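/- Let $\mathbb I=[0,1]$, and let $y,\varepsilon$ be real numbers with $0\le y\le 1$, $\varepsilon\ge 0$ and $0<y+\varepsilon\le 1$. **The space $S(y,\varepsilon)\subset\mathbb R^3$.** For $n\ge 1$ put $$A_n=\left(\tfrac1{2n-1},0,0\right),\quad B_n=\left(\tfrac1{2n},1,0\right),\quad C_n=\left(\tfrac1{2n-1},\,y+\tfrac{\varepsilon}{2n-1},0\right),\quad D_n=\left(\tfrac1{2n},\,1-y-\tfrac{\varepsilon}{2n},0\right),$$ $$\overline E_n=\left(\tfrac1{2n-1},\ \tfrac12\left(y+\tfrac{\varepsilon}{2n-1}\right),\ \tfrac1{2(2n-1)}\right),\qquad \overline F_n=\left(\tfrac1{2n},\ \tfrac12\left(2-y-\tfrac{\varepsilon}{2n}\right),\ \tfrac1{4n}\right).$$ Let $H_{2n-1}$ be the convex hull of $A_n,B_n,C_n,D_n,\overline E_n,\overline F_n$, let $H_{2n}$ be the convex hull of $A_{n+1},B_n,C_{n+1},D_n,\overline F_n,\overline E_{n+1}$, let $H_\infty=\bigcup_{n\ge1}H_n$, let $\partial H_\infty$ be the topological boundary of $H_\infty$ in $\mathbb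 R^3$, and let $\Delta$ be the open triangle (without its sides) with vertices $A_1,C_1,\overline E_1$. Then $$S(y,\varepsilon)=\left((\mathbb I^2\times\{0\})\cup\partial H_\infty\right)\setminus\Delta .$$ **The space $SC(S^1)$.** Let $T\subset\mathbb I^2$ be the piecewise linear topologist's sine curve, that is, the union of the segment from $(0,0)$ to $(0,1)$ and of the segments from $(2^{-n},0)$ to $(2^{-n},1)$ and from $(2^{-n},1)$ to $(2^{-n-1},0)$, $n\ge0$. Let $s_0$ be any point of the circle $S^1$. Then $SC(S^1)$ is the quotient space of the topological sum of $\mathbb I^2$ and $T\times S^1$ obtained by identifying $(t,s_0)$ with $t\in\mathbb I^2$ for every $t\in T$, and identifying each set $\{t\}\times S^1$ with $t$ for $t\in\{0\}\times\mathbb I$. **The Griffiths space $\mathcal G$.** Let $\mathbb H=\bigcup_{m\ge1}\{(u,v)\in\mathbb R^2:(u-\frac1m)^2+v^2=\frac1{m^2}\}$ be the Hawaiian earring, and let $C(\mathbb H)$ be its cone, the quotient of $\mathbb H\times\mathbb I$ by $\mathbb H\times\{1\}$, with $\mathbb H$ identified with $\mathbb H\times\{0\}\subset C(\mathbb H)$.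 Then $\mathcal G$ is the one-point union of two copies of $C(\mathbb H)$, obtained by identifying the two copies of the point $(0,0)\in\mathbb H$. **Theorem.** The following hold. 1. If $1/2<y\le1$, then the spaces $S(1,0)$ and $S(y,\varepsilon)$ are contractible. 2. If $y=0$, then $S(y,\varepsilon)$ is homotopy equivalent to $SC(S^1)$, for every choice of $s_0\in S^1$. 3. If $0<y\le1/2$, then $S(y,\varepsilon)$ is homotopy equivalent to $\mathcal G$. -/

import Mathlib

open scoped ContinuousMap

/-! ### The spaces `S(y, ε) ⊂ ℝ³`

Points of `ℝ³` are triples; only the topology and the affine structure are used. -/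

/-- The unit square `𝕀² × {0}` in `ℝ³`. -/
def flatSquare : Set (ℝ × ℝ × ℝ) :=
  {p | p.1 ∈ Set.Icc (0 : ℝ) 1 ∧ p.2.1 ∈ Set.Icc (0 : ℝ) 1 ∧ p.2.2 = 0}

/-- `A_n = (1/(2n-1), 0, 0)`, for `n ≥ 1`. -/
noncomputable def ptA (n : ℕ) : ℝ × ℝ × ℝ := (1 / (2 * (n : ℝ) - 1), 0, 0)

/-- `B_n = (1/(2n), 1, 0)`, for `n ≥ 1`. -/
noncomputable def ptB (n : ℕ) : ℝ × ℝ × ℝ := (1 / (2 * (n : ℝ)), 1, 0)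

/-- `C_n = (1/(2n-1), y + ε/(2n-1), 0)`, for `n ≥ 1`. -/
noncomputable def ptC (y ε : ℝ) (n : ℕ) : ℝ × ℝ × ℝ :=
  (1 / (2 * (n : ℝ) - 1), y + ε / (2 * (n : ℝ) - 1), 0)

/-- `D_n = (1/(2n), 1 - y - ε/(2n), 0)`, for `n ≥ 1`. -/
noncomputable def ptD (y ε : ℝ) (n : ℕ) : ℝ × ℝ × ℝ :=
  (1 / (2 * (n : ℝ)), 1 - y - ε / (2 * (n : ℝ)), 0)

/-- The point over the midpoint of `A_n C_n` at height half its first coordinate, for `n ≥ 1`. -/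
noncomputable def ptE (y ε : ℝ) (n : ℕ) : ℝ × ℝ × ℝ :=
  (1 / (2 * (n : ℝ) - 1), (1 / 2) * (y + ε / (2 * (n : ℝ) - 1)), 1 / (2 * (2 * (n : ℝ) - 1)))

/-- The point over the midpoint of `B_n D_n` at height half its first coordinate, for `n ≥ 1`. -/
noncomputable def ptF (y ε : ℝ) (n : ℕ) : ℝ × ℝ × ℝ :=
  (1 / (2 * (n : ℝ)), (1 / 2) * (2 - y - ε / (2 * (n : ℝ))), 1 / (4 * (n : ℝ)))

/-- The solid `H_{2n-1}`, for `n ≥ 1`. -/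
def tubeOdd (y ε : ℝ) (n : ℕ) : Set (ℝ × ℝ × ℝ) :=
  convexHull ℝ {ptA n, ptB n, ptC y ε n, ptD y ε n, ptE y ε n, ptF y ε n}

/-- The solid `H_{2n}`, for `n ≥ 1`. -/
def tubeEven (y ε : ℝ) (n : ℕ) : Set (ℝ × ℝ × ℝ) :=
  convexHull ℝ {ptA (n + 1), ptB n, ptC y ε (n + 1), ptD y ε n, ptF y ε n, ptE y ε (n + 1)}

/-- The solid infinite tube `H_∞`, the union of all `H_n` with `n ≥ 1`. -/
def solidTube (y ε : ℝ) : Set (ℝ × ℝ × ℝ) :=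
  ⋃ n ∈ {n : ℕ | 1 ≤ n}, tubeOdd y ε n ∪ tubeEven y ε n

/-- The open triangle (without its sides and vertices) with vertices `P`, `Q`, `R`. -/
def openTriangle (P Q R : ℝ × ℝ × ℝ) : Set (ℝ × ℝ × ℝ) :=
  {p | ∃ a b c : ℝ, 0 < a ∧ 0 < b ∧ 0 < c ∧ a + b + c = 1 ∧ a • P + b • Q + c • R = p}

/-- The space `S(y, ε)`: the square together with the boundary in `ℝ³` of the solid tube, with the
open triangle at the end of the tube removed. It carries the subspace topology. -/
def plSpace (y ε : ℝ) : Set (ℝ × ℝ × ℝ) :=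
  (flatSquare ∪ frontier (solidTube y ε)) \ openTriangle (ptA 1) (ptC y ε 1) (ptE y ε 1)

/-! ### The space `SC(X)` -/

/-- The unit square `𝕀²` in the plane. -/
def unitSquare : Set (ℝ × ℝ) := Set.Icc (0 : ℝ) 1 ×ˢ Set.Icc (0 : ℝ) 1

/-- The piecewise linear topologist's sine curve in the square: the union of the limit segment `AB`
from `(0, 0)` to `(0, 1)` and the broken line `A_1 B_1 A_2 B_2 ...`, where (counting from `n = 0`)
the vertices are `(1/2ⁿ, 0)` and `(1/2ⁿ, 1)`. -/
def sineCurve : Set (ℝ × ℝ) :=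
  segment ℝ (0, 0) (0, 1) ∪
    ⋃ n : ℕ, segment ℝ ((1 / 2 : ℝ) ^ n, (0 : ℝ)) ((1 / 2 : ℝ) ^ n, 1) ∪
      segment ℝ ((1 / 2 : ℝ) ^ n, (1 : ℝ)) ((1 / 2 : ℝ) ^ (n + 1), 0)

/-- The identifications on the topological sum of `𝕀²` and `T × X`: a point `t` of `T ⊆ 𝕀²` is
identified with `(t, x₀)`, and, if `t` lies on `{0} × 𝕀`, with `(t, x)` for every `x`. -/
inductive SCRel (X : Type) (x₀ : X) :
    (unitSquare ⊕ (sineCurve × X)) → (unitSquare ⊕ (sineCurve × X)) → Prop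
  | base (p : unitSquare) (t : sineCurve) (h : (p : ℝ × ℝ) = t) :
      SCRel X x₀ (Sum.inl p) (Sum.inr (t, x₀))
  | collapse (p : unitSquare) (t : sineCurve) (x : X) (h : (p : ℝ × ℝ) = t)
      (h0 : (t : ℝ × ℝ).1 = 0) : SCRel X x₀ (Sum.inl p) (Sum.inr (t, x))

/-- The space `SC(X)` of a pointed space `(X, x₀)`, with the quotient topology. -/
abbrev SCSpace (X : Type) [TopologicalSpace X] (x₀ : X) : Type := Quot (SCRel X x₀)

/-! ### The Griffiths space -/

/-- The Hawaiian earring in the plane. -/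
def hawaiianEarring : Set (ℝ × ℝ) :=
  {p | ∃ m : ℕ, 1 ≤ m ∧ (p.1 - 1 / (m : ℝ)) ^ 2 + p.2 ^ 2 = (1 / (m : ℝ)) ^ 2}

/-- The point `(0, 0)` of the Hawaiian earring. -/
def earringPoint : hawaiianEarring := ⟨(0, 0), 1, le_refl 1, by norm_num⟩

/-- The cone over `X`: the quotient of `X × 𝕀` by `X × {1}`. -/
abbrev TopCone (X : Type) [TopologicalSpace X] : Type :=
  Quot (fun p q : X × unitInterval => p.2 = 1 ∧ q.2 = 1)

/-- The inclusion of `X` into its cone as the base `X × {0}`. -/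
def TopCone.ofBase {X : Type} [TopologicalSpace X] (x : X) : TopCone X := Quot.mk _ (x, 0)

/-- The one-point union of the pointed spaces `(X, x)` and `(Y, y)`, with the quotient topology. -/
abbrev OnePointUnion {X Y : Type} [TopologicalSpace X] [TopologicalSpace Y] (x : X) (y : Y) :
    Type :=
  Quot (fun a b : X ⊕ Y => a = Sum.inl x ∧ b = Sum.inr y)

/-- The Griffiths space: two cones over the Hawaiian earring, glued at the point `(0, 0)` of the
two base copies of the earring. -/
abbrev GriffithsSpace : Type :=
  OnePointUnion (TopCone.ofBase earringPoint) (TopCone.ofBase earringPoint)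

/-!
The tube is the region between the square and the graph of a continuous function `roof` on the
square that is positive exactly over an open strip `l x < v < l x + y + ε x`, `0 < x`, where `l`
oscillates between the bottom of the square and the height `1 - y - ε x`. So
`S(y, ε)` is the unit square doubled along the zero set of `roof`, which consists of the side
`x = 0` and the complement of the strip (`plSpace_eq_doubleSquare`). A map out of a doubled square is a pair
of maps of the square that agree on the zero set, and the homotopy type does not change when the
boundaries of the strip are perturbed by `O(x)`, in position and in relative width
(`nonempty_homotopyEquiv_of_strips`). This allows the normalizations of the strips below.

* For `1 / 2 < y` the strip contains a horizontal strip around the middle line. A vertical stretch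
  moves the zero set into three sides of the square, and the square doubled along three sides is
  contractible (`contractibleSpace_doubleSquare`).

* For `y = 0` the width of the strip is `ε x`. The upper sheet over the strip is a family of
  vertical arcs attached to the square, parametrized by a sine curve, whose arcs over the limit segment are
  degenerate. The end points of such a family may be moved by homotopies relative to the limit
  segment (`ArcSpace.nonempty_homotopyEquiv_start`), and any two choices are homotopic since the
  square is convex. With both end points on the piecewise linear sine curve this is `SC(S¹)`.

* For `0 < y ≤ 1 / 2` the complement of the strip consists of fingers, which rise from the bottom
  and hang from the top, and cluster at the side `x = 0`. Each sheet retracts horizontally to this side,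
  and a point `w` of a finger yields a loop: from the side through the flat sheet to `w`, and back
  through the upper sheet. With the fingers enlarged to a `collar` of the complement of width
  `O(x)`, the doubled square is homotopy equivalent to the segment `x = 0` with a loop attached at
  the height of each point of the collar, degenerate for the points on the side itself
  (`nonempty_homotopyEquiv_collarLoops`): the position in the collar provides the parameter of the
  loop, and continuity at `x = 0` comes from the tube lemma (`continuous_of_collapse`). The lower
  fingers are joined along the bottom of the square and the upper ones along the top, at heights
  where the fan has its two common ends; so the fingers may be replaced by the leaves of a `fan`,
  which are segments (`nonempty_homotopyEquiv_fanLoops`). The loops over one leaf form a cone over a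
  circle, and together they form the two cones over Hawaiian earrings that make up the Griffiths
  space (`nonempty_homeomorph_griffithsSpace`).
-/

open Set Topology Filter

/-! ### Homotopies, homeomorphisms and the tube lemma -/

section General

variable {A B V X W X' W' Y K : Type*} [TopologicalSpace A] [TopologicalSpace B]
  [TopologicalSpace V] [TopologicalSpace X] [TopologicalSpace W] [TopologicalSpace X']
  [TopologicalSpace W'] [TopologicalSpace Y] [TopologicalSpace K]

theorem homotopic_of_family {f g : C(A, B)} (H : A → unitInterval → B)
    (hH : Continuous fun p : A × unitInterval => H p.1 p.2) (h0 : ∀ a, H a 0 = f a)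
    (h1 : ∀ a, H a 1 = g a) : f.Homotopic g :=
  ⟨{ toFun := fun p => H p.2 p.1
     continuous_toFun := hH.comp continuous_swap
     map_zero_left := h0
     map_one_left := h1 }⟩

/-- Compact spaces that map continuously and injectively to a Hausdorff space, with the same image,
are homeomorphic. -/
theorem nonempty_homeomorph_of_range_eq [CompactSpace A] [CompactSpace B] [T2Space V]
    {f : A → V} {g : B → V} (hf : Continuous f) (hg : Continuous g)
    (hfi : Function.Injective f) (hgi : Function.Injective g) (h : range f = range g) :
    Nonempty (A ≃ₜ B) :=
  ⟨(hf.isClosedEmbedding hfi).isEmbedding.toHomeomorph.trans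
    ((Homeomorph.setCongr h).trans (hg.isClosedEmbedding hgi).isEmbedding.toHomeomorph.symm)⟩

/-- A function of `(w, θ, k)`, with `θ` in the compact unit interval, may be composed with a map `θ`
that is discontinuous where `w` lies in a set on which the function does not depend on `θ`. This is
how all continuity statements at the limit segment are obtained. -/
theorem continuous_of_collapse {WL : Set W} {γ : W → unitInterval → K → V}
    (hγ : Continuous fun p : W × unitInterval × K => γ p.1 p.2.1 p.2.2)
    (hc : ∀ w ∈ WL, ∀ θ k, γ w θ k = γ w 0 k)
    {w : Y → W} {θ : Y → unitInterval} {k : Y → K} (hw : Continuous w)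
    (hθ : ∀ y, w y ∉ WL → ContinuousAt θ y) (hk : Continuous k) :
    Continuous fun y => γ (w y) (θ y) (k y) := by
  rw [continuous_iff_continuousAt]
  intro y
  by_cases hy : w y ∈ WL
  · rw [ContinuousAt, tendsto_nhds]
    intro U hU hyU
    have hn : IsOpen {p : unitInterval × (W × K) | γ p.2.1 p.1 p.2.2 ∈ U} :=
      hU.preimage (hγ.comp (by fun_prop :
        Continuous fun p : unitInterval × (W × K) => (p.2.1, p.1, p.2.2)))
    obtain ⟨u, v, -, hv, hu', hv', huv⟩ := generalized_tube_lemma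
      (isCompact_univ (X := unitInterval)) (isCompact_singleton (x := (w y, k y))) hn (by
        rintro ⟨t, p⟩ ⟨-, rfl⟩
        simp only [mem_ofPred_eq] at hyU ⊢
        rwa [hc _ hy, ← hc _ hy (θ y)])
    filter_upwards [(hw.prodMk hk).continuousAt (hv.mem_nhds (hv' rfl))] with z hz
    exact huv (show (θ z, (w z, k z)) ∈ u ×ˢ v from ⟨hu' trivial, hz⟩)
  · exact hγ.continuousAt.comp (f := fun y => (w y, θ y, k y))
      (hw.continuousAt.prodMk ((hθ y hy).prodMk hk.continuousAt))

end General

/-! ### Spaces with attached arcs -/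

/-- The identifications on the topological sum of `X` and `W × 𝕀` which attach the arc `{w} × 𝕀` to
`X` with end points `f₀ w` and `f₁ w`, and collapse it to a point for `w ∈ L`. -/
inductive ArcRel {X W : Type} (f₀ f₁ : W → X) (L : Set W) :
    X ⊕ (W × unitInterval) → X ⊕ (W × unitInterval) → Prop
  | start (w : W) : ArcRel f₀ f₁ L (Sum.inr (w, 0)) (Sum.inl (f₀ w))
  | finish (w : W) : ArcRel f₀ f₁ L (Sum.inr (w, 1)) (Sum.inl (f₁ w))
  | collapse (w : W) (θ : unitInterval) (h : w ∈ L) :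
      ArcRel f₀ f₁ L (Sum.inr (w, θ)) (Sum.inl (f₀ w))

/-- The space obtained from `X` by attaching an arc from `f₀ w` to `f₁ w` for each `w : W`, where
the arcs over `L ⊆ W` are degenerate. In the quotient topology the arcs shrink near `L`. -/
abbrev ArcSpace {X W : Type} [TopologicalSpace X] [TopologicalSpace W] (f₀ f₁ : W → X)
    (L : Set W) : Type := Quot (ArcRel f₀ f₁ L)

namespace ArcSpace

variable {X W X' W' V K : Type} [TopologicalSpace X] [TopologicalSpace W] [TopologicalSpace X']
  [TopologicalSpace W'] [TopologicalSpace V] [TopologicalSpace K]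
  {f₀ f₁ : W → X} {L : Set W} {g₀ g₁ : W' → X'} {L' : Set W'}

/-- The inclusion of `X` into the space with attached arcs. -/
def pt (f₀ f₁ : W → X) (L : Set W) (x : X) : ArcSpace f₀ f₁ L := Quot.mk _ (Sum.inl x)

/-- The arc over `w`, with its parameter clamped to `[0, 1]`. -/
noncomputable def arc (f₀ f₁ : W → X) (L : Set W) (w : W) (θ : ℝ) : ArcSpace f₀ f₁ L :=
  Quot.mk _ (Sum.inr (w, projIcc 0 1 zero_le_one θ))

theorem continuous_pt : Continuous (pt f₀ f₁ L) := continuous_quot_mk.comp continuous_inl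

theorem continuous_arc : Continuous fun p : W × ℝ => arc f₀ f₁ L p.1 p.2 :=
  continuous_quot_mk.comp (continuous_inr.comp
    (continuous_fst.prodMk (continuous_projIcc.comp continuous_snd)))

theorem arc_of_le_zero (w : W) {θ : ℝ} (h : θ ≤ 0) : arc f₀ f₁ L w θ = pt f₀ f₁ L (f₀ w) := by
  rw [arc, projIcc_of_le_left _ h]
  exact Quot.sound (ArcRel.start w)

theorem arc_of_one_le (w : W) {θ : ℝ} (h : 1 ≤ θ) : arc f₀ f₁ L w θ = pt f₀ f₁ L (f₁ w) := by
  rw [arc, projIcc_of_right_le _ h]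
  exact Quot.sound (ArcRel.finish w)

theorem arc_of_mem {w : W} (h : w ∈ L) (θ : ℝ) : arc f₀ f₁ L w θ = pt f₀ f₁ L (f₀ w) :=
  Quot.sound (ArcRel.collapse w _ h)

theorem exists_rep (q : ArcSpace f₀ f₁ L) : (∃ x, q = pt f₀ f₁ L x) ∨
    ∃ w, w ∉ L ∧ ∃ θ : unitInterval, 0 < (θ : ℝ) ∧ (θ : ℝ) < 1 ∧ q = arc f₀ f₁ L w θ := by
  obtain ⟨x | ⟨w, θ⟩, rfl⟩ := Quot.exists_rep q
  · exact Or.inl ⟨x, rfl⟩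
  · have e : Quot.mk (ArcRel f₀ f₁ L) (Sum.inr (w, θ)) = arc f₀ f₁ L w θ := by
      rw [arc, projIcc_val]
    rw [e]
    by_cases hw : w ∈ L
    · exact Or.inl ⟨_, arc_of_mem hw _⟩
    · rcases θ.2.1.eq_or_lt with h | h
      · exact Or.inl ⟨_, arc_of_le_zero w h.ge⟩
      rcases θ.2.2.eq_or_lt with h' | h'
      · exact Or.inl ⟨_, arc_of_one_le w h'.ge⟩
      · exact Or.inr ⟨w, hw, θ, h, h', rfl⟩

/-- The function on a space with attached arcs that is given by `α` on `X` and by `γ` on the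
arcs. -/
def desc (f₀ f₁ : W → X) (L : Set W) (α : X → V) (γ : W → unitInterval → V)
    (h0 : ∀ w, γ w 0 = α (f₀ w)) (h1 : ∀ w, γ w 1 = α (f₁ w))
    (hc : ∀ w ∈ L, ∀ θ, γ w θ = α (f₀ w)) : ArcSpace f₀ f₁ L → V :=
  Quot.lift (Sum.elim α fun p => γ p.1 p.2) (by
    rintro _ _ (w | w | ⟨w, θ, h⟩)
    · exact h0 w
    · exact h1 w
    · exact hc w h θ)

theorem continuous_desc {α : X → V} {γ : W → unitInterval → V} {h0 h1 hc} (hα : Continuous α)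
    (hγ : Continuous fun p : W × unitInterval => γ p.1 p.2) :
    Continuous (desc f₀ f₁ L α γ h0 h1 hc) :=
  continuous_quot_lift _ (hα.sumElim hγ)

omit [TopologicalSpace V] in
theorem desc_arc {α : X → V} {γ : W → unitInterval → V} {h0 h1 hc} (w : W) (θ : unitInterval) :
    desc f₀ f₁ L α γ h0 h1 hc (arc f₀ f₁ L w θ) = γ w θ := by
  rw [arc, projIcc_val]
  rfl

omit [TopologicalSpace V] in
theorem desc_injective {α : X → V} {γ : W → unitInterval → V} {h0 h1 hc}
    (hα : Function.Injective α)
    (hγ : ∀ w ∉ L, ∀ w' ∉ L, ∀ θ θ' : unitInterval, 0 < (θ : ℝ) → (θ : ℝ) < 1 →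
      0 < (θ' : ℝ) → (θ' : ℝ) < 1 → γ w θ = γ w' θ' → w = w' ∧ θ = θ')
    (hαγ : ∀ x, ∀ w ∉ L, ∀ θ : unitInterval, 0 < (θ : ℝ) → (θ : ℝ) < 1 → α x ≠ γ w θ) :
    Function.Injective (desc f₀ f₁ L α γ h0 h1 hc) := by
  intro a b hab
  rcases exists_rep a with ⟨x, rfl⟩ | ⟨w, hw, θ, hθ0, hθ1, rfl⟩ <;>
  rcases exists_rep b with ⟨x', rfl⟩ | ⟨w', hw', θ', hθ0', hθ1', rfl⟩
  · rw [hα (show α x = α x' from hab)]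
  · rw [desc_arc] at hab
    exact absurd hab (hαγ _ _ hw' _ hθ0' hθ1')
  · rw [desc_arc] at hab
    exact absurd hab.symm (hαγ _ _ hw _ hθ0 hθ1)
  · rw [desc_arc, desc_arc] at hab
    obtain ⟨rfl, rfl⟩ := hγ _ hw _ hw' _ _ hθ0 hθ1 hθ0' hθ1' hab
    rfl

/-- Maps out of a space with attached arcs are homotopic by a homotopy given on `X` and on the
arcs. -/
theorem homotopic_of_family {F G : C(ArcSpace f₀ f₁ L, V)} (α : X → unitInterval → V)
    (γ : W → unitInterval → unitInterval → V)
    (hα : Continuous fun p : X × unitInterval => α p.1 p.2)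
    (hγ : Continuous fun p : W × unitInterval × unitInterval => γ p.1 p.2.1 p.2.2)
    (h0 : ∀ w s, γ w 0 s = α (f₀ w) s) (h1 : ∀ w s, γ w 1 s = α (f₁ w) s)
    (hc : ∀ w ∈ L, ∀ θ s, γ w θ s = α (f₀ w) s)
    (hF : ∀ x, F (pt f₀ f₁ L x) = α x 0) (hF' : ∀ w, ∀ θ : unitInterval,
      F (arc f₀ f₁ L w θ) = γ w θ 0)
    (hG : ∀ x, G (pt f₀ f₁ L x) = α x 1) (hG' : ∀ w, ∀ θ : unitInterval,
      G (arc f₀ f₁ L w θ) = γ w θ 1) : F.Homotopic G := by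
  refine _root_.homotopic_of_family (fun a s => desc f₀ f₁ L (fun x => α x s) (fun w θ => γ w θ s)
    (fun w => h0 w s) (fun w => h1 w s) (fun w hw θ => hc w hw θ s) a) ?_ ?_ ?_
  · refine (isQuotientMap_quot_mk (r := ArcRel f₀ f₁ L)).continuous_lift_prod_left ?_
    refine (Homeomorph.sumProdDistrib (X := X) (Y := W × unitInterval)
      (Z := unitInterval)).symm.isQuotientMap.continuous_iff.2 ?_
    refine continuous_sum_dom.2 ⟨hα, ?_⟩
    exact hγ.comp (by fun_prop :
      Continuous fun p : (W × unitInterval) × unitInterval => (p.1.1, p.1.2, p.2))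
  · intro a
    rcases exists_rep a with ⟨x, rfl⟩ | ⟨w, -, θ, -, -, rfl⟩
    · exact (hF x).symm
    · rw [hF', desc_arc]
  · intro a
    rcases exists_rep a with ⟨x, rfl⟩ | ⟨w, -, θ, -, -, rfl⟩
    · exact (hG x).symm
    · rw [hG', desc_arc]

/-- The map between spaces with attached arcs that is induced by maps `ψ` and `a` of the bases and
of the parameter spaces of the arcs. -/
noncomputable def map (g₀ g₁ : W' → X') (L' : Set W') (ψ : C(X, X')) (a : C(W, W'))
    (h0 : ∀ w, g₀ (a w) = ψ (f₀ w)) (h1 : ∀ w, g₁ (a w) = ψ (f₁ w)) (hL : ∀ w ∈ L, a w ∈ L') :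
    C(ArcSpace f₀ f₁ L, ArcSpace g₀ g₁ L') where
  toFun := desc f₀ f₁ L (fun x => pt g₀ g₁ L' (ψ x)) (fun w θ => arc g₀ g₁ L' (a w) θ)
    (fun w => by rw [arc_of_le_zero _ (by simp), h0])
    (fun w => by rw [arc_of_one_le _ (by simp), h1])
    (fun w hw θ => by rw [arc_of_mem (hL w hw), h0])
  continuous_toFun := continuous_desc (continuous_pt.comp ψ.continuous)
    (continuous_arc.comp (by fun_prop :
      Continuous fun p : W × unitInterval => (a p.1, (p.2 : ℝ))))

theorem map_pt {ψ : C(X, X')} {a : C(W, W')} {h0 h1 hL} (x : X) :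
    map (f₀ := f₀) (f₁ := f₁) (L := L) g₀ g₁ L' ψ a h0 h1 hL (pt f₀ f₁ L x) =
      pt g₀ g₁ L' (ψ x) := rfl

theorem map_arc {ψ : C(X, X')} {a : C(W, W')} {h0 h1 hL} (w : W) (θ : unitInterval) :
    map (f₀ := f₀) (f₁ := f₁) (L := L) g₀ g₁ L' ψ a h0 h1 hL (arc f₀ f₁ L w θ) =
      arc g₀ g₁ L' (a w) θ := by
  rw [map, ContinuousMap.coe_mk, desc_arc]

/-- A deformation of the base and of the parameter space of the arcs, compatible with the attaching
maps, deforms the space with attached arcs. -/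
theorem homotopic_of_deformation {F G : C(ArcSpace f₀ f₁ L, ArcSpace f₀ f₁ L)}
    (ψ : X → unitInterval → X) (a : W → unitInterval → W)
    (hψ : Continuous fun p : X × unitInterval => ψ p.1 p.2)
    (ha : Continuous fun p : W × unitInterval => a p.1 p.2)
    (h0 : ∀ w s, f₀ (a w s) = ψ (f₀ w) s) (h1 : ∀ w s, f₁ (a w s) = ψ (f₁ w) s)
    (hL : ∀ w ∈ L, ∀ s, a w s ∈ L)
    (hF : ∀ x, F (pt f₀ f₁ L x) = pt f₀ f₁ L (ψ x 0))
    (hF' : ∀ w, ∀ θ : unitInterval, F (arc f₀ f₁ L w θ) = arc f₀ f₁ L (a w 0) θ)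
    (hG : ∀ x, G (pt f₀ f₁ L x) = pt f₀ f₁ L (ψ x 1))
    (hG' : ∀ w, ∀ θ : unitInterval, G (arc f₀ f₁ L w θ) = arc f₀ f₁ L (a w 1) θ) :
    F.Homotopic G := by
  refine homotopic_of_family (fun x s => pt f₀ f₁ L (ψ x s))
    (fun w θ s => arc f₀ f₁ L (a w s) θ) (continuous_pt.comp hψ) ?_ ?_ ?_ ?_ hF hF' hG hG'
  · exact continuous_arc.comp ((ha.comp (by fun_prop :
      Continuous fun p : W × unitInterval × unitInterval => (p.1, p.2.2))).prodMk (by fun_prop))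
  · intro w s
    rw [arc_of_le_zero _ (by simp), h0]
  · intro w s
    rw [arc_of_one_le _ (by simp), h1]
  · intro w hw θ s
    rw [arc_of_mem (hL w hw s), h0]

/-- An arc of the space in which the arc over `w` starts at `F w 0`, extended to negative parameters
by the path `F w`. -/
noncomputable def extendedArc (F : W → unitInterval → X) (f f₁ : W → X) (L : Set W) (w : W)
    (θ : ℝ) : ArcSpace f f₁ L :=
  if θ ≤ 0 then pt f f₁ L (F w (projIcc 0 1 zero_le_one (-θ))) else arc f f₁ L w θ

section Reattach

variable {F : W → unitInterval → X} {f f' : W → X}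

theorem continuous_extendedArc (hF : Continuous fun p : W × unitInterval => F p.1 p.2)
    (h0 : ∀ w, F w 0 = f w) :
    Continuous fun p : W × ℝ => extendedArc F f f₁ L p.1 p.2 := by
  refine Continuous.if_le ?_ continuous_arc (by fun_prop) (by fun_prop) ?_
  · have : Continuous fun p : W × ℝ => projIcc (0 : ℝ) 1 zero_le_one (-p.2) :=
      continuous_projIcc.comp (by fun_prop)
    exact continuous_pt.comp (hF.comp (continuous_fst.prodMk this))
  · intro p hp
    rw [arc_of_le_zero _ hp.le, projIcc_of_le_left _ (by linarith)]
    exact congrArg _ (h0 _)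

theorem extendedArc_of_mem (hL : ∀ w ∈ L, ∀ s, F w s = f w) {w : W} (hw : w ∈ L) (θ : ℝ) :
    extendedArc F f f₁ L w θ = pt f f₁ L (f w) := by
  rw [extendedArc]
  split_ifs
  · rw [hL w hw]
  · exact arc_of_mem hw θ

/-- Moving the starting points of the arcs along the paths `F w`, which are constant for `w ∈ L`:
the new arc over `w` runs along `F w` first. -/
noncomputable def reattach (hF : Continuous fun p : W × unitInterval => F p.1 p.2) (f₁ : W → X)
    (h0 : ∀ w, F w 0 = f w) (h1 : ∀ w, F w 1 = f' w) (hL : ∀ w ∈ L, ∀ s, F w s = f w) :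
    C(ArcSpace f' f₁ L, ArcSpace f f₁ L) where
  toFun := desc _ _ _ (pt _ _ _) (fun w θ => extendedArc F f f₁ L w (2 * (θ : ℝ) - 1))
    (fun w => by simp [extendedArc, h1])
    (fun w => by
      rw [extendedArc, if_neg (by norm_num), arc_of_one_le _ (by norm_num)])
    (fun w hw θ => by rw [extendedArc_of_mem hL hw, ← h1, hL w hw])
  continuous_toFun := continuous_desc continuous_pt ((continuous_extendedArc hF h0).comp
    (by fun_prop : Continuous fun p : W × unitInterval => (p.1, 2 * (p.2 : ℝ) - 1)))

variable {hF : Continuous fun p : W × unitInterval => F p.1 p.2} {h0 : ∀ w, F w 0 = f w}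
  {h1 : ∀ w, F w 1 = f' w} {hL : ∀ w ∈ L, ∀ s, F w s = f w}

theorem reattach_pt (x : X) : reattach hF f₁ h0 h1 hL (pt f' f₁ L x) = pt f f₁ L x := rfl

theorem reattach_arc (w : W) {θ : ℝ} (hθ : 0 ≤ θ) :
    reattach hF f₁ h0 h1 hL (arc f' f₁ L w θ) = extendedArc F f f₁ L w (2 * θ - 1) := by
  by_cases h : θ ≤ 1
  · lift θ to unitInterval using ⟨hθ, h⟩
    rw [reattach, ContinuousMap.coe_mk, desc_arc]
  · push Not at h
    rw [arc_of_one_le _ h.le, extendedArc, if_neg (by linarith), arc_of_one_le _ (by linarith)]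
    rfl

variable {F' : W → unitInterval → X} {hF' : Continuous fun p : W × unitInterval => F' p.1 p.2}
  {h0' : ∀ w, F' w 0 = f' w} {h1' : ∀ w, F' w 1 = f w} {hL' : ∀ w ∈ L, ∀ s, F' w s = f' w}

/-- Reattaching along a homotopy and then along its reverse: the arc over `w` runs back and forth
along `F w` before it runs along the original arc. The homotopy shortens this excursion. -/
theorem reattach_comp_reattach (hFF' : ∀ w s, F' w s = F w (unitInterval.symm s)) :
    ((reattach hF f₁ h0 h1 hL).comp (reattach hF' f₁ h0' h1' hL')).Homotopic
      (ContinuousMap.id _) := by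
  refine homotopic_of_family (fun x _ => pt f f₁ L x)
    (fun w θ s => if (θ : ℝ) ≤ (1 - s) / 2 then
        pt f f₁ L (F w (projIcc 0 1 zero_le_one (2 * (θ : ℝ))))
      else extendedArc F f f₁ L w
        (-(1 - s) + (θ - (1 - s) / 2) * (2 - s) / (1 - (1 - s) / 2))) ?_ ?_ ?_ ?_ ?_ ?_ ?_ ?_ ?_
  · exact continuous_pt.comp continuous_fst
  · refine Continuous.if_le ?_ ?_ (by fun_prop) (by fun_prop) ?_
    · have : Continuous fun p : W × unitInterval × unitInterval =>
          projIcc (0 : ℝ) 1 zero_le_one (2 * (p.2.1 : ℝ)) := continuous_projIcc.comp (by fun_prop)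
      exact continuous_pt.comp (hF.comp (continuous_fst.prodMk this))
    · refine (continuous_extendedArc hF h0).comp (continuous_fst.prodMk ?_)
      refine Continuous.add (by fun_prop) (Continuous.div (by fun_prop) (by fun_prop) ?_)
      intro p
      have := p.2.2.2.1
      exact ne_of_gt (by linarith)
    · rintro ⟨w, θ, s⟩ h
      dsimp only at h ⊢
      have := s.2.2
      rw [h, extendedArc, if_pos (by simpa using this)]
      ring_nf
  · intro w s
    have := s.2.2
    rw [if_pos (by simp only [Set.Icc.coe_zero]; linarith)]
    simp [h0]
  · intro w s
    have h2 := s.2.1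
    have h3 := s.2.2
    have e : (-(1 - (s : ℝ)) + ((1 : ℝ) - (1 - s) / 2) * (2 - s) / (1 - (1 - s) / 2)) = 1 := by
      rw [mul_div_assoc, mul_div_cancel₀ _ (by linarith)]
      ring
    rw [if_neg (by push_cast; linarith), Set.Icc.coe_one, e, extendedArc, if_neg (by norm_num),
      arc_of_one_le _ le_rfl]
  · intro w hw θ s
    split_ifs
    · rw [hL w hw]
    · exact extendedArc_of_mem hL hw _
  · intro x
    rfl
  · intro w θ
    rw [ContinuousMap.comp_apply, reattach_arc _ θ.2.1, extendedArc]
    have h2 := θ.2.1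
    have h3 := θ.2.2
    simp only [Set.Icc.coe_zero, sub_zero]
    by_cases h : (θ : ℝ) ≤ 1 / 2
    · rw [if_pos (by linarith), if_pos h, reattach_pt, hFF']
      congr 2
      ext
      simp only [unitInterval.coe_symm_eq, coe_projIcc]
      rw [min_eq_right (by linarith), min_eq_right (by linarith), max_eq_right (by linarith),
        max_eq_right (by linarith)]
      ring
    · push Not at h
      rw [if_neg (by linarith), if_neg (by linarith), reattach_arc _ (by linarith)]
      congr 1
      ring
  · intro x
    rfl
  · intro w θ
    have h2 := θ.2.1
    simp only [Set.Icc.coe_one, sub_self, zero_div, ContinuousMap.id_apply]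
    split_ifs with h
    · rw [arc_of_le_zero _ h, projIcc_of_le_left _ (by linarith)]
      exact congrArg _ (h0 w).symm
    · rw [extendedArc, if_neg (by push Not at h; linarith)]
      congr 1
      ring

end Reattach

/-- The homotopy type of a space with attached arcs depends only on the homotopy class, relative to
`L`, of the map which gives the starting points of the arcs. -/
theorem nonempty_homotopyEquiv_start (F : W → unitInterval → X)
    (hF : Continuous fun p : W × unitInterval => F p.1 p.2) {f f' : W → X} (f₁ : W → X)
    (h0 : ∀ w, F w 0 = f w) (h1 : ∀ w, F w 1 = f' w) (hL : ∀ w ∈ L, ∀ s, F w s = f w) :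
    Nonempty (ArcSpace f f₁ L ≃ₕ ArcSpace f' f₁ L) := by
  have hF' : Continuous fun p : W × unitInterval => F p.1 (unitInterval.symm p.2) :=
    hF.comp (by fun_prop :
      Continuous fun p : W × unitInterval => (p.1, unitInterval.symm p.2))
  have hL' : ∀ w ∈ L, ∀ s, F w (unitInterval.symm s) = f' w := fun w hw s => by
    rw [hL w hw, ← h1, hL w hw]
  exact ⟨⟨reattach (F := fun w s => F w (unitInterval.symm s)) hF' f₁ (by simpa using h1)
      (by simpa using h0) hL', reattach hF f₁ h0 h1 hL,
    reattach_comp_reattach fun w s => rfl, reattach_comp_reattach fun w s => by simp⟩⟩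

/-- Reversing the arcs. -/
noncomputable def reverse (f₀ f₁ : W → X) (L : Set W) (h : ∀ w ∈ L, f₀ w = f₁ w) :
    C(ArcSpace f₀ f₁ L, ArcSpace f₁ f₀ L) where
  toFun := desc _ _ _ (pt _ _ _) (fun w θ => arc f₁ f₀ L w (1 - θ))
    (fun w => arc_of_one_le _ (by simp)) (fun w => arc_of_le_zero _ (by simp))
    (fun w hw θ => by rw [arc_of_mem hw, h w hw])
  continuous_toFun := continuous_desc continuous_pt (continuous_arc.comp (by fun_prop :
    Continuous fun p : W × unitInterval => (p.1, 1 - (p.2 : ℝ))))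

theorem reverse_comp_reverse {h : ∀ w ∈ L, f₀ w = f₁ w} {h' : ∀ w ∈ L, f₁ w = f₀ w} :
    (reverse f₁ f₀ L h').comp (reverse f₀ f₁ L h) = ContinuousMap.id _ := by
  ext a
  rcases exists_rep a with ⟨x, rfl⟩ | ⟨w, -, θ, -, -, rfl⟩
  · rfl
  · rw [ContinuousMap.comp_apply, reverse, reverse, ContinuousMap.coe_mk, ContinuousMap.coe_mk,
      desc_arc, ContinuousMap.id_apply]
    refine (desc_arc w (unitInterval.symm θ)).trans ?_
    simp

theorem nonempty_homotopyEquiv_reverse (h : ∀ w ∈ L, f₀ w = f₁ w) :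
    Nonempty (ArcSpace f₀ f₁ L ≃ₕ ArcSpace f₁ f₀ L) :=
  ⟨⟨reverse f₀ f₁ L h, reverse f₁ f₀ L fun w hw => (h w hw).symm,
    by rw [reverse_comp_reverse], by rw [reverse_comp_reverse]⟩⟩

end ArcSpace

/-! ### The square doubled along the zero set of a function -/

/-- The point of the unit square that is obtained by clamping the coordinates. -/
noncomputable def sqPt (p : ℝ × ℝ) : unitSquare :=
  ⟨(projIcc (0 : ℝ) 1 zero_le_one p.1, projIcc (0 : ℝ) 1 zero_le_one p.2),
    (projIcc (0 : ℝ) 1 zero_le_one p.1).2, (projIcc (0 : ℝ) 1 zero_le_one p.2).2⟩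

theorem continuous_sqPt : Continuous sqPt := by
  have h : Continuous fun x : ℝ => ((projIcc (0 : ℝ) 1 zero_le_one x : Icc (0 : ℝ) 1) : ℝ) :=
    continuous_subtype_val.comp continuous_projIcc
  exact Continuous.subtype_mk ((h.comp continuous_fst).prodMk (h.comp continuous_snd)) _

theorem sqPt_val {p : ℝ × ℝ} (h1 : 0 ≤ p.1) (h1' : p.1 ≤ 1) (h2 : 0 ≤ p.2) (h2' : p.2 ≤ 1) :
    (sqPt p : ℝ × ℝ) = p := by
  ext
  · simp [sqPt, coe_projIcc, h1, h1']
  · simp [sqPt, coe_projIcc, h2, h2']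

theorem sqPt_fst (p : ℝ × ℝ) : (sqPt p : ℝ × ℝ).1 = max 0 (min 1 p.1) :=
  coe_projIcc _ _ zero_le_one _

theorem sqPt_snd (p : ℝ × ℝ) : (sqPt p : ℝ × ℝ).2 = max 0 (min 1 p.2) :=
  coe_projIcc _ _ zero_le_one _

@[simp] theorem sqPt_coe (p : unitSquare) : sqPt p = p :=
  Subtype.ext (sqPt_val p.2.1.1 p.2.1.2 p.2.2.1 p.2.2.2)

/-- The union of the unit square `𝕀² × {0}` and the graph of `G` over it: for `0 ≤ G` this is the
square doubled along the zero set of `G`. -/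
def doubleSquare (G : ℝ × ℝ → ℝ) : Set (ℝ × ℝ × ℝ) :=
  {q | (q.1, q.2.1) ∈ unitSquare ∧ (q.2.2 = 0 ∨ q.2.2 = G (q.1, q.2.1))}

namespace doubleSquare

variable {G G' : ℝ × ℝ → ℝ} {V K : Type} [TopologicalSpace V] [TopologicalSpace K]

/-- The flat sheet. -/
def flat (G : ℝ × ℝ → ℝ) (p : unitSquare) : doubleSquare G :=
  ⟨((p : ℝ × ℝ).1, (p : ℝ × ℝ).2, 0), p.2, Or.inl rfl⟩

/-- The upper sheet. -/
def top (G : ℝ × ℝ → ℝ) (p : unitSquare) : doubleSquare G :=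
  ⟨((p : ℝ × ℝ).1, (p : ℝ × ℝ).2, G p), p.2, Or.inr rfl⟩

/-- The projection to the square. -/
def proj (q : doubleSquare G) : unitSquare := ⟨((q : ℝ × ℝ × ℝ).1, (q : ℝ × ℝ × ℝ).2.1), q.2.1⟩

theorem continuous_proj : Continuous (proj : doubleSquare G → unitSquare) :=
  Continuous.subtype_mk (by fun_prop) _

theorem continuous_flat : Continuous (flat G) := Continuous.subtype_mk (by fun_prop) _

theorem continuous_top (hG : ContinuousOn G unitSquare) : Continuous (top G) := by
  have := hG.domRestrict
  refine Continuous.subtype_mk ((continuous_fst.comp continuous_subtype_val).prodMk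
    ((continuous_snd.comp continuous_subtype_val).prodMk this)) _

theorem flat_eq_top {p : unitSquare} (h : G p = 0) : flat G p = top G p := by
  apply Subtype.ext
  simp [flat, top, h]

theorem exists_rep (q : doubleSquare G) : (∃ p, q = flat G p) ∨ ∃ p, q = top G p := by
  rcases q.2.2 with h | h
  · refine Or.inl ⟨proj q, Subtype.ext ?_⟩
    simp [flat, proj, ← h]
  · refine Or.inr ⟨proj q, Subtype.ext ?_⟩
    simp [top, proj, ← h]

open Classical in
/-- The function on the doubled square that is given by `α` on the flat and by `β` on the upper
sheet. -/
noncomputable def desc (G : ℝ × ℝ → ℝ) (α β : unitSquare → V) (q : doubleSquare G) : V :=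
  if (q : ℝ × ℝ × ℝ).2.2 = 0 then α (proj q) else β (proj q)

omit [TopologicalSpace V] in
theorem desc_flat (α β : unitSquare → V) (p : unitSquare) : desc G α β (flat G p) = α p :=
  if_pos rfl

omit [TopologicalSpace V] in
theorem desc_top {α β : unitSquare → V} (h : ∀ p : unitSquare, G p = 0 → α p = β p)
    (p : unitSquare) : desc G α β (top G p) = β p := by
  rw [desc]
  split_ifs with h'
  · exact h p h'
  · rfl

theorem continuous_desc_family (hG : ContinuousOn G unitSquare) {α β : unitSquare → K → V}
    (hα : Continuous fun p : unitSquare × K => α p.1 p.2)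
    (hβ : Continuous fun p : unitSquare × K => β p.1 p.2)
    (h : ∀ (p : unitSquare) k, G p = 0 → α p k = β p k) :
    Continuous fun p : doubleSquare G × K =>
      desc G (fun x => α x p.2) (fun x => β x p.2) p.1 := by
  have hp : Continuous fun p : doubleSquare G × K => (proj p.1, p.2) :=
    (continuous_proj.comp continuous_fst).prodMk continuous_snd
  have hz : Continuous fun p : doubleSquare G × K => (p.1 : ℝ × ℝ × ℝ).2.2 := by fun_prop
  have hGp : Continuous fun p : doubleSquare G × K => G (proj p.1) :=
    hG.domRestrict.comp (continuous_proj.comp continuous_fst)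
  rw [← continuousOn_univ]
  have hu : (univ : Set (doubleSquare G × K)) = {p | (p.1 : ℝ × ℝ × ℝ).2.2 = 0} ∪
      {p | (p.1 : ℝ × ℝ × ℝ).2.2 = G (proj p.1)} := by
    ext p
    exact iff_of_true trivial p.1.2.2
  rw [hu]
  refine ContinuousOn.union_of_isClosed ?_ ?_ (isClosed_eq hz continuous_const)
    (isClosed_eq hz hGp)
  · refine (hα.comp hp).continuousOn.congr fun p hp' => ?_
    exact if_pos hp'
  · refine (hβ.comp hp).continuousOn.congr fun p hp' => ?_
    rw [desc]
    split_ifs with h0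
    · exact h _ _ (hp'.symm.trans h0)
    · rfl

theorem continuous_desc (hG : ContinuousOn G unitSquare) {α β : unitSquare → V}
    (hα : Continuous α) (hβ : Continuous β) (h : ∀ p : unitSquare, G p = 0 → α p = β p) :
    Continuous (desc G α β) :=
  (continuous_desc_family (K := Unit) hG (α := fun p _ => α p) (β := fun p _ => β p)
    (hα.comp continuous_fst) (hβ.comp continuous_fst) (fun p _ => h p)).comp
    (by fun_prop : Continuous fun q : doubleSquare G => (q, ()))

theorem homotopic_of_family (hG : ContinuousOn G unitSquare) {F F' : C(doubleSquare G, V)}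
    (α β : unitSquare → unitInterval → V)
    (hα : Continuous fun p : unitSquare × unitInterval => α p.1 p.2)
    (hβ : Continuous fun p : unitSquare × unitInterval => β p.1 p.2)
    (h : ∀ (p : unitSquare) s, G p = 0 → α p s = β p s)
    (hF : ∀ p, F (flat G p) = α p 0) (hF' : ∀ p, F (top G p) = β p 0)
    (hG' : ∀ p, F' (flat G p) = α p 1) (hG'' : ∀ p, F' (top G p) = β p 1) :
    F.Homotopic F' := by
  refine _root_.homotopic_of_family (fun q s => desc G (fun x => α x s) (fun x => β x s) q)
    (continuous_desc_family hG hα hβ h) ?_ ?_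
  · intro a
    rcases exists_rep a with ⟨p, rfl⟩ | ⟨p, rfl⟩
    · rw [desc_flat, hF]
    · rw [desc_top fun p hp => h p _ hp, hF']
  · intro a
    rcases exists_rep a with ⟨p, rfl⟩ | ⟨p, rfl⟩
    · rw [desc_flat, hG']
    · rw [desc_top fun p hp => h p _ hp, hG'']

/-- The map of doubled squares induced by a map of the square that respects the zero sets. -/
noncomputable def map (hG : ContinuousOn G unitSquare) (hG' : ContinuousOn G' unitSquare)
    (φ : C(unitSquare, unitSquare)) (h : ∀ p : unitSquare, G p = 0 → G' (φ p) = 0) :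
    C(doubleSquare G, doubleSquare G') where
  toFun := desc G (fun p => flat G' (φ p)) (fun p => top G' (φ p))
  continuous_toFun := continuous_desc hG (continuous_flat.comp φ.continuous)
    ((continuous_top hG').comp φ.continuous) fun p hp => flat_eq_top (h p hp)

theorem map_flat {hG : ContinuousOn G unitSquare} {hG' : ContinuousOn G' unitSquare}
    {φ : C(unitSquare, unitSquare)} {h : ∀ p : unitSquare, G p = 0 → G' (φ p) = 0}
    (p : unitSquare) : map hG hG' φ h (flat G p) = flat G' (φ p) := by
  rw [map, ContinuousMap.coe_mk, desc_flat]

theorem map_top {hG : ContinuousOn G unitSquare} {hG' : ContinuousOn G' unitSquare}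
    {φ : C(unitSquare, unitSquare)} {h : ∀ p : unitSquare, G p = 0 → G' (φ p) = 0}
    (p : unitSquare) : map hG hG' φ h (top G p) = top G' (φ p) :=
  desc_top (fun p hp => flat_eq_top (h p hp)) _

/-- A deformation of the square that preserves the zero set induces one of the doubled square. -/
theorem homotopic_of_deformation (hG : ContinuousOn G unitSquare)
    {F F' : C(doubleSquare G, doubleSquare G)} (h : unitSquare → unitInterval → unitSquare)
    (hc : Continuous fun p : unitSquare × unitInterval => h p.1 p.2)
    (hz : ∀ (p : unitSquare) s, G p = 0 → G (h p s) = 0)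
    (hF : ∀ p, F (flat G p) = flat G (h p 0)) (hF' : ∀ p, F (top G p) = top G (h p 0))
    (hG' : ∀ p, F' (flat G p) = flat G (h p 1)) (hG'' : ∀ p, F' (top G p) = top G (h p 1)) :
    F.Homotopic F' :=
  homotopic_of_family hG (fun p s => flat G (h p s)) (fun p s => top G (h p s))
    (continuous_flat.comp hc) ((continuous_top hG).comp hc)
    (fun p s hp => flat_eq_top (hz p s hp)) hF hF' hG' hG''

end doubleSquare

/-- The zero set of `G` in the square consists of the left side and the points outside the strip
between the graphs of `l` and `r`. -/
def IsStripFunction (G : ℝ × ℝ → ℝ) (l r : ℝ → ℝ) : Prop :=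
  ContinuousOn G unitSquare ∧
    ∀ p : unitSquare, G p = 0 ↔ (p : ℝ × ℝ).1 = 0 ∨ (p : ℝ × ℝ).2 ≤ l (p : ℝ × ℝ).1 ∨
      r (p : ℝ × ℝ).1 ≤ (p : ℝ × ℝ).2

open doubleSquare in
/-- If the strip contains a horizontal strip around the middle line, then stretching the vertical
coordinate pushes the zero set into three sides of the square, and the square doubled along three
sides is contracted horizontally. -/
theorem contractibleSpace_doubleSquare {G : ℝ × ℝ → ℝ} {l r : ℝ → ℝ} (hG : IsStripFunction G l r)
    {c : ℝ} (hc : 0 < c) (hl0 : ∀ x, 0 < x → x ≤ 1 → 0 ≤ l x)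
    (hr1 : ∀ x, 0 < x → x ≤ 1 → r x ≤ 1)
    (hl : ∀ x, 0 < x → x ≤ 1 → l x ≤ 1 / 2 - c) (hr : ∀ x, 0 < x → x ≤ 1 → 1 / 2 + c ≤ r x) :
    ContractibleSpace (doubleSquare G) := by
  obtain ⟨hGc, hz⟩ := hG
  rw [contractible_iff_id_nullhomotopic]
  -- the stretch by the factor `1 + t / c` about the middle line
  set e : ℝ → ℝ → ℝ := fun v t => 1 / 2 + (1 + t / c) * (v - 1 / 2) with he
  have hec : Continuous fun p : ℝ × ℝ => e p.1 p.2 := by fun_prop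
  have clamp01 : ∀ t : ℝ, 0 ≤ max 0 (min 1 t) ∧ max 0 (min 1 t) ≤ 1 := fun t =>
    ⟨le_max_left _ _, max_le zero_le_one (min_le_left _ _)⟩
  have low : ∀ v t : ℝ, 0 ≤ t → v ≤ 1 / 2 - c → e v t ≤ v - t := by
    intro v t ht hv
    have : t / c * (v - 1 / 2) ≤ t / c * (-c) :=
      mul_le_mul_of_nonneg_left (by linarith) (by positivity)
    rw [div_mul_eq_mul_div, div_mul_eq_mul_div, mul_neg, neg_div, mul_div_assoc t c,
      div_self hc.ne'] at this
    simp only [he, add_mul, div_mul_eq_mul_div]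
    linarith
  have high : ∀ v t : ℝ, 0 ≤ t → 1 / 2 + c ≤ v → v + t ≤ e v t := by
    intro v t ht hv
    have : t / c * c ≤ t / c * (v - 1 / 2) :=
      mul_le_mul_of_nonneg_left (by linarith) (by positivity)
    rw [div_mul_cancel₀ _ hc.ne'] at this
    simp only [he, add_mul, one_mul]
    linarith
  have fst_eq : ∀ (p : unitSquare) (t v : ℝ), 0 ≤ t → t ≤ 1 →
      (sqPt (t * (p : ℝ × ℝ).1, v) : ℝ × ℝ).1 = t * (p : ℝ × ℝ).1 := by
    intro p t v h0 h1
    have := p.2.1.1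
    have := p.2.1.2
    rw [sqPt_fst, min_eq_right (by nlinarith), max_eq_right (by positivity)]
  -- the stretch, as a deformation which preserves the zero set
  have hz1 : ∀ (p : unitSquare) (s : unitInterval), G p = 0 →
      G (sqPt ((p : ℝ × ℝ).1, e (p : ℝ × ℝ).2 s)) = 0 := by
    intro p s hp
    have h1 := fst_eq p 1 (e (p : ℝ × ℝ).2 s) zero_le_one le_rfl
    rw [one_mul] at h1
    rw [hz] at hp ⊢
    rw [h1, sqPt_snd]
    rcases eq_or_ne (p : ℝ × ℝ).1 0 with h0 | h0
    · exact Or.inl h0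
    have hx := lt_of_le_of_ne p.2.1.1 (Ne.symm h0)
    have hx' := p.2.1.2
    have hv0 := p.2.2.1
    have hv1 := p.2.2.2
    have hs := s.2.1
    rcases hp with h | h | h
    · exact absurd h h0
    · refine Or.inr (Or.inl (max_le (hl0 _ hx hx') ((min_le_right _ _).trans ?_)))
      linarith [low _ _ hs (h.trans (hl _ hx hx'))]
    · refine Or.inr (Or.inr (le_max_of_le_right (le_min (hr1 _ hx hx') ?_)))
      linarith [high _ _ hs ((hr _ hx hx').trans h)]
  -- the horizontal contraction after the full stretch
  have hz2 : ∀ (p : unitSquare) (s : unitInterval), G p = 0 →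
      G (sqPt ((1 - s) * (p : ℝ × ℝ).1, e (p : ℝ × ℝ).2 1)) = 0 := by
    intro p s hp
    have hs := s.2.1
    have hs' := s.2.2
    rw [hz] at hp ⊢
    rw [fst_eq p _ _ (by linarith) (by linarith), sqPt_snd]
    rcases eq_or_ne ((1 - s : ℝ) * (p : ℝ × ℝ).1) 0 with h0 | h0
    · exact Or.inl h0
    have hpx0 := p.2.1.1
    have hx : 0 < (1 - s : ℝ) * (p : ℝ × ℝ).1 :=
      lt_of_le_of_ne (mul_nonneg (by linarith) hpx0) (Ne.symm h0)
    have hpx : 0 < (p : ℝ × ℝ).1 := lt_of_le_of_ne hpx0 (by rintro h; rw [← h] at h0; simp at h0)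
    have hpx' := p.2.1.2
    have hx' : (1 - s : ℝ) * (p : ℝ × ℝ).1 ≤ 1 := by nlinarith
    have hv0 := p.2.2.1
    have hv1 := p.2.2.2
    rcases hp with h | h | h
    · exact absurd h hpx.ne'
    · have := low _ 1 zero_le_one (h.trans (hl _ hpx hpx'))
      refine Or.inr (Or.inl (max_le (hl0 _ hx hx') ?_))
      exact (min_le_right _ _).trans (le_trans (by linarith) (hl0 _ hx hx'))
    · have := high _ 1 zero_le_one ((hr _ hpx hpx').trans h)
      refine Or.inr (Or.inr (le_max_of_le_right ?_))
      rw [min_eq_left (by linarith)]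
      exact hr1 _ hx hx'
  have cont1 : Continuous fun p : unitSquare × unitInterval =>
      sqPt ((p.1 : ℝ × ℝ).1, e (p.1 : ℝ × ℝ).2 p.2) :=
    continuous_sqPt.comp ((by fun_prop : Continuous fun p : unitSquare × unitInterval =>
      (p.1 : ℝ × ℝ).1).prodMk (hec.comp (by fun_prop :
        Continuous fun p : unitSquare × unitInterval => ((p.1 : ℝ × ℝ).2, (p.2 : ℝ)))))
  have cont2 : Continuous fun p : unitSquare × unitInterval =>
      sqPt ((1 - p.2) * (p.1 : ℝ × ℝ).1, e (p.1 : ℝ × ℝ).2 1) :=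
    continuous_sqPt.comp ((by fun_prop : Continuous fun p : unitSquare × unitInterval =>
      (1 - p.2 : ℝ) * (p.1 : ℝ × ℝ).1).prodMk (hec.comp (by fun_prop :
        Continuous fun p : unitSquare × unitInterval => ((p.1 : ℝ × ℝ).2, (1 : ℝ)))))
  have cont3 : Continuous fun p : unitSquare × unitInterval =>
      sqPt (0, (1 - p.2) * e (p.1 : ℝ × ℝ).2 1) :=
    continuous_sqPt.comp (continuous_const.prodMk (Continuous.mul (by fun_prop)
      (hec.comp (by fun_prop :
        Continuous fun p : unitSquare × unitInterval => ((p.1 : ℝ × ℝ).2, (1 : ℝ))))))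
  have zero_left : ∀ v, G (sqPt (0, v)) = 0 := fun v => by
    rw [hz, sqPt_fst]
    simp
  let m1 : C(doubleSquare G, doubleSquare G) := map hGc hGc
    ⟨fun p => sqPt ((p : ℝ × ℝ).1, e (p : ℝ × ℝ).2 1), cont1.comp (by fun_prop :
      Continuous fun p : unitSquare => (p, (1 : unitInterval)))⟩ (fun p hp => by
        simpa using hz1 p 1 hp)
  let m2 : C(doubleSquare G, doubleSquare G) := map hGc hGc
    ⟨fun p => sqPt (0, e (p : ℝ × ℝ).2 1), continuous_sqPt.comp (continuous_const.prodMk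
      (hec.comp (by fun_prop : Continuous fun p : unitSquare => ((p : ℝ × ℝ).2, (1 : ℝ)))))⟩
    (fun p _ => zero_left _)
  refine ⟨flat G (sqPt (0, 0)), ?_⟩
  have H1 : (ContinuousMap.id _).Homotopic m1 := by
    refine homotopic_of_deformation hGc _ cont1 hz1 ?_ ?_ ?_ ?_
    · intro p; simp [he]
    · intro p; simp [he]
    · intro p; exact map_flat p
    · intro p; exact map_top p
  have H2 : m1.Homotopic m2 := by
    refine homotopic_of_deformation hGc _ cont2 hz2 ?_ ?_ ?_ ?_
    · intro p; refine (map_flat p).trans ?_; simp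
    · intro p; refine (map_top p).trans ?_; simp
    · intro p; refine (map_flat p).trans ?_; simp
    · intro p; refine (map_top p).trans ?_; simp
  have H3 : m2.Homotopic (ContinuousMap.const _ (flat G (sqPt (0, 0)))) := by
    refine homotopic_of_deformation hGc (fun p s => sqPt (0, (1 - s) * e (p : ℝ × ℝ).2 1))
      cont3 (fun p s _ => zero_left _) ?_ ?_ ?_ ?_
    · intro p; refine (map_flat p).trans ?_; simp
    · intro p; refine (map_top p).trans ?_; simp
    · intro p; simp
    · intro p; simp [flat_eq_top (zero_left 0)]
  exact (H1.trans H2).trans H3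

/-! ### Piecewise linear interpolation with nodes `1 / k` -/

theorem exists_slab {x : ℝ} (h0 : 0 < x) (h1 : x ≤ 1) :
    ∃ k : ℕ, 1 ≤ k ∧ 1 / ((k : ℝ) + 1) ≤ x ∧ x ≤ 1 / (k : ℝ) := by
  refine ⟨⌊1 / x⌋₊, ?_, ?_, ?_⟩
  · rw [Nat.one_le_floor_iff]
    exact (one_le_div h0).2 h1
  · have := Nat.lt_floor_add_one (1 / x)
    rw [div_le_iff₀ (by positivity)]
    rw [div_lt_iff₀ h0] at this
    linarith
  · have h : 1 ≤ 1 / x := (one_le_div h0).2 h1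
    have h2 : (1 : ℝ) ≤ (⌊1 / x⌋₊ : ℝ) := by exact_mod_cast (Nat.one_le_floor_iff _).2 h
    have := Nat.floor_le (a := 1 / x) (by positivity)
    rw [le_div_iff₀ (by positivity)]
    rw [le_div_iff₀ h0] at this
    linarith

/-- Continuity may be checked on each of the closed slabs `1 / (k + 1) ≤ φ ≤ 1 / k`. -/
theorem continuousOn_of_slabs {E V : Type*} [TopologicalSpace E] [TopologicalSpace V] {φ : E → ℝ}
    (hφ : Continuous φ) {A : Set E} {f : E → V}
    (h : ∀ k : ℕ, 1 ≤ k → ContinuousOn f (A ∩ φ ⁻¹' Icc (1 / ((k : ℝ) + 1)) (1 / (k : ℝ)))) :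
    ContinuousOn f (A ∩ φ ⁻¹' Ioc 0 1) := by
  have hw : ∀ (k : ℕ), 1 ≤ k → ∀ x ∈ A,
      ContinuousWithinAt f (A ∩ φ ⁻¹' Icc (1 / ((k : ℝ) + 1)) (1 / (k : ℝ))) x := by
    intro k hk x hx
    by_cases hxk : φ x ∈ Icc (1 / ((k : ℝ) + 1)) (1 / (k : ℝ))
    · exact h k hk x ⟨hx, hxk⟩
    · refine continuousWithinAt_of_notMem_closure fun hcl => hxk ?_
      have := closure_mono inter_subset_right hcl
      rwa [(isClosed_Icc.preimage hφ).closure_eq] at this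
  have hN : ∀ N : ℕ, ∀ x ∈ A,
      ContinuousWithinAt f (A ∩ φ ⁻¹' Icc (1 / ((N : ℝ) + 1 + 1)) 1) x := by
    intro N
    induction N with
    | zero => intro x hx; simpa using hw 1 le_rfl x hx
    | succ N ih =>
      intro x hx
      have hu : A ∩ φ ⁻¹' Icc (1 / (((N + 1 : ℕ) : ℝ) + 1 + 1)) 1 ⊆
          (A ∩ φ ⁻¹' Icc (1 / ((N : ℝ) + 1 + 1)) 1) ∪
          (A ∩ φ ⁻¹' Icc (1 / (((N + 2 : ℕ) : ℝ) + 1)) (1 / ((N + 2 : ℕ) : ℝ))) := by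
        rintro z ⟨hz, hz1, hz2⟩
        push_cast at hz1 ⊢
        by_cases hc : 1 / ((N : ℝ) + 1 + 1) ≤ φ z
        · exact Or.inl ⟨hz, hc, hz2⟩
        · push Not at hc
          refine Or.inr ⟨hz, le_trans (le_of_eq ?_) hz1, hc.le.trans (le_of_eq ?_)⟩ <;> ring
      exact (continuousWithinAt_union.2 ⟨ih x hx, hw (N + 2) (by omega) x hx⟩).mono hu
  rintro x ⟨hxA, hx0, hx1⟩
  obtain ⟨k, hk, hk1, -⟩ := exists_slab hx0 hx1
  have hlt : 1 / ((k : ℝ) + 1 + 1) < φ x :=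
    lt_of_lt_of_le (one_div_lt_one_div_of_lt (by positivity) (by linarith)) hk1
  refine (hN k x hxA).mono_of_mem_nhdsWithin ?_
  have := (hφ.isOpen_preimage _ isOpen_Ioi).mem_nhds (show x ∈ φ ⁻¹' Ioi _ from hlt)
  filter_upwards [mem_nhdsWithin_of_mem_nhds this, self_mem_nhdsWithin] with z hz hz'
  exact ⟨hz'.1, le_of_lt hz, hz'.2.2⟩

/-- A function bounded by a multiple of `φ ≥ 0` is continuous if it is so where `φ > 0`. -/
theorem continuous_of_abs_le {E : Type*} [TopologicalSpace E] {φ e : E → ℝ} (hφ : Continuous φ)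
    (h0 : ∀ p, 0 ≤ φ p) {C : ℝ} (he : ∀ p, |e p| ≤ C * φ p) (hc : ContinuousOn e {p | 0 < φ p}) :
    Continuous e := by
  rw [continuous_iff_continuousAt]
  intro p
  rcases (h0 p).eq_or_lt with hp | hp
  · have hp0 : e p = 0 := by
      have := he p
      rw [← hp, mul_zero] at this
      exact abs_nonpos_iff.1 this
    rw [ContinuousAt, hp0]
    refine squeeze_zero_norm (a := fun p => C * φ p) he ?_
    have := (hφ.tendsto p).const_mul C
    rwa [← hp, mul_zero] at this
  · exact hc.continuousAt ((isOpen_lt continuous_const hφ).mem_nhds hp)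

/-- The piecewise linear interpolation on `(0, 1]` of the values `a k` at `1 / k`, `k ≥ 1`. -/
noncomputable def interp (a : ℕ → ℝ) (x : ℝ) : ℝ :=
  a ⌊1 / x⌋₊ + (⌊1 / x⌋₊ + 1) * (1 - ⌊1 / x⌋₊ * x) * (a (⌊1 / x⌋₊ + 1) - a ⌊1 / x⌋₊)

theorem slab_coord_mem {x : ℝ} {k : ℕ} (hk : 1 ≤ k) (h1 : 1 / ((k : ℝ) + 1) ≤ x)
    (h2 : x ≤ 1 / (k : ℝ)) : 0 ≤ ((k : ℝ) + 1) * (1 - k * x) ∧ ((k : ℝ) + 1) * (1 - k * x) ≤ 1 := by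
  have hk' : (0 : ℝ) < k := by exact_mod_cast hk
  rw [div_le_iff₀ (by positivity)] at h1
  rw [le_div_iff₀ hk'] at h2
  constructor
  · exact mul_nonneg (by positivity) (by linarith)
  · nlinarith

theorem interp_eq (a : ℕ → ℝ) {x : ℝ} {k : ℕ} (hk : 1 ≤ k) (h1 : 1 / ((k : ℝ) + 1) ≤ x)
    (h2 : x ≤ 1 / (k : ℝ)) :
    interp a x = a k + (k + 1) * (1 - k * x) * (a (k + 1) - a k) := by
  have hk' : (0 : ℝ) < k := by exact_mod_cast hk
  rcases h1.eq_or_lt with h | h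
  · have : ⌊1 / x⌋₊ = k + 1 := by
      rw [← h, one_div_one_div]
      exact_mod_cast Nat.floor_natCast (k + 1)
    rw [interp, this, ← h]
    push_cast
    field_simp
    ring
  · have hx : 0 < x := lt_trans (by positivity) h
    have : ⌊1 / x⌋₊ = k := by
      rw [Nat.floor_eq_iff (by positivity)]
      constructor
      · rw [le_div_iff₀ hx]
        rw [le_div_iff₀ hk'] at h2
        linarith
      · rw [div_lt_iff₀ hx]
        rw [div_lt_iff₀ (by positivity)] at h
        linarith
    rw [interp, this]

theorem interp_add (a b : ℕ → ℝ) (x : ℝ) :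
    interp (fun k => a k + b k) x = interp a x + interp b x := by
  simp only [interp]
  ring

theorem interp_const_mul (c : ℝ) (a : ℕ → ℝ) (x : ℝ) :
    interp (fun k => c * a k) x = c * interp a x := by
  simp only [interp]
  ring

theorem interp_const (c x : ℝ) : interp (fun _ => c) x = c := by simp [interp]

theorem interp_inv {x : ℝ} (h0 : 0 < x) (h1 : x ≤ 1) : interp (fun k => 1 / (k : ℝ)) x = x := by
  obtain ⟨k, hk, hk1, hk2⟩ := exists_slab h0 h1
  have hk' : (0 : ℝ) < k := by exact_mod_cast hk
  rw [interp_eq _ hk hk1 hk2]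
  push_cast
  field_simp
  ring

theorem interp_mono {a b : ℕ → ℝ} (h : ∀ k, 1 ≤ k → a k ≤ b k) {x : ℝ} (h0 : 0 < x) (h1 : x ≤ 1) :
    interp a x ≤ interp b x := by
  obtain ⟨k, hk, hk1, hk2⟩ := exists_slab h0 h1
  rw [interp_eq _ hk hk1 hk2, interp_eq _ hk hk1 hk2]
  obtain ⟨h3, h4⟩ := slab_coord_mem hk hk1 hk2
  have := h k hk
  have := h (k + 1) (by omega)
  nlinarith

theorem continuousOn_interp (a : ℕ → ℝ) : ContinuousOn (interp a) (Ioc 0 1) := by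
  have := continuousOn_of_slabs (φ := fun x : ℝ => x) continuous_id (A := univ) (f := interp a) ?_
  · simpa using this
  · intro k hk
    refine ContinuousOn.congr (f := fun x => a k + (k + 1) * (1 - k * x) * (a (k + 1) - a k))
      (by fun_prop) fun x hx => ?_
    exact interp_eq a hk hx.2.1 hx.2.2

/-- The triangle wave with value `0` at `1 / k` for odd `k` and `1` for even `k`. -/
noncomputable def wave : ℝ → ℝ := interp fun k => if Even k then 1 else 0

/-- The lower boundary of the base of the tube. -/
noncomputable def lowerEdge (y ε : ℝ) : ℝ → ℝ := interp fun k => if Even k then 1 - y - ε / k else 0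

theorem wave_nonneg {x : ℝ} (h0 : 0 < x) (h1 : x ≤ 1) : 0 ≤ wave x := by
  rw [← interp_const 0 x]
  exact interp_mono (fun k _ => by split_ifs <;> norm_num) h0 h1

theorem wave_le_one {x : ℝ} (h0 : 0 < x) (h1 : x ≤ 1) : wave x ≤ 1 := by
  rw [← interp_const 1 x]
  exact interp_mono (fun k _ => by split_ifs <;> norm_num) h0 h1

theorem lowerEdge_nonneg {y ε : ℝ} (hε : 0 ≤ ε) (hle : y + ε ≤ 1) {x : ℝ} (h0 : 0 < x)
    (h1 : x ≤ 1) : 0 ≤ lowerEdge y ε x := by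
  rw [← interp_const 0 x]
  refine interp_mono (fun k hk => ?_) h0 h1
  have : ε / k ≤ ε := div_le_self hε (by exact_mod_cast hk)
  split_ifs
  · linarith
  · exact le_rfl

theorem lowerEdge_add_le {y ε : ℝ} (hε : 0 ≤ ε) (hle : y + ε ≤ 1) {x : ℝ} (h0 : 0 < x)
    (h1 : x ≤ 1) : lowerEdge y ε x + (y + ε * x) ≤ 1 := by
  have e : lowerEdge y ε x + (y + ε * x) = interp (fun k =>
      (if Even k then 1 - y - ε / k else 0) + (y + ε * (1 / (k : ℝ)))) x := by
    rw [interp_add, interp_add, interp_const, interp_const_mul, interp_inv h0 h1, lowerEdge]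
  rw [e]
  refine (interp_mono (b := fun _ => 1) (fun k hk => ?_) h0 h1).trans_eq (interp_const 1 x)
  have : ε / k ≤ ε := div_le_self hε (by exact_mod_cast hk)
  rw [mul_one_div]
  split_ifs <;> linarith

theorem abs_lowerEdge_sub_le {y ε : ℝ} (hε : 0 ≤ ε) {x : ℝ} (h0 : 0 < x) (h1 : x ≤ 1) :
    |lowerEdge y ε x - (1 - y) * wave x| ≤ ε * x := by
  have e : lowerEdge y ε x + -1 * ((1 - y) * wave x) = interp (fun k =>
      (if Even k then 1 - y - ε / k else 0) +
        -1 * ((1 - y) * (if Even k then 1 else 0))) x := by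
    rw [interp_add, interp_const_mul, interp_const_mul, lowerEdge, wave]
  rw [abs_le, sub_eq_add_neg, ← neg_one_mul ((1 - y) * wave x), e]
  have hp : ∀ k : ℕ, 0 ≤ ε / k := fun k => by positivity
  constructor
  · rw [← interp_inv h0 h1, neg_mul_eq_neg_mul, ← interp_const_mul]
    rw [interp_inv h0 h1]
    refine interp_mono (fun k hk => ?_) h0 h1
    have := hp k
    have : -ε * (1 / (k : ℝ)) = - (ε / k) := by ring
    rw [this]
    split_ifs <;> linarith
  · rw [show ε * x = interp (fun k => ε * (1 / (k : ℝ))) x by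
      rw [interp_const_mul, interp_inv h0 h1]]
    refine interp_mono (fun k hk => ?_) h0 h1
    have := hp k
    rw [mul_one_div]
    split_ifs <;> linarith

/-! ### Strips with asymptotic boundaries -/

section Strips

/-- The affine map of each vertical line that takes the strip between `l` and `r` to the strip
between `l'` and `r'`, clamped to the square. On the side `x = 0`, where the boundaries have no
value, it is the identity. -/
noncomputable def stretch (l r l' r' : ℝ → ℝ) (p : unitSquare) : unitSquare :=
  sqPt ((p : ℝ × ℝ).1, if (p : ℝ × ℝ).1 = 0 then (p : ℝ × ℝ).2 else l' (p : ℝ × ℝ).1 +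
    ((p : ℝ × ℝ).2 - l (p : ℝ × ℝ).1) *
      ((r' (p : ℝ × ℝ).1 - l' (p : ℝ × ℝ).1) / (r (p : ℝ × ℝ).1 - l (p : ℝ × ℝ).1)))

variable {l r l' r' : ℝ → ℝ}

theorem stretch_fst (p : unitSquare) :
    (stretch l r l' r' p : ℝ × ℝ).1 = (p : ℝ × ℝ).1 := by
  rw [stretch, sqPt_fst, min_eq_right p.2.1.2, max_eq_right p.2.1.1]

theorem continuous_stretch (hl : ContinuousOn l (Ioc 0 1)) (hr : ContinuousOn r (Ioc 0 1))
    (hl' : ContinuousOn l' (Ioc 0 1)) (hr' : ContinuousOn r' (Ioc 0 1))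
    (hb : ∀ x ∈ Ioc (0 : ℝ) 1, 0 ≤ l x ∧ l x < r x ∧ r x ≤ 1) {C : ℝ}
    (h1 : ∀ x ∈ Ioc (0 : ℝ) 1, |l x - l' x| ≤ C * x)
    (h2 : ∀ x ∈ Ioc (0 : ℝ) 1, |(r' x - l' x) / (r x - l x) - 1| ≤ C * x) :
    Continuous (stretch l r l' r') := by
  have hx : Continuous fun p : unitSquare => (p : ℝ × ℝ).1 := by fun_prop
  have key : Continuous fun p : unitSquare => if (p : ℝ × ℝ).1 = 0 then (0 : ℝ) else
      l' (p : ℝ × ℝ).1 - l (p : ℝ × ℝ).1 + ((p : ℝ × ℝ).2 - l (p : ℝ × ℝ).1) *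
        ((r' (p : ℝ × ℝ).1 - l' (p : ℝ × ℝ).1) / (r (p : ℝ × ℝ).1 - l (p : ℝ × ℝ).1) - 1) := by
    refine continuous_of_abs_le hx (fun p => p.2.1.1) (C := C + C) ?_ ?_
    · intro p
      split_ifs with h
      · simp [h]
      · have hp : (p : ℝ × ℝ).1 ∈ Ioc (0 : ℝ) 1 := ⟨lt_of_le_of_ne p.2.1.1 (Ne.symm h), p.2.1.2⟩
        obtain ⟨b1, b2, b3⟩ := hb _ hp
        have hv : |(p : ℝ × ℝ).2 - l (p : ℝ × ℝ).1| ≤ 1 :=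
          abs_le.2 ⟨by linarith [p.2.2.1], by linarith [p.2.2.2]⟩
        rw [add_mul]
        refine (abs_add_le _ _).trans (add_le_add ?_ ?_)
        · rw [abs_sub_comm]
          exact h1 _ hp
        · rw [abs_mul]
          calc _ ≤ 1 * _ := mul_le_mul_of_nonneg_right hv (abs_nonneg _)
            _ ≤ _ := by rw [one_mul]; exact h2 _ hp
    · have hm : MapsTo (fun p : unitSquare => (p : ℝ × ℝ).1) {p | 0 < (p : ℝ × ℝ).1} (Ioc 0 1) :=
        fun p hp => ⟨hp, p.2.1.2⟩
      have cl := hl.comp hx.continuousOn hm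
      have cr := hr.comp hx.continuousOn hm
      have cl' := hl'.comp hx.continuousOn hm
      have cr' := hr'.comp hx.continuousOn hm
      have hd : ContinuousOn (fun p : unitSquare => (r' (p : ℝ × ℝ).1 - l' (p : ℝ × ℝ).1) /
          (r (p : ℝ × ℝ).1 - l (p : ℝ × ℝ).1)) {p | 0 < (p : ℝ × ℝ).1} :=
        (cr'.sub cl').div (cr.sub cl) fun p hp => by
          have := (hb _ (hm hp)).2.1
          exact ne_of_gt (sub_pos.2 this)
      refine ContinuousOn.congr ((cl'.sub cl).add (((continuous_snd.comp
        continuous_subtype_val).continuousOn.sub cl).mul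
        (hd.sub (continuousOn_const (c := (1 : ℝ)))))) fun p hp => ?_
      exact if_neg (ne_of_gt hp)
  have : stretch l r l' r' = fun p : unitSquare => sqPt ((p : ℝ × ℝ).1, (p : ℝ × ℝ).2 +
      if (p : ℝ × ℝ).1 = 0 then (0 : ℝ) else
      l' (p : ℝ × ℝ).1 - l (p : ℝ × ℝ).1 + ((p : ℝ × ℝ).2 - l (p : ℝ × ℝ).1) *
        ((r' (p : ℝ × ℝ).1 - l' (p : ℝ × ℝ).1) / (r (p : ℝ × ℝ).1 - l (p : ℝ × ℝ).1) - 1)) := by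
    funext p
    rw [stretch]
    congr 2
    split_ifs
    · simp
    · ring
  rw [this]
  exact continuous_sqPt.comp (hx.prodMk (Continuous.add (by fun_prop) key))

theorem stretch_snd_le {p : unitSquare} (hp : (p : ℝ × ℝ).1 ≠ 0)
    (hl' : 0 ≤ l' (p : ℝ × ℝ).1) (hlr : l (p : ℝ × ℝ).1 < r (p : ℝ × ℝ).1)
    (hlr' : l' (p : ℝ × ℝ).1 < r' (p : ℝ × ℝ).1) (h : (p : ℝ × ℝ).2 ≤ l (p : ℝ × ℝ).1) :
    (stretch l r l' r' p : ℝ × ℝ).2 ≤ l' (p : ℝ × ℝ).1 := by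
  rw [stretch, sqPt_snd, if_neg hp]
  refine max_le hl' ((min_le_right _ _).trans ?_)
  have : 0 ≤ (r' (p : ℝ × ℝ).1 - l' (p : ℝ × ℝ).1) / (r (p : ℝ × ℝ).1 - l (p : ℝ × ℝ).1) :=
    div_nonneg (by linarith) (by linarith)
  nlinarith

theorem le_stretch_snd {p : unitSquare} (hp : (p : ℝ × ℝ).1 ≠ 0)
    (hr' : r' (p : ℝ × ℝ).1 ≤ 1) (hlr : l (p : ℝ × ℝ).1 < r (p : ℝ × ℝ).1)
    (hlr' : l' (p : ℝ × ℝ).1 < r' (p : ℝ × ℝ).1) (h : r (p : ℝ × ℝ).1 ≤ (p : ℝ × ℝ).2) :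
    r' (p : ℝ × ℝ).1 ≤ (stretch l r l' r' p : ℝ × ℝ).2 := by
  rw [stretch, sqPt_snd, if_neg hp]
  refine le_max_of_le_right (le_min hr' ?_)
  have h3 : 0 ≤ (r' (p : ℝ × ℝ).1 - l' (p : ℝ × ℝ).1) / (r (p : ℝ × ℝ).1 - l (p : ℝ × ℝ).1) :=
    div_nonneg (by linarith) (by linarith)
  have h4 := mul_le_mul_of_nonneg_right (sub_le_sub_right h (l (p : ℝ × ℝ).1)) h3
  rw [mul_div_cancel₀ _ (by linarith)] at h4
  linarith

theorem stretch_zero {G G' : ℝ × ℝ → ℝ} (hG : IsStripFunction G l r)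
    (hG' : IsStripFunction G' l' r')
    (hb : ∀ x ∈ Ioc (0 : ℝ) 1, 0 ≤ l x ∧ l x < r x ∧ r x ≤ 1)
    (hb' : ∀ x ∈ Ioc (0 : ℝ) 1, 0 ≤ l' x ∧ l' x < r' x ∧ r' x ≤ 1) (p : unitSquare)
    (hp : G p = 0) : G' (stretch l r l' r' p) = 0 := by
  rw [hG.2] at hp
  rw [hG'.2, stretch_fst]
  rcases eq_or_ne (p : ℝ × ℝ).1 0 with h | h
  · exact Or.inl h
  have hx : (p : ℝ × ℝ).1 ∈ Ioc (0 : ℝ) 1 := ⟨lt_of_le_of_ne p.2.1.1 (Ne.symm h), p.2.1.2⟩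
  rcases hp with h' | h' | h'
  · exact Or.inl h'
  · exact Or.inr (Or.inl (stretch_snd_le h (hb' _ hx).1 (hb _ hx).2.1 (hb' _ hx).2.1 h'))
  · exact Or.inr (Or.inr (le_stretch_snd h (hb' _ hx).2.2 (hb _ hx).2.1 (hb' _ hx).2.1 h'))

open doubleSquare in
theorem stretch_comp_stretch {G G' : ℝ × ℝ → ℝ} (hG : IsStripFunction G l r)
    (hG' : IsStripFunction G' l' r')
    (hb : ∀ x ∈ Ioc (0 : ℝ) 1, 0 ≤ l x ∧ l x < r x ∧ r x ≤ 1)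
    (hb' : ∀ x ∈ Ioc (0 : ℝ) 1, 0 ≤ l' x ∧ l' x < r' x ∧ r' x ≤ 1)
    (hc : Continuous (stretch l r l' r')) (hc' : Continuous (stretch l' r' l r)) :
    ((map hG'.1 hG.1 ⟨_, hc'⟩ (stretch_zero hG' hG hb' hb)).comp
      (map hG.1 hG'.1 ⟨_, hc⟩ (stretch_zero hG hG' hb hb'))).Homotopic
      (ContinuousMap.id (doubleSquare G)) := by
  have hsq : ∀ (p q : unitSquare) (s : unitInterval),
      (sqPt (((p : ℝ × ℝ).1, (1 - s) * (q : ℝ × ℝ).2 + s * (p : ℝ × ℝ).2)) : ℝ × ℝ) =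
        ((p : ℝ × ℝ).1, (1 - s) * (q : ℝ × ℝ).2 + s * (p : ℝ × ℝ).2) := by
    intro p q s
    have := s.2.1
    have := s.2.2
    have := p.2.2.1
    have := p.2.2.2
    have := q.2.2.1
    have := q.2.2.2
    exact sqPt_val p.2.1.1 p.2.1.2 (by dsimp only; nlinarith) (by dsimp only; nlinarith)
  have hend : ∀ p, stretch l' r' l r (stretch l r l' r' p) = sqPt ((p : ℝ × ℝ).1,
      (1 - ((0 : unitInterval) : ℝ)) * (stretch l' r' l r (stretch l r l' r' p) : ℝ × ℝ).2 +
        ((0 : unitInterval) : ℝ) * (p : ℝ × ℝ).2) := by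
    intro p
    apply Subtype.ext
    rw [hsq]
    ext
    · dsimp only
      rw [stretch_fst, stretch_fst]
    · simp
  refine homotopic_of_deformation hG.1 (fun p s => sqPt ((p : ℝ × ℝ).1, (1 - s) *
    (stretch l' r' l r (stretch l r l' r' p) : ℝ × ℝ).2 + s * (p : ℝ × ℝ).2)) ?_ ?_ ?_ ?_ ?_ ?_
  · refine continuous_sqPt.comp (Continuous.prodMk (by fun_prop) (Continuous.add
      (Continuous.mul (by fun_prop) ?_) (by fun_prop)))
    exact (continuous_snd.comp continuous_subtype_val).comp
      (hc'.comp (hc.comp continuous_fst))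
  · intro p s hp
    rw [hG.2] at hp ⊢
    rw [hsq]
    dsimp only
    rcases eq_or_ne (p : ℝ × ℝ).1 0 with h | h
    · exact Or.inl h
    have hx : (p : ℝ × ℝ).1 ∈ Ioc (0 : ℝ) 1 := ⟨lt_of_le_of_ne p.2.1.1 (Ne.symm h), p.2.1.2⟩
    obtain ⟨b1, b2, b3⟩ := hb _ hx
    obtain ⟨b1', b2', b3'⟩ := hb' _ hx
    have e1 : (stretch l r l' r' p : ℝ × ℝ).1 = (p : ℝ × ℝ).1 := stretch_fst p
    have := s.2.1
    have := s.2.2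
    rcases hp with h' | h' | h'
    · exact absurd h' h
    · have h1 := stretch_snd_le (r' := r') h b1' b2 b2' h'
      have h2 := stretch_snd_le (p := stretch l r l' r' p) (l := l') (r := r') (l' := l) (r' := r)
        (by rwa [e1]) (by rwa [e1]) (by rwa [e1]) (by rwa [e1]) (by rwa [e1])
      rw [e1] at h2
      exact Or.inr (Or.inl (by nlinarith))
    · have h1 := le_stretch_snd (l' := l') h b3' b2 b2' h'
      have h2 := le_stretch_snd (p := stretch l r l' r' p) (l := l') (r := r') (l' := l) (r' := r)
        (by rwa [e1]) (by rwa [e1]) (by rwa [e1]) (by rwa [e1]) (by rwa [e1])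
      rw [e1] at h2
      exact Or.inr (Or.inr (by nlinarith))
  · intro p
    rw [ContinuousMap.comp_apply, map_flat, map_flat]
    exact congrArg _ (hend p)
  · intro p
    rw [ContinuousMap.comp_apply, doubleSquare.map_top, doubleSquare.map_top]
    exact congrArg _ (hend p)
  · intro p
    simp
  · intro p
    simp

/-- Doubled squares of strips whose boundaries approach each other, and whose widths have a ratio
that tends to `1`, are homotopy equivalent. -/
theorem nonempty_homotopyEquiv_of_strips {G G' : ℝ × ℝ → ℝ} (hG : IsStripFunction G l r)
    (hG' : IsStripFunction G' l' r') (hl : ContinuousOn l (Ioc 0 1))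
    (hr : ContinuousOn r (Ioc 0 1)) (hl' : ContinuousOn l' (Ioc 0 1))
    (hr' : ContinuousOn r' (Ioc 0 1))
    (hb : ∀ x ∈ Ioc (0 : ℝ) 1, 0 ≤ l x ∧ l x < r x ∧ r x ≤ 1)
    (hb' : ∀ x ∈ Ioc (0 : ℝ) 1, 0 ≤ l' x ∧ l' x < r' x ∧ r' x ≤ 1) {C : ℝ}
    (h1 : ∀ x ∈ Ioc (0 : ℝ) 1, |l x - l' x| ≤ C * x)
    (h2 : ∀ x ∈ Ioc (0 : ℝ) 1, |(r' x - l' x) / (r x - l x) - 1| ≤ C * x)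
    (h3 : ∀ x ∈ Ioc (0 : ℝ) 1, |(r x - l x) / (r' x - l' x) - 1| ≤ C * x) :
    Nonempty (doubleSquare G ≃ₕ doubleSquare G') := by
  have hc := continuous_stretch hl hr hl' hr' hb h1 h2
  have hc' := continuous_stretch hl' hr' hl hr hb'
    (fun x hx => by rw [abs_sub_comm]; exact h1 x hx) h3
  exact ⟨⟨_, _, stretch_comp_stretch hG hG' hb hb' hc hc',
    stretch_comp_stretch hG' hG hb' hb hc' hc⟩⟩

end Strips

/-! ### The solid tube and its boundary -/

/-- Splitting a point under the graph of the sum of two tents into points under the tents: the left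
half. Here `h₁`, `h₂` are the heights and `w₁`, `w₂` the widths of the two tents, weighted by
`1 - t` and `t`, and the first tent is at least as steep as the second. -/
theorem exists_split_tents_left {w₁ w₂ h₁ h₂ t a z : ℝ} (hw₁ : 0 < w₁) (hw₂ : 0 < w₂) (hh₁ : 0 < h₁)
    (hh₂ : 0 < h₂) (ht0 : 0 ≤ t) (ht1 : t ≤ 1)
    (ha0 : 0 ≤ a) (ha : a ≤ ((1 - t) * w₁ + t * w₂) / 2) (hz : 0 ≤ z)
    (hz1 : z ≤ 2 * h₁ / w₁ * a)
    (hz2 : z ≤ (1 - t) * (h₁ - h₂ / w₂ * w₁) + 2 * h₂ / w₂ * a) :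
    ∃ a₁ a₂ z₁ z₂ : ℝ, 0 ≤ a₁ ∧ a₁ ≤ w₁ / 2 ∧ 0 ≤ a₂ ∧ a₂ ≤ w₂ / 2 ∧ 0 ≤ z₁ ∧ 0 ≤ z₂ ∧
      z₁ ≤ 2 * h₁ / w₁ * a₁ ∧ z₂ ≤ 2 * h₂ / w₂ * a₂ ∧ (1 - t) * a₁ + t * a₂ = a ∧
      (1 - t) * z₁ + t * z₂ = z := by
  have hs1 : 0 < 2 * h₁ / w₁ := by positivity
  have hs2 : 0 < 2 * h₂ / w₂ := by positivity
  by_cases hc : a < (1 - t) * w₁ / 2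
  · have ht : 0 < 1 - t := by
      by_contra hneg
      have : 1 - t = 0 := by linarith
      rw [this] at hc
      linarith
    refine ⟨a / (1 - t), 0, z / (1 - t), 0, by positivity, ?_, le_rfl, by positivity, by positivity,
      le_rfl, ?_, by simp, ?_, ?_⟩
    · rw [div_le_iff₀ ht]; linarith
    · rw [← mul_div_assoc]; gcongr
    · field_simp; ring
    · field_simp; ring
  · push Not at hc
    obtain ⟨a₂, ha₂0, ha₂1, ha₂⟩ : ∃ a₂, 0 ≤ a₂ ∧ a₂ ≤ w₂ / 2 ∧ t * a₂ = a - (1 - t) * w₁ / 2 := by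
      rcases ht0.eq_or_lt with rfl | ht
      · exact ⟨0, le_rfl, by positivity, by linarith⟩
      · refine ⟨(a - (1 - t) * w₁ / 2) / t, div_nonneg (by linarith) ht0, ?_, by field_simp⟩
        rw [div_le_iff₀ ht]; linarith
    have hT : z ≤ (1 - t) * h₁ + t * (2 * h₂ / w₂ * a₂) := by
      have : t * (2 * h₂ / w₂ * a₂) = 2 * h₂ / w₂ * (a - (1 - t) * w₁ / 2) := by rw [← ha₂]; ring
      rw [this]
      refine hz2.trans (le_of_eq ?_)
      ring
    obtain ⟨c, hc0, hc1, hcz⟩ : ∃ c, 0 ≤ c ∧ c ≤ 1 ∧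
        c * ((1 - t) * h₁ + t * (2 * h₂ / w₂ * a₂)) = z := by
      rcases (hz.trans hT).eq_or_lt with h | h
      · exact ⟨0, le_rfl, zero_le_one, by linarith⟩
      · exact ⟨z / _, div_nonneg hz h.le, (div_le_one h).2 hT, div_mul_cancel₀ _ h.ne'⟩
    refine ⟨w₁ / 2, a₂, c * h₁, c * (2 * h₂ / w₂ * a₂), by positivity, le_rfl, ha₂0, ha₂1,
      by positivity, by positivity, ?_, ?_, by linarith, by linarith⟩
    · have : 2 * h₁ / w₁ * (w₁ / 2) = h₁ := by field_simp
      rw [this]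
      exact mul_le_of_le_one_left hh₁.le hc1
    · exact mul_le_of_le_one_left (by positivity) hc1

theorem exists_split_tents {w₁ w₂ h₁ h₂ t a z : ℝ} (hw₁ : 0 < w₁) (hw₂ : 0 < w₂) (hh₁ : 0 < h₁)
    (hh₂ : 0 < h₂) (ht0 : 0 ≤ t) (ht1 : t ≤ 1)
    (ha0 : 0 ≤ a) (ha : a ≤ (1 - t) * w₁ + t * w₂) (hz : 0 ≤ z)
    (hz1 : z ≤ 2 * h₁ / w₁ * min a ((1 - t) * w₁ + t * w₂ - a))
    (hz2 : z ≤ (1 - t) * (h₁ - h₂ / w₂ * w₁) +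
      2 * h₂ / w₂ * min a ((1 - t) * w₁ + t * w₂ - a)) :
    ∃ a₁ a₂ z₁ z₂ : ℝ, 0 ≤ a₁ ∧ a₁ ≤ w₁ ∧ 0 ≤ a₂ ∧ a₂ ≤ w₂ ∧ 0 ≤ z₁ ∧ 0 ≤ z₂ ∧
      z₁ ≤ 2 * h₁ / w₁ * min a₁ (w₁ - a₁) ∧ z₂ ≤ 2 * h₂ / w₂ * min a₂ (w₂ - a₂) ∧
      (1 - t) * a₁ + t * a₂ = a ∧ (1 - t) * z₁ + t * z₂ = z := by
  by_cases hc : a ≤ ((1 - t) * w₁ + t * w₂) / 2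
  · rw [min_eq_left (by linarith)] at hz1 hz2
    obtain ⟨a₁, a₂, z₁, z₂, h1, h2, h3, h4, h5, h6, h7, h8, h9, h10⟩ :=
      exists_split_tents_left hw₁ hw₂ hh₁ hh₂ ht0 ht1 ha0 hc hz hz1 hz2
    refine ⟨a₁, a₂, z₁, z₂, h1, by linarith, h3, by linarith, h5, h6, ?_, ?_, h9, h10⟩
    · rwa [min_eq_left (by linarith)]
    · rwa [min_eq_left (by linarith)]
  · push Not at hc
    rw [min_eq_right (by linarith)] at hz1 hz2
    obtain ⟨a₁, a₂, z₁, z₂, h1, h2, h3, h4, h5, h6, h7, h8, h9, h10⟩ :=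
      exists_split_tents_left (a := (1 - t) * w₁ + t * w₂ - a) hw₁ hw₂ hh₁ hh₂ ht0 ht1
        (by linarith) (by linarith) hz hz1 hz2
    refine ⟨w₁ - a₁, w₂ - a₂, z₁, z₂, by linarith, by linarith, by linarith, by linarith, h5, h6,
      ?_, ?_, by linarith, h10⟩
    · rwa [min_eq_right (by linarith), sub_sub_cancel]
    · rwa [min_eq_right (by linarith), sub_sub_cancel]

/-- The points of an isosceles triangle in the plane with constant first coordinate `x`. -/
theorem mem_convexHull_tent {x l w h a z : ℝ} (hw : 0 < w) (hh : 0 < h)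
    (hz : 0 ≤ z) (hz1 : z ≤ 2 * h / w * min a (w - a)) {S : Set (ℝ × ℝ × ℝ)}
    (hL : (x, l, 0) ∈ S) (hR : (x, l + w, 0) ∈ S) (hM : (x, l + w / 2, h) ∈ S) :
    (x, l + a, z) ∈ convexHull ℝ S := by
  have h1 : z / h * (w / 2) ≤ min a (w - a) := by
    rw [div_mul_eq_mul_div, div_le_iff₀ hh]
    rw [div_mul_eq_mul_div, le_div_iff₀ hw] at hz1
    linarith
  have h2 := h1.trans (min_le_left _ _)
  have h3 := h1.trans (min_le_right _ _)
  have h4 : 0 ≤ z / h := by positivity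
  have hsum : (1 - z / h - (a - z / h * (w / 2)) / w) + (a - z / h * (w / 2)) / w + z / h = 1 := by
    ring
  have key := (convex_convexHull ℝ S).sum_mem (t := (Finset.univ : Finset (Fin 3)))
    (w := ![1 - z / h - (a - z / h * (w / 2)) / w, (a - z / h * (w / 2)) / w, z / h])
    (z := ![(x, l, 0), (x, l + w, 0), (x, l + w / 2, h)]) ?_ ?_ ?_
  · convert key using 1
    simp only [Fin.sum_univ_three, Matrix.cons_val_zero, Matrix.cons_val_one, Matrix.cons_val,
      Prod.smul_mk, Prod.mk_add_mk, smul_eq_mul, mul_zero, zero_add, add_zero]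
    ext
    · dsimp only
      rw [← add_mul, ← add_mul, hsum, one_mul]
    · dsimp only
      field_simp
      ring
    · dsimp only
      field_simp
  · intro i _
    fin_cases i
    · have : (a - z / h * (w / 2)) / w ≤ 1 - z / h := by
        rw [div_le_iff₀ hw]; linarith
      simp only [Fin.zero_eta, Matrix.cons_val_zero]
      linarith
    · exact div_nonneg (by linarith) hw.le
    · exact h4
  · simp [Fin.sum_univ_three]
  · intro i _
    fin_cases i
    · exact subset_convexHull ℝ S hL
    · exact subset_convexHull ℝ S hR
    · exact subset_convexHull ℝ S hM

/-- The convex hull of two isosceles triangles in the planes `x = x₁` and `x = x₂`, with heights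
`h₁`, `h₂` and bases `[l₁, l₁ + w₁]`, `[l₂, l₂ + w₂]`. The slice over `(1 - t) x₁ + t x₂` is the
Minkowski combination of the two triangles, a pentagon if the first one is steeper. -/
theorem mem_convexHull_two_tents {x₁ x₂ l₁ l₂ w₁ w₂ h₁ h₂ : ℝ} (hw₁ : 0 < w₁)
    (hw₂ : 0 < w₂) (hh₁ : 0 < h₁) (hh₂ : 0 < h₂) (hs : h₂ / w₂ * w₁ ≤ h₁) (p : ℝ × ℝ × ℝ) :
    p ∈ convexHull ℝ {((x₁, l₁, 0) : ℝ × ℝ × ℝ), (x₁, l₁ + w₁, 0), (x₁, l₁ + w₁ / 2, h₁),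
      (x₂, l₂, 0), (x₂, l₂ + w₂, 0), (x₂, l₂ + w₂ / 2, h₂)} ↔
    ∃ t a : ℝ, 0 ≤ t ∧ t ≤ 1 ∧ 0 ≤ a ∧ a ≤ (1 - t) * w₁ + t * w₂ ∧ 0 ≤ p.2.2 ∧
      p.2.2 ≤ 2 * h₁ / w₁ * min a ((1 - t) * w₁ + t * w₂ - a) ∧
      p.2.2 ≤ (1 - t) * (h₁ - h₂ / w₂ * w₁) +
        2 * h₂ / w₂ * min a ((1 - t) * w₁ + t * w₂ - a) ∧
      p.1 = (1 - t) * x₁ + t * x₂ ∧ p.2.1 = (1 - t) * l₁ + t * l₂ + a := by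
  have hs1 : 0 < 2 * h₁ / w₁ := by positivity
  have hs2 : 0 < 2 * h₂ / w₂ := by positivity
  constructor
  · intro hp
    -- the right hand side is convex because `t` and `a` are affine functions of the point
    set C : Set (ℝ × ℝ × ℝ) := {p | ∃ t a : ℝ, 0 ≤ t ∧ t ≤ 1 ∧ 0 ≤ a ∧
      a ≤ (1 - t) * w₁ + t * w₂ ∧ 0 ≤ p.2.2 ∧
      p.2.2 ≤ 2 * h₁ / w₁ * min a ((1 - t) * w₁ + t * w₂ - a) ∧
      p.2.2 ≤ (1 - t) * (h₁ - h₂ / w₂ * w₁) +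
        2 * h₂ / w₂ * min a ((1 - t) * w₁ + t * w₂ - a) ∧
      p.1 = (1 - t) * x₁ + t * x₂ ∧ p.2.1 = (1 - t) * l₁ + t * l₂ + a} with hC
    have hconv : Convex ℝ C := by
      rintro p ⟨t, a, h1, h2, h3, h4, h5, h6, h7, h8, h9⟩ q
        ⟨t', a', h1', h2', h3', h4', h5', h6', h7', h8', h9'⟩ c d hc hd hcd
      have hc' : c = 1 - d := by linarith
      subst hc'
      rw [mul_min_of_nonneg _ _ hs1.le, le_min_iff] at h6 h6'
      rw [mul_min_of_nonneg _ _ hs2.le, ← min_add_add_left, le_min_iff] at h7 h7'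
      refine ⟨(1 - d) * t + d * t', (1 - d) * a + d * a', by positivity, by nlinarith,
        by positivity, by nlinarith, ?_, ?_, ?_, ?_, ?_⟩
      · simp only [Prod.snd_add, Prod.smul_snd, smul_eq_mul]
        positivity
      · rw [mul_min_of_nonneg _ _ hs1.le, le_min_iff]
        simp only [Prod.snd_add, Prod.smul_snd, smul_eq_mul]
        have m1 := mul_le_mul_of_nonneg_left h6.1 hc
        have m2 := mul_le_mul_of_nonneg_left h6.2 hc
        have m3 := mul_le_mul_of_nonneg_left h6'.1 hd
        have m4 := mul_le_mul_of_nonneg_left h6'.2 hd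
        constructor <;> linarith
      · rw [mul_min_of_nonneg _ _ hs2.le, ← min_add_add_left, le_min_iff]
        simp only [Prod.snd_add, Prod.smul_snd, smul_eq_mul]
        have m1 := mul_le_mul_of_nonneg_left h7.1 hc
        have m2 := mul_le_mul_of_nonneg_left h7.2 hc
        have m3 := mul_le_mul_of_nonneg_left h7'.1 hd
        have m4 := mul_le_mul_of_nonneg_left h7'.2 hd
        constructor <;> linarith
      · simp only [Prod.fst_add, Prod.smul_fst, smul_eq_mul, h8, h8']
        ring
      · simp only [Prod.fst_add, Prod.snd_add, Prod.smul_fst, Prod.smul_snd, smul_eq_mul, h9, h9']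
        ring
    refine convexHull_min ?_ hconv hp
    have e1 : 2 * h₁ / w₁ * (w₁ / 2) = h₁ := by field_simp
    have e2 : 2 * h₂ / w₂ * (w₂ / 2) = h₂ := by field_simp
    have e3 : 2 * h₂ / w₂ * (w₁ / 2) = h₂ / w₂ * w₁ := by ring
    -- at the second triangle the bound by the first slope follows from the comparison of slopes
    have e4 : h₂ ≤ 2 * h₁ / w₁ * (w₂ / 2) := by
      rw [div_mul_eq_mul_div, div_le_iff₀ hw₂] at hs
      rw [div_mul_div_comm, le_div_iff₀ (by positivity)]
      linarith
    rintro _ (rfl | rfl | rfl | rfl | rfl | rfl)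
    · exact ⟨0, 0, by simp, by simp, by simp, by simp [hw₁.le], by simp, by simp [hw₁.le],
        by simp [hw₁.le, hs], by simp, by simp⟩
    · exact ⟨0, w₁, by simp, by simp, hw₁.le, by simp, by simp, by simp [hw₁.le],
        by simp [hw₁.le, hs], by simp, by simp⟩
    · refine ⟨0, w₁ / 2, by simp, by simp, by positivity, by linarith, hh₁.le, ?_, ?_, by simp,
        by simp⟩
      · rw [min_eq_left (by linarith), e1]
      · rw [min_eq_left (by linarith), e3]
        linarith
    · exact ⟨1, 0, by simp, by simp, by simp, by simp [hw₂.le], by simp, by simp [hw₂.le],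
        by simp [hw₂.le], by simp, by simp⟩
    · exact ⟨1, w₂, by simp, by simp, hw₂.le, by simp, by simp, by simp [hw₂.le],
        by simp [hw₂.le], by simp, by simp⟩
    · refine ⟨1, w₂ / 2, by simp, by simp, by positivity, by linarith, hh₂.le, ?_, ?_, by simp,
        by simp⟩
      · rw [min_eq_left (by linarith)]
        exact e4
      · rw [min_eq_left (by linarith), e2]
        simp
  · rintro ⟨t, a, h1, h2, h3, h4, h5, h6, h7, h8, h9⟩
    obtain ⟨a₁, a₂, z₁, z₂, k1, k2, k3, k4, k5, k6, k7, k8, k9, k10⟩ :=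
      exists_split_tents hw₁ hw₂ hh₁ hh₂ h1 h2 h3 h4 h5 h6 h7
    have m1 := mem_convexHull_tent (x := x₁) (l := l₁) (S := {((x₁, l₁, 0) : ℝ × ℝ × ℝ),
      (x₁, l₁ + w₁, 0), (x₁, l₁ + w₁ / 2, h₁), (x₂, l₂, 0), (x₂, l₂ + w₂, 0),
      (x₂, l₂ + w₂ / 2, h₂)}) hw₁ hh₁ k5 k7 (by simp) (by simp) (by simp)
    have m2 := mem_convexHull_tent (x := x₂) (l := l₂) (S := {((x₁, l₁, 0) : ℝ × ℝ × ℝ),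
      (x₁, l₁ + w₁, 0), (x₁, l₁ + w₁ / 2, h₁), (x₂, l₂, 0), (x₂, l₂ + w₂, 0),
      (x₂, l₂ + w₂ / 2, h₂)}) hw₂ hh₂ k6 k8 (by simp) (by simp) (by simp)
    have key := convex_convexHull ℝ _ m1 m2 (sub_nonneg.2 h2) h1 (by ring)
    convert key using 1
    ext
    · simpa using h8
    · simp only [Prod.smul_mk, Prod.mk_add_mk, smul_eq_mul]
      rw [h9, ← k9]
      ring
    · simp only [Prod.smul_mk, Prod.mk_add_mk, smul_eq_mul]
      exact k10.symm

section Tube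

variable {y ε : ℝ}

/-- The left end of the base of the triangle at `x = 1 / k`. -/
noncomputable def nodeL (y ε : ℝ) (k : ℕ) : ℝ × ℝ × ℝ :=
  (1 / (k : ℝ), if Even k then 1 - y - ε / k else 0, 0)

/-- The right end of the base of the triangle at `x = 1 / k`. -/
noncomputable def nodeR (y ε : ℝ) (k : ℕ) : ℝ × ℝ × ℝ :=
  (1 / (k : ℝ), (if Even k then 1 - y - ε / k else 0) + (y + ε / k), 0)

/-- The apex of the triangle at `x = 1 / k`. -/
noncomputable def nodeM (y ε : ℝ) (k : ℕ) : ℝ × ℝ × ℝ :=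
  (1 / (k : ℝ), (if Even k then 1 - y - ε / k else 0) + (y + ε / k) / 2, 1 / (2 * (k : ℝ)))

/-- The `k`-th solid of the tube, in a form that does not distinguish the parity of `k`. -/
def tubeSlab (y ε : ℝ) (k : ℕ) : Set (ℝ × ℝ × ℝ) :=
  convexHull ℝ {nodeL y ε k, nodeR y ε k, nodeM y ε k, nodeL y ε (k + 1), nodeR y ε (k + 1),
    nodeM y ε (k + 1)}

theorem tubeOdd_eq {n : ℕ} (hn : 1 ≤ n) : tubeOdd y ε n = tubeSlab y ε (2 * n - 1) := by
  obtain ⟨m, rfl⟩ : ∃ m, n = m + 1 := ⟨n - 1, by omega⟩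
  have h1 : ¬ Even (2 * (m + 1) - 1) := by
    rw [Nat.not_even_iff_odd]
    exact ⟨m, by omega⟩
  have h2 : 2 * (m + 1) - 1 + 1 = 2 * (m + 1) := by omega
  have h3 : ((2 * (m + 1) - 1 : ℕ) : ℝ) = 2 * ((m + 1 : ℕ) : ℝ) - 1 := by
    rw [Nat.cast_sub (by omega)]
    push_cast
    ring
  have h4 : Even (2 * (m + 1)) := even_two_mul _
  have e1 : nodeL y ε (2 * (m + 1) - 1) = ptA (m + 1) := by simp [nodeL, ptA, h1, h3]
  have e2 : nodeR y ε (2 * (m + 1) - 1) = ptC y ε (m + 1) := by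
    simp [nodeR, ptC, h1, h3]
  have e3 : nodeM y ε (2 * (m + 1) - 1) = ptE y ε (m + 1) := by
    rw [nodeM, ptE, if_neg h1, h3]
    congr 2
    ring
  have e4 : nodeL y ε (2 * (m + 1)) = ptD y ε (m + 1) := by simp [nodeL, ptD]
  have e5 : nodeR y ε (2 * (m + 1)) = ptB (m + 1) := by
    rw [nodeR, ptB, if_pos h4]
    push_cast
    congr 2
    ring
  have e6 : nodeM y ε (2 * (m + 1)) = ptF y ε (m + 1) := by
    rw [nodeM, ptF, if_pos h4]
    push_cast
    congr 2
    · ring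
    · ring
  rw [tubeSlab, h2, e1, e2, e3, e4, e5, e6, tubeOdd]
  congr 1
  ext p
  simp only [mem_insert_iff, mem_singleton_iff]
  tauto

theorem tubeEven_eq (n : ℕ) : tubeEven y ε n = tubeSlab y ε (2 * n) := by
  have h1 : ¬ Even (2 * n + 1) := by
    rw [Nat.not_even_iff_odd]
    exact ⟨n, rfl⟩
  have h3 : ((2 * n + 1 : ℕ) : ℝ) = 2 * ((n + 1 : ℕ) : ℝ) - 1 := by
    push_cast
    ring
  have h4 : Even (2 * n) := even_two_mul _
  have e1 : nodeL y ε (2 * n + 1) = ptA (n + 1) := by rw [nodeL, ptA, if_neg h1, h3]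
  have e2 : nodeR y ε (2 * n + 1) = ptC y ε (n + 1) := by
    rw [nodeR, ptC, if_neg h1, h3, zero_add]
  have e3 : nodeM y ε (2 * n + 1) = ptE y ε (n + 1) := by
    rw [nodeM, ptE, if_neg h1, h3]
    congr 2
    ring
  have e4 : nodeL y ε (2 * n) = ptD y ε n := by simp [nodeL, ptD]
  have e5 : nodeR y ε (2 * n) = ptB n := by
    rw [nodeR, ptB, if_pos h4]
    push_cast
    congr 2
    ring
  have e6 : nodeM y ε (2 * n) = ptF y ε n := by
    rw [nodeM, ptF, if_pos h4]
    push_cast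
    congr 2
    · ring
    · ring
  rw [tubeSlab, e1, e2, e3, e4, e5, e6, tubeEven]
  congr 1
  ext p
  simp only [mem_insert_iff, mem_singleton_iff]
  tauto

theorem mem_solidTube_iff_exists (p : ℝ × ℝ × ℝ) :
    p ∈ solidTube y ε ↔ ∃ k : ℕ, 1 ≤ k ∧ p ∈ tubeSlab y ε k := by
  simp only [solidTube, mem_iUnion, mem_ofPred_eq, mem_union]
  constructor
  · rintro ⟨n, hn, h | h⟩
    · exact ⟨2 * n - 1, by omega, by rwa [← tubeOdd_eq hn]⟩
    · exact ⟨2 * n, by omega, by rwa [← tubeEven_eq]⟩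
  · rintro ⟨k, hk, h⟩
    rcases Nat.even_or_odd' k with ⟨n, rfl | rfl⟩
    · exact ⟨n, by omega, Or.inr (by rwa [tubeEven_eq])⟩
    · exact ⟨n + 1, by omega, Or.inl (by rwa [tubeOdd_eq (by omega)])⟩

/-- The distance from `v` to the boundary of the base of the tube over `x`; zero outside. -/
noncomputable def edgeDist (y ε : ℝ) (p : ℝ × ℝ) : ℝ :=
  max 0 (min (p.2 - lowerEdge y ε p.1) (lowerEdge y ε p.1 + (y + ε * p.1) - p.2))

/-- The roof of the tube over the `k`-th slab. -/
noncomputable def roofSlab (y ε : ℝ) (k : ℕ) (p : ℝ × ℝ) : ℝ :=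
  min (2 * (1 / (2 * (k : ℝ))) / (y + ε / k) * edgeDist y ε p)
    ((1 - (k + 1) * (1 - k * p.1)) * (1 / (2 * (k : ℝ)) -
        1 / (2 * ((k + 1 : ℕ) : ℝ)) / (y + ε / (k + 1 : ℕ)) * (y + ε / k)) +
      2 * (1 / (2 * ((k + 1 : ℕ) : ℝ))) / (y + ε / (k + 1 : ℕ)) * edgeDist y ε p)

/-- The height of the roof of the tube, extended by zero. -/
noncomputable def roof (y ε : ℝ) (p : ℝ × ℝ) : ℝ := roofSlab y ε ⌊1 / p.1⌋₊ p

theorem width_pos (hy0 : 0 ≤ y) (hε : 0 ≤ ε) (hpos : 0 < y + ε) {x : ℝ} (hx : 0 < x) :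
    0 < y + ε * x := by
  rcases hy0.eq_or_lt with rfl | h
  · have : 0 < ε := by linarith
    positivity
  · positivity

theorem nodeWidth_pos (hy0 : 0 ≤ y) (hε : 0 ≤ ε) (hpos : 0 < y + ε) {k : ℕ} (hk : 1 ≤ k) :
    0 < y + ε / k := by
  have hk' : (0 : ℝ) < k := by exact_mod_cast hk
  rw [div_eq_mul_one_div]
  exact width_pos hy0 hε hpos (by positivity)

/-- The slopes of the triangles decrease. -/
theorem slope_anti (hy0 : 0 ≤ y) (hε : 0 ≤ ε) (hpos : 0 < y + ε) {k : ℕ} (hk : 1 ≤ k) :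
    1 / (2 * ((k + 1 : ℕ) : ℝ)) / (y + ε / (k + 1 : ℕ)) * (y + ε / k) ≤ 1 / (2 * (k : ℝ)) := by
  have hk' : (0 : ℝ) < k := by exact_mod_cast hk
  have h2 := nodeWidth_pos hy0 hε hpos (k := k + 1) (by omega)
  rw [div_div, div_mul_eq_mul_div, one_mul, div_le_div_iff₀ (by positivity) (by positivity)]
  push_cast
  have : ((k : ℝ) + 1) * (y + ε / (k + 1)) = (k + 1) * y + ε := by field_simp
  have h3 : (k : ℝ) * (y + ε / k) = k * y + ε := by field_simp
  nlinarith

theorem edgeDist_nonneg (p : ℝ × ℝ) : 0 ≤ edgeDist y ε p := le_max_left _ _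

theorem edgeDist_le (p : ℝ × ℝ) (h : 0 ≤ y + ε * p.1) : edgeDist y ε p ≤ (y + ε * p.1) / 2 := by
  refine max_le (by linarith) ?_
  rcases le_total (p.2 - lowerEdge y ε p.1) ((y + ε * p.1) / 2) with h' | h'
  · exact (min_le_left _ _).trans h'
  · exact (min_le_right _ _).trans (by linarith)

theorem roof_eq (hy0 : 0 ≤ y) (hε : 0 ≤ ε) (hpos : 0 < y + ε) {p : ℝ × ℝ} {k : ℕ} (hk : 1 ≤ k)
    (h1 : 1 / ((k : ℝ) + 1) ≤ p.1) (h2 : p.1 ≤ 1 / (k : ℝ)) :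
    roof y ε p = roofSlab y ε k p := by
  have hk' : (0 : ℝ) < k := by exact_mod_cast hk
  rcases h1.eq_or_lt with h | h
  · have hf : ⌊1 / p.1⌋₊ = k + 1 := by
      rw [← h, one_div_one_div]
      exact_mod_cast Nat.floor_natCast (k + 1)
    rw [roof, hf]
    have hw := nodeWidth_pos hy0 hε hpos (k := k + 1) (by omega)
    have hw0 := nodeWidth_pos hy0 hε hpos hk
    have hd0 := edgeDist_nonneg (y := y) (ε := ε) p
    have hd := edgeDist_le (y := y) (ε := ε) p (by
      have : 0 < p.1 := by rw [← h]; positivity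
      positivity)
    have ew : y + ε * p.1 = y + ε / (k + 1 : ℕ) := by rw [← h]; push_cast; ring
    rw [ew] at hd
    have s1 := slope_anti hy0 hε hpos hk
    have s2 := slope_anti hy0 hε hpos (k := k + 1) (by omega)
    have c1 : ((k : ℝ) + 1) * (1 - k * p.1) = 1 := by rw [← h]; field_simp; ring
    have c2 : (((k + 1 : ℕ) : ℝ) + 1) * (1 - ((k + 1 : ℕ) : ℝ) * p.1) = 0 := by
      rw [← h]; push_cast; field_simp; ring
    rw [roofSlab, roofSlab, c1, c2]
    generalize edgeDist y ε p = d at hd hd0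
    generalize 1 / (2 * (k : ℝ)) = ha at *
    generalize 1 / (2 * ((k + 1 : ℕ) : ℝ)) = hb at *
    generalize 1 / (2 * ((k + 1 + 1 : ℕ) : ℝ)) = hc at *
    generalize y + ε / (k : ℝ) = wa at *
    generalize y + ε / ((k + 1 : ℕ) : ℝ) = wb at *
    generalize y + ε / ((k + 1 + 1 : ℕ) : ℝ) = wc at *
    rw [min_eq_left, min_eq_right]
    · ring
    · rw [sub_self, zero_mul, zero_add, mul_div_assoc, mul_div_assoc]
      have : hb / wb ≤ ha / wa := by rwa [le_div_iff₀ hw0]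
      gcongr
    · have e : hb = hb / wb * wb := by field_simp
      have : hc / wc ≤ hb / wb := by rwa [le_div_iff₀ hw]
      rw [sub_zero, one_mul, mul_div_assoc, mul_div_assoc]
      nlinarith [mul_nonneg (sub_nonneg.2 this) (sub_nonneg.2 hd)]
  · have hx : 0 < p.1 := lt_trans (by positivity) h
    have : ⌊1 / p.1⌋₊ = k := by
      rw [Nat.floor_eq_iff (by positivity)]
      constructor
      · rw [le_div_iff₀ hx]
        rw [le_div_iff₀ hk'] at h2
        linarith
      · rw [div_lt_iff₀ hx]
        rw [div_lt_iff₀ (by positivity)] at h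
        linarith
    rw [roof, this]

theorem mem_tubeSlab (hy0 : 0 ≤ y) (hε : 0 ≤ ε) (hpos : 0 < y + ε) {k : ℕ} (hk : 1 ≤ k)
    (p : ℝ × ℝ × ℝ) : p ∈ tubeSlab y ε k ↔ (1 / ((k : ℝ) + 1) ≤ p.1 ∧ p.1 ≤ 1 / (k : ℝ)) ∧
      lowerEdge y ε p.1 ≤ p.2.1 ∧ p.2.1 ≤ lowerEdge y ε p.1 + (y + ε * p.1) ∧ 0 ≤ p.2.2 ∧
      p.2.2 ≤ roof y ε (p.1, p.2.1) := by
  have hk' : (0 : ℝ) < k := by exact_mod_cast hk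
  have hw := nodeWidth_pos hy0 hε hpos (k := k + 1) (by omega)
  have hw0 := nodeWidth_pos hy0 hε hpos hk
  have eL : ∀ x, 1 / ((k : ℝ) + 1) ≤ x → x ≤ 1 / (k : ℝ) → lowerEdge y ε x =
      (1 - (k + 1) * (1 - k * x)) * (if Even k then 1 - y - ε / k else 0) +
      (k + 1) * (1 - k * x) *
        (if Even (k + 1) then 1 - y - ε / (k + 1 : ℕ) else 0) := by
    intro x hx1 hx2
    rw [lowerEdge, interp_eq _ hk hx1 hx2]
    ring
  have eW : ∀ x, (1 - (k + 1) * (1 - k * x)) * (y + ε / k) + (k + 1) * (1 - k * x) *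
      (y + ε / (k + 1 : ℕ)) = y + ε * x := by
    intro x
    push_cast
    field_simp
    ring
  rw [tubeSlab, nodeL, nodeR, nodeM, nodeL, nodeR, nodeM, mem_convexHull_two_tents hw0 hw
    (by positivity) (by positivity) (slope_anti hy0 hε hpos hk)]
  constructor
  · rintro ⟨t, a, h1, h2, h3, h4, h5, h6, h7, h8, h9⟩
    have ht : t = (k + 1) * (1 - k * p.1) := by
      rw [h8]; push_cast; field_simp; ring
    have hx1 : 1 / ((k : ℝ) + 1) ≤ p.1 := by
      rw [div_le_iff₀ (by positivity)]
      rw [ht] at h2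
      nlinarith
    have hx2 : p.1 ≤ 1 / (k : ℝ) := by
      rw [le_div_iff₀ hk']
      rw [ht] at h1
      have := nonneg_of_mul_nonneg_right h1 (by positivity)
      linarith
    rw [ht, eW] at h4 h6 h7
    rw [ht] at h9
    rw [← eL _ hx1 hx2] at h9
    have hd : edgeDist y ε (p.1, p.2.1) = min a (y + ε * p.1 - a) := by
      rw [edgeDist]
      dsimp only
      rw [h9, add_sub_cancel_left, add_sub_add_left_eq_sub]
      exact max_eq_right (le_min h3 (by linarith))
    refine ⟨⟨hx1, hx2⟩, by linarith, by linarith, h5, ?_⟩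
    rw [roof_eq hy0 hε hpos hk hx1 hx2, roofSlab, hd]
    exact le_min h6 h7
  · rintro ⟨⟨hx1, hx2⟩, h3, h4, h5, h6⟩
    obtain ⟨t0, t1⟩ := slab_coord_mem hk hx1 hx2
    rw [roof_eq hy0 hε hpos hk hx1 hx2, roofSlab, le_min_iff] at h6
    have hd : edgeDist y ε (p.1, p.2.1) = min (p.2.1 - lowerEdge y ε p.1)
        (y + ε * p.1 - (p.2.1 - lowerEdge y ε p.1)) := by
      rw [edgeDist]
      dsimp only
      rw [show lowerEdge y ε p.1 + (y + ε * p.1) - p.2.1 =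
        y + ε * p.1 - (p.2.1 - lowerEdge y ε p.1) by ring]
      exact max_eq_right (le_min (by linarith) (by linarith))
    rw [hd] at h6
    refine ⟨(k + 1) * (1 - k * p.1), p.2.1 - lowerEdge y ε p.1, t0, t1, by linarith, ?_, h5, ?_, ?_,
      ?_, ?_⟩
    · rw [eW]; linarith
    · rw [eW]; exact h6.1
    · rw [eW]; exact h6.2
    · push_cast; field_simp; ring
    · rw [← eL _ hx1 hx2]; ring

theorem mem_solidTube (hy0 : 0 ≤ y) (hε : 0 ≤ ε) (hpos : 0 < y + ε) (p : ℝ × ℝ × ℝ) :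
    p ∈ solidTube y ε ↔ (0 < p.1 ∧ p.1 ≤ 1) ∧
      lowerEdge y ε p.1 ≤ p.2.1 ∧ p.2.1 ≤ lowerEdge y ε p.1 + (y + ε * p.1) ∧ 0 ≤ p.2.2 ∧
      p.2.2 ≤ roof y ε (p.1, p.2.1) := by
  rw [mem_solidTube_iff_exists]
  constructor
  · rintro ⟨k, hk, h⟩
    rw [mem_tubeSlab hy0 hε hpos hk] at h
    have hk' : (1 : ℝ) ≤ k := by exact_mod_cast hk
    refine ⟨⟨lt_of_lt_of_le (by positivity) h.1.1, h.1.2.trans ?_⟩, h.2⟩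
    rw [div_le_one (by positivity)]
    exact hk'
  · rintro ⟨⟨h0, h1⟩, h⟩
    obtain ⟨k, hk, hk1, hk2⟩ := exists_slab h0 h1
    exact ⟨k, hk, (mem_tubeSlab hy0 hε hpos hk p).2 ⟨⟨hk1, hk2⟩, h⟩⟩

theorem roof_nonneg_le (hy0 : 0 ≤ y) (hε : 0 ≤ ε) (hpos : 0 < y + ε) {p : ℝ × ℝ} (h0 : 0 ≤ p.1)
    (h1 : p.1 ≤ 1) : 0 ≤ roof y ε p ∧ roof y ε p ≤ p.1 := by
  rcases h0.eq_or_lt with h | h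
  · have := edgeDist_nonneg (y := y) (ε := ε) p
    rw [roof, ← h, roofSlab, ← h]
    simp only [div_zero, Nat.floor_zero, Nat.cast_zero, mul_zero, zero_div, zero_mul, le_min_iff,
      le_refl, true_and, min_le_left, and_true]
    norm_num
    positivity
  · obtain ⟨k, hk, hk1, hk2⟩ := exists_slab h h1
    have hk' : (1 : ℝ) ≤ k := by exact_mod_cast hk
    have hw := nodeWidth_pos hy0 hε hpos (k := k + 1) (by omega)
    have hw0 := nodeWidth_pos hy0 hε hpos hk
    have hd := edgeDist_le (y := y) (ε := ε) p (by positivity)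
    have hd0 := edgeDist_nonneg (y := y) (ε := ε) p
    obtain ⟨t0, t1⟩ := slab_coord_mem hk hk1 hk2
    have s1 := slope_anti hy0 hε hpos hk
    rw [roof_eq hy0 hε hpos hk hk1 hk2, roofSlab]
    constructor
    · refine le_min (by positivity) (add_nonneg (mul_nonneg (by linarith) (by linarith))
        (by positivity))
    · refine (min_le_left _ _).trans ?_
      calc _ ≤ 2 * (1 / (2 * (k : ℝ))) / (y + ε / k) * ((y + ε / k) / 2) := by
            gcongr
            refine hd.trans ?_
            rw [div_eq_mul_one_div ε]
            gcongr
        _ = 1 / (2 * k) := by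
            rw [div_mul_div_cancel₀ hw0.ne', mul_div_cancel_left₀ _ (two_ne_zero' ℝ)]
        _ ≤ 1 / (k + 1) := by
            apply one_div_le_one_div_of_le <;> linarith
        _ ≤ p.1 := hk1

theorem roof_pos_iff (hy0 : 0 ≤ y) (hε : 0 ≤ ε) (hpos : 0 < y + ε) {p : ℝ × ℝ} (h0 : 0 < p.1)
    (h1 : p.1 ≤ 1) : 0 < roof y ε p ↔ lowerEdge y ε p.1 < p.2 ∧
      p.2 < lowerEdge y ε p.1 + (y + ε * p.1) := by
  obtain ⟨k, hk, hk1, hk2⟩ := exists_slab h0 h1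
  have hk' : (1 : ℝ) ≤ k := by exact_mod_cast hk
  have hw := nodeWidth_pos hy0 hε hpos (k := k + 1) (by omega)
  have hw0 := nodeWidth_pos hy0 hε hpos hk
  have hd0 := edgeDist_nonneg (y := y) (ε := ε) p
  obtain ⟨t0, t1⟩ := slab_coord_mem hk hk1 hk2
  have s1 := slope_anti hy0 hε hpos hk
  have hiff : 0 < edgeDist y ε p ↔ lowerEdge y ε p.1 < p.2 ∧
      p.2 < lowerEdge y ε p.1 + (y + ε * p.1) := by
    rw [edgeDist, lt_max_iff, lt_min_iff, sub_pos, sub_pos]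
    simp
  rw [← hiff, roof_eq hy0 hε hpos hk hk1 hk2, roofSlab, lt_min_iff]
  constructor
  · rintro ⟨h, -⟩
    exact pos_of_mul_pos_right h (by positivity)
  · intro h
    exact ⟨by positivity, add_pos_of_nonneg_of_pos (mul_nonneg (by linarith) (by linarith))
      (by positivity)⟩

theorem continuousOn_edgeDist : ContinuousOn (edgeDist y ε) {p | p.1 ∈ Ioc (0 : ℝ) 1} := by
  have hl : ContinuousOn (fun p : ℝ × ℝ => lowerEdge y ε p.1) {p | p.1 ∈ Ioc (0 : ℝ) 1} :=
    (continuousOn_interp _).comp continuous_fst.continuousOn fun p hp => hp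
  have hm : Continuous fun q : ℝ × ℝ => max 0 (min q.1 q.2) := by fun_prop
  exact hm.comp_continuousOn ((continuous_snd.continuousOn.sub hl).prodMk
    ((hl.add (by fun_prop)).sub continuous_snd.continuousOn))

theorem continuousOn_roof (hy0 : 0 ≤ y) (hε : 0 ≤ ε) (hpos : 0 < y + ε) :
    ContinuousOn (roof y ε) {p | p.1 ∈ Icc (0 : ℝ) 1} := by
  rw [continuousOn_iff_continuous_domRestrict]
  refine continuous_of_abs_le (φ := fun p : {p : ℝ × ℝ | p.1 ∈ Icc (0 : ℝ) 1} => (p : ℝ × ℝ).1)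
    (by fun_prop) (fun p => p.property.1) (C := 1)
    ?_ ?_
  · intro p
    obtain ⟨h1, h2⟩ := roof_nonneg_le hy0 hε hpos p.property.1 p.property.2
    rw [one_mul]
    exact abs_le.2 ⟨by rw [domRestrict_apply]; linarith [p.property.1], h2⟩
  · have h := continuousOn_of_slabs (φ := fun p : ℝ × ℝ => p.1) continuous_fst (A := univ)
      (f := roof y ε) ?_
    · exact h.comp continuous_subtype_val.continuousOn fun p hp => ⟨trivial, hp, p.property.2⟩
    · intro k hk
      have hk' : (1 : ℝ) ≤ k := by exact_mod_cast hk
      have hsub : (univ ∩ (fun p : ℝ × ℝ => p.1) ⁻¹' Icc (1 / ((k : ℝ) + 1)) (1 / (k : ℝ))) ⊆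
          {p | p.1 ∈ Ioc (0 : ℝ) 1} := by
        rintro p ⟨-, hp1, hp2⟩
        refine ⟨lt_of_lt_of_le (by positivity) hp1, hp2.trans ?_⟩
        rw [div_le_one (by positivity)]
        exact hk'
      have hd := (continuousOn_edgeDist (y := y) (ε := ε)).mono hsub
      refine ContinuousOn.congr (f := roofSlab y ε k) ?_
        fun p hp => roof_eq hy0 hε hpos hk hp.2.1 hp.2.2
      exact (continuous_min (α := ℝ)).comp_continuousOn ((continuousOn_const.mul hd).prodMk
        (ContinuousOn.add (by fun_prop) (continuousOn_const.mul hd)))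

end Tube

/-! ### The boundary of the tube -/

section Boundary

variable {y ε : ℝ}

theorem isStripFunction_roof (hy0 : 0 ≤ y) (hε : 0 ≤ ε) (hpos : 0 < y + ε) :
    IsStripFunction (roof y ε) (lowerEdge y ε) (fun x => lowerEdge y ε x + (y + ε * x)) := by
  refine ⟨(continuousOn_roof hy0 hε hpos).mono fun p hp => hp.1, fun p => ?_⟩
  obtain ⟨h1, h2⟩ := roof_nonneg_le hy0 hε hpos p.2.1.1 p.2.1.2
  rcases p.2.1.1.eq_or_lt with h | h
  · rw [← h] at h2
    exact iff_of_true (le_antisymm h2 h1) (Or.inl h.symm)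
  · have := roof_pos_iff hy0 hε hpos h p.2.1.2
    rw [h1.lt_iff_ne', ne_eq] at this
    rw [← not_iff_not, this, or_iff_right h.ne']
    push Not
    rfl

/-- At the end of the tube the roof is a single tent. -/
theorem roof_one (hy0 : 0 ≤ y) (hε : 0 ≤ ε) (hpos : 0 < y + ε) (v : ℝ) :
    lowerEdge y ε 1 = 0 ∧ roof y ε (1, v) = 1 / (y + ε) * max 0 (min v (y + ε - v)) := by
  have hL : lowerEdge y ε 1 = 0 := by
    rw [lowerEdge, interp_eq _ (le_refl 1) (by norm_num) (by norm_num)]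
    norm_num
  refine ⟨hL, ?_⟩
  have s1 := slope_anti hy0 hε hpos (le_refl 1)
  have hd := edgeDist_le (y := y) (ε := ε) (1, v) (by dsimp only; linarith)
  have e : edgeDist y ε (1, v) = max 0 (min v (y + ε - v)) := by
    rw [edgeDist]
    simp [hL]
  have hw : 0 < y + ε / 2 := by linarith
  rw [roof_eq hy0 hε hpos (le_refl 1) (by norm_num) (by norm_num), roofSlab, ← e]
  rw [mul_one] at hd
  norm_num at s1 ⊢
  generalize edgeDist y ε (1, v) = d at hd
  have e2 : (1 : ℝ) / 2 = (y + ε)⁻¹ * ((y + ε) / 2) := by field_simp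
  have s2 : 1 / 4 / (y + ε / 2) ≤ (y + ε)⁻¹ * (1 / 2) := by
    rw [inv_mul_eq_div, le_div_iff₀ hpos]
    exact s1
  have e3 : 1 / 2 / (y + ε / 2) = 2 * (1 / 4 / (y + ε / 2)) := by ring
  rw [e3]
  nlinarith [mul_nonneg (sub_nonneg.2 s2) (sub_nonneg.2 hd)]

theorem closure_solidTube_subset (hy0 : 0 ≤ y) (hε : 0 ≤ ε) (hpos : 0 < y + ε)
    (hle : y + ε ≤ 1) {p : ℝ × ℝ × ℝ} (hp : p ∈ closure (solidTube y ε)) :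
    p ∈ solidTube y ε ∨ p.1 = 0 ∧ p.2.1 ∈ Icc (0 : ℝ) 1 ∧ p.2.2 = 0 := by
  have hbox : p ∈ {p : ℝ × ℝ × ℝ | p.1 ∈ Icc (0 : ℝ) 1 ∧ p.2.1 ∈ Icc (0 : ℝ) 1 ∧
      0 ≤ p.2.2 ∧ p.2.2 ≤ p.1} := by
    refine closure_minimal ?_ ?_ hp
    · intro q hq
      rw [mem_solidTube hy0 hε hpos] at hq
      obtain ⟨⟨h1, h2⟩, h3, h4, h5, h6⟩ := hq
      have := lowerEdge_nonneg hε hle h1 h2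
      have := lowerEdge_add_le hε hle h1 h2
      exact ⟨⟨h1.le, h2⟩, ⟨by linarith, by linarith⟩, h5,
        h6.trans (roof_nonneg_le hy0 hε hpos (p := (q.1, q.2.1)) h1.le h2).2⟩
    · exact (isClosed_Icc.preimage continuous_fst).inter
        ((isClosed_Icc.preimage (continuous_fst.comp continuous_snd)).inter
        ((isClosed_le (f := fun _ : ℝ × ℝ × ℝ => (0 : ℝ)) (g := fun q => q.2.2) (by fun_prop)
          (by fun_prop)).inter (isClosed_le (f := fun q : ℝ × ℝ × ℝ => q.2.2) (g := fun q => q.1)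
          (by fun_prop) (by fun_prop))))
  obtain ⟨⟨hx0, hx1⟩, hv, hz0, hz1⟩ := hbox
  rcases hx0.eq_or_lt with h | h
  · exact Or.inr ⟨h.symm, hv, le_antisymm (by rw [h]; exact hz1) hz0⟩
  · refine Or.inl ((mem_solidTube hy0 hε hpos p).2 ⟨⟨h, hx1⟩, ?_⟩)
    -- near `p` the tube is described by weak inequalities between continuous functions
    have hcl : p ∈ closure (solidTube y ε ∩ {q | p.1 / 2 ≤ q.1}) := by
      rw [mem_closure_iff_nhds] at hp ⊢
      intro U hU
      have hV : {q : ℝ × ℝ × ℝ | p.1 / 2 < q.1} ∈ 𝓝 p :=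
        (isOpen_lt continuous_const continuous_fst).mem_nhds (by
          simp only [mem_ofPred_eq]; linarith)
      obtain ⟨q, ⟨hq1, hq2⟩, hq3⟩ := hp _ (inter_mem hU hV)
      exact ⟨q, hq1, hq3, le_of_lt (α := ℝ) hq2⟩
    set D : Set (ℝ × ℝ × ℝ) := {q | q.1 ∈ Icc (p.1 / 2) 1} with hD
    have hDc : IsClosed D := isClosed_Icc.preimage continuous_fst
    have hl : ContinuousOn (fun q : ℝ × ℝ × ℝ => lowerEdge y ε q.1) D :=
      (continuousOn_interp _).comp continuous_fst.continuousOn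
        fun q hq => ⟨lt_of_lt_of_le (by linarith) hq.1, hq.2⟩
    have hr : ContinuousOn (fun q : ℝ × ℝ × ℝ => roof y ε (q.1, q.2.1)) D :=
      (continuousOn_roof hy0 hε hpos).comp (by fun_prop)
        fun q hq => ⟨le_trans (by linarith) hq.1, hq.2⟩
    have hcv : ContinuousOn (fun q : ℝ × ℝ × ℝ => q.2.1) D := by fun_prop
    have hC := ((hDc.isClosed_le hl hcv).inter
      (hDc.isClosed_le hcv
        (hl.add (by fun_prop : ContinuousOn (fun q : ℝ × ℝ × ℝ => y + ε * q.1) D)))).inter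
      ((hDc.isClosed_le (by fun_prop : ContinuousOn (fun _ : ℝ × ℝ × ℝ => (0 : ℝ)) D)
        (by fun_prop : ContinuousOn (fun q : ℝ × ℝ × ℝ => q.2.2) D)).inter
      (hDc.isClosed_le (by fun_prop : ContinuousOn (fun q : ℝ × ℝ × ℝ => q.2.2) D) hr))
    have := closure_minimal ?_ hC hcl
    · exact ⟨this.1.1.2, this.1.2.2, this.2.1.2, this.2.2.2⟩
    · rintro q ⟨hq, hq'⟩
      rw [mem_solidTube hy0 hε hpos] at hq
      obtain ⟨⟨h1, h2⟩, h3, h4, h5, h6⟩ := hq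
      have hqD : q ∈ D := ⟨hq', h2⟩
      exact ⟨⟨⟨hqD, h3⟩, ⟨hqD, h4⟩⟩, ⟨hqD, h5⟩, ⟨hqD, h6⟩⟩

theorem mem_interior_solidTube (hy0 : 0 ≤ y) (hε : 0 ≤ ε) (hpos : 0 < y + ε) {p : ℝ × ℝ × ℝ}
    (h0 : 0 < p.1) (h1 : p.1 < 1) (hz0 : 0 < p.2.2) (hz1 : p.2.2 < roof y ε (p.1, p.2.1)) :
    p ∈ interior (solidTube y ε) := by
  have hr : ContinuousAt (fun q : ℝ × ℝ × ℝ => roof y ε (q.1, q.2.1)) p := by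
    have h2 : ContinuousAt (roof y ε) (p.1, p.2.1) :=
      (continuousOn_roof hy0 hε hpos).continuousAt
        (continuous_fst.continuousAt.preimage_mem_nhds (Icc_mem_nhds h0 h1))
    exact h2.comp (f := fun q : ℝ × ℝ × ℝ => (q.1, q.2.1)) (by fun_prop)
  rw [mem_interior_iff_mem_nhds]
  have e1 : ∀ᶠ q : ℝ × ℝ × ℝ in 𝓝 p, q.1 ∈ Ioo (0 : ℝ) 1 :=
    continuous_fst.continuousAt.preimage_mem_nhds (Ioo_mem_nhds h0 h1)
  have e2 : ∀ᶠ q : ℝ × ℝ × ℝ in 𝓝 p, 0 < q.2.2 :=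
    (isOpen_lt continuous_const (by fun_prop)).mem_nhds hz0
  have e3 : ∀ᶠ q : ℝ × ℝ × ℝ in 𝓝 p, q.2.2 < roof y ε (q.1, q.2.1) :=
    ContinuousAt.eventually_lt (f := fun q : ℝ × ℝ × ℝ => q.2.2) (by fun_prop) hr hz1
  filter_upwards [e1, e2, e3] with q h1 h2 h3
  obtain ⟨h4, h5⟩ := (roof_pos_iff hy0 hε hpos (p := (q.1, q.2.1)) h1.1 h1.2.le).1 (h2.trans h3)
  exact (mem_solidTube hy0 hε hpos q).2 ⟨⟨h1.1, h1.2.le⟩, h4.le, h5.le, h2.le, h3.le⟩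

theorem mem_openTriangle_iff (hy0 : 0 ≤ y) (hε : 0 ≤ ε) (hpos : 0 < y + ε) (p : ℝ × ℝ × ℝ) :
    p ∈ openTriangle (ptA 1) (ptC y ε 1) (ptE y ε 1) ↔
      p.1 = 1 ∧ 0 < p.2.2 ∧ p.2.2 < roof y ε (p.1, p.2.1) := by
  have hA : ptA 1 = (1, 0, 0) := by norm_num [ptA]
  have hC : ptC y ε 1 = (1, y + ε, 0) := by norm_num [ptC]
  have hE : ptE y ε 1 = (1, 1 / 2 * (y + ε), 1 / 2) := by norm_num [ptE]
  rw [openTriangle, hA, hC, hE]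
  constructor
  · rintro ⟨a, b, c, ha, hb, hc, habc, rfl⟩
    simp only [Prod.smul_mk, Prod.mk_add_mk, smul_eq_mul, mul_one, mul_zero, zero_add, habc,
      true_and]
    refine ⟨by positivity, ?_⟩
    rw [(roof_one hy0 hε hpos _).2, one_div_mul_eq_div, lt_div_iff₀ hpos]
    refine lt_max_of_lt_right (lt_min ?_ ?_)
    · nlinarith [mul_pos hb hpos]
    · have : a = 1 - b - c := by linarith
      nlinarith [mul_pos ha hpos]
  · rintro ⟨h1, h2, h3⟩
    rw [h1, (roof_one hy0 hε hpos _).2, one_div_mul_eq_div, lt_div_iff₀ hpos, lt_max_iff,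
      lt_min_iff] at h3
    have h3' : p.2.2 * (y + ε) < p.2.1 ∧ p.2.2 * (y + ε) < y + ε - p.2.1 := by
      rcases h3 with h3 | h3
      · exact absurd h3 (not_lt.2 (by positivity))
      · exact h3
    refine ⟨1 - p.2.1 / (y + ε) - p.2.2, p.2.1 / (y + ε) - p.2.2, 2 * p.2.2, ?_, ?_, by positivity,
      by ring, ?_⟩
    · rw [sub_sub, sub_pos, ← lt_sub_iff_add_lt, div_lt_iff₀ hpos]
      linarith
    · rw [sub_pos, lt_div_iff₀ hpos]
      exact h3'.1
    · simp only [Prod.smul_mk, Prod.mk_add_mk, smul_eq_mul]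
      ext
      · dsimp only
        rw [h1]
        ring
      · dsimp only
        field_simp
        ring
      · dsimp only
        ring

/-- The space `S(y, ε)` is the square doubled along the complement of the base of the tube. -/
theorem plSpace_eq_doubleSquare (hy0 : 0 ≤ y) (hε : 0 ≤ ε) (hpos : 0 < y + ε)
    (hle : y + ε ≤ 1) : plSpace y ε = doubleSquare (roof y ε) := by
  ext p
  have hsq : ∀ {x v : ℝ}, 0 < x → x ≤ 1 → lowerEdge y ε x ≤ v →
      v ≤ lowerEdge y ε x + (y + ε * x) → (x, v) ∈ unitSquare := by
    intro x v h1 h2 h3 h4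
    have := lowerEdge_nonneg hε hle h1 h2
    have := lowerEdge_add_le hε hle h1 h2
    exact ⟨⟨h1.le, h2⟩, ⟨by dsimp only; linarith, by dsimp only; linarith⟩⟩
  constructor
  · rintro ⟨hp | hp, hT⟩
    · exact ⟨⟨hp.1, hp.2.1⟩, Or.inl hp.2.2⟩
    · rcases closure_solidTube_subset hy0 hε hpos hle hp.1 with h | ⟨h1, h2, h3⟩
      · have hs := (mem_solidTube hy0 hε hpos p).1 h
        obtain ⟨⟨h1, h2⟩, h3, h4, h5, h6⟩ := hs
        refine ⟨hsq h1 h2 h3 h4, ?_⟩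
        by_contra hcon
        push Not at hcon
        have hz0 := lt_of_le_of_ne h5 hcon.1.symm
        have hz1 := lt_of_le_of_ne h6 hcon.2
        rcases h2.eq_or_lt with h7 | h7
        · exact hT ((mem_openTriangle_iff hy0 hε hpos p).2 ⟨h7, hz0, hz1⟩)
        · exact hp.2 (mem_interior_solidTube hy0 hε hpos h1 h7 hz0 hz1)
      · exact ⟨⟨by rw [h1]; simp, h2⟩, Or.inl h3⟩
  · rintro ⟨hp, hz⟩
    have hnonneg := (roof_nonneg_le hy0 hε hpos (p := (p.1, p.2.1)) hp.1.1 hp.1.2).1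
    have hT : p ∉ openTriangle (ptA 1) (ptC y ε 1) (ptE y ε 1) := by
      rw [mem_openTriangle_iff hy0 hε hpos]
      rintro ⟨-, h1, h2⟩
      rcases hz with h | h
      · exact h1.ne' h
      · exact h2.ne h
    by_cases h0 : p.2.2 = 0
    · exact ⟨Or.inl ⟨hp.1, hp.2, h0⟩, hT⟩
    have hz' := hz.resolve_left h0
    refine ⟨Or.inr ?_, hT⟩
    have hrpos : 0 < roof y ε (p.1, p.2.1) :=
      lt_of_le_of_ne hnonneg (by rw [← hz']; exact Ne.symm h0)
    have hx0 : 0 < p.1 :=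
      hrpos.trans_le (roof_nonneg_le hy0 hε hpos (p := (p.1, p.2.1)) hp.1.1 hp.1.2).2
    obtain ⟨h3, h4⟩ := (roof_pos_iff hy0 hε hpos (p := (p.1, p.2.1)) hx0 hp.1.2).1 hrpos
    refine ⟨subset_closure ((mem_solidTube hy0 hε hpos p).2
      ⟨⟨hx0, hp.1.2⟩, h3.le, h4.le, by rw [hz']; exact hnonneg, hz'.le⟩), fun hint => ?_⟩
    -- points directly above the roof do not belong to the tube
    rw [mem_interior_iff_mem_nhds] at hint
    have hc : Tendsto (fun t : ℝ => (p.1, p.2.1, p.2.2 + t)) (𝓝[>] 0) (𝓝 p) := by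
      have : Continuous fun t : ℝ => (p.1, p.2.1, p.2.2 + t) := by fun_prop
      have h := this.tendsto 0
      rw [add_zero] at h
      exact h.mono_left nhdsWithin_le_nhds
    obtain ⟨t, ht, ht'⟩ := ((hc.eventually hint).and self_mem_nhdsWithin).exists
    have := ((mem_solidTube hy0 hε hpos _).1 ht).2.2.2.2
    dsimp only at this
    rw [← hz'] at this
    have : 0 < t := ht'
    linarith

end Boundary

/-! ### Strips with prescribed boundaries -/

/-- A continuous bijection from a compact space to a Hausdorff space is a homeomorphism. -/
theorem nonempty_homotopyEquiv_of_bijective {A B : Type*} [TopologicalSpace A] [TopologicalSpace B]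
    [CompactSpace A] [T2Space B] {f : A → B} (hf : Continuous f) (hb : Function.Bijective f) :
    Nonempty (A ≃ₕ B) :=
  ⟨(Continuous.homeoOfEquivCompactToT2 (f := Equiv.ofBijective f hb) hf).toHomotopyEquiv⟩

theorem continuousOn_mul_of_bounded {l : ℝ → ℝ} (hl : ContinuousOn l (Ioc 0 1)) {C : ℝ}
    (hC : ∀ x ∈ Ioc (0 : ℝ) 1, |l x| ≤ C) : ContinuousOn (fun x => x * l x) (Icc 0 1) := by
  rw [continuousOn_iff_continuous_domRestrict]
  refine continuous_of_abs_le (φ := fun x : Icc (0 : ℝ) 1 => (x : ℝ)) (by fun_prop)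
    (fun x => x.2.1) (C := C) ?_ ?_
  · intro x
    rw [domRestrict_apply, abs_mul, abs_of_nonneg x.2.1, mul_comm]
    rcases x.2.1.eq_or_lt with h | h
    · rw [← h]; simp
    · exact mul_le_mul_of_nonneg_right (hC _ ⟨h, x.2.2⟩) x.2.1
  · exact continuous_subtype_val.continuousOn.mul
      (hl.comp continuous_subtype_val.continuousOn fun x hx => ⟨hx, x.2.2⟩)

/-- A function on the square that is positive exactly over the strip between `l` and `r`. -/
noncomputable def stripRoof (l r : ℝ → ℝ) (p : ℝ × ℝ) : ℝ :=
  max 0 (min (p.1 * p.2 - p.1 * l p.1) (p.1 * r p.1 - p.1 * p.2))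

theorem isStripFunction_stripRoof {l r : ℝ → ℝ} (hl : ContinuousOn l (Ioc 0 1))
    (hr : ContinuousOn r (Ioc 0 1))
    (hb : ∀ x ∈ Ioc (0 : ℝ) 1, 0 ≤ l x ∧ l x < r x ∧ r x ≤ 1) :
    IsStripFunction (stripRoof l r) l r := by
  have cl := continuousOn_mul_of_bounded hl (C := 1) fun x hx => by
    obtain ⟨h1, h2, h3⟩ := hb x hx
    exact abs_le.2 ⟨by linarith, by linarith⟩
  have cr := continuousOn_mul_of_bounded hr (C := 1) fun x hx => by
    obtain ⟨h1, h2, h3⟩ := hb x hx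
    exact abs_le.2 ⟨by linarith, by linarith⟩
  constructor
  · have cl' : ContinuousOn (fun p : ℝ × ℝ => p.1 * l p.1) unitSquare :=
      cl.comp continuous_fst.continuousOn fun p hp => hp.1
    have cr' : ContinuousOn (fun p : ℝ × ℝ => p.1 * r p.1) unitSquare :=
      cr.comp continuous_fst.continuousOn fun p hp => hp.1
    have cm : ContinuousOn (fun p : ℝ × ℝ => p.1 * p.2) unitSquare := by fun_prop
    have hm : Continuous fun q : ℝ × ℝ => max 0 (min q.1 q.2) := by fun_prop
    exact hm.comp_continuousOn ((cm.sub cl').prodMk (cr'.sub cm))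
  · intro p
    rw [stripRoof, max_eq_left_iff, min_le_iff, sub_nonpos, sub_nonpos]
    rcases p.2.1.1.eq_or_lt with h | h
    · simp [← h]
    · rw [mul_le_mul_iff_right₀ h, mul_le_mul_iff_right₀ h, or_iff_right h.ne']

theorem abs_mul_wave_sub_le {ε x : ℝ} (hε : 0 ≤ ε) (h0 : 0 < x) (h1 : x ≤ 1) (c : ℝ) :
    |c * wave x - (c - ε * x) * wave x| ≤ ε * x := by
  have := wave_nonneg h0 h1
  have := wave_le_one h0 h1
  have e : c * wave x - (c - ε * x) * wave x = ε * x * wave x := by ring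
  rw [e, abs_of_nonneg (by positivity)]
  exact mul_le_of_le_one_right (by positivity) ‹_›

theorem continuousOn_wave : ContinuousOn wave (Ioc 0 1) := continuousOn_interp _

theorem continuousOn_lowerEdge {y ε : ℝ} : ContinuousOn (lowerEdge y ε) (Ioc 0 1) :=
  continuousOn_interp _

theorem lowerEdge_bounds {y ε : ℝ} (hy0 : 0 ≤ y) (hε : 0 ≤ ε) (hpos : 0 < y + ε)
    (hle : y + ε ≤ 1) : ∀ x ∈ Ioc (0 : ℝ) 1, 0 ≤ lowerEdge y ε x ∧
      lowerEdge y ε x < lowerEdge y ε x + (y + ε * x) ∧ lowerEdge y ε x + (y + ε * x) ≤ 1 :=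
  fun x hx => ⟨lowerEdge_nonneg hε hle hx.1 hx.2, by linarith [width_pos hy0 hε hpos hx.1],
    lowerEdge_add_le hε hle hx.1 hx.2⟩

/-- The lower boundary of a strip of width `ε x` around the triangle wave. -/
noncomputable def thinLower (ε x : ℝ) : ℝ := (1 - ε * x) * wave x

theorem thin_bounds {ε : ℝ} (hε : 0 < ε) (hle : ε ≤ 1) : ∀ x ∈ Ioc (0 : ℝ) 1,
    0 ≤ thinLower ε x ∧ thinLower ε x < thinLower ε x + ε * x ∧ thinLower ε x + ε * x ≤ 1 := by
  intro x hx
  have h1 := wave_nonneg hx.1 hx.2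
  have h2 := wave_le_one hx.1 hx.2
  have h3 : ε * x ≤ 1 := by nlinarith [hx.1, hx.2]
  have h4 : 0 < ε * x := mul_pos hε hx.1
  exact ⟨mul_nonneg (by linarith) h1, by linarith, by rw [thinLower]; nlinarith⟩

theorem continuousOn_thinLower {ε : ℝ} : ContinuousOn (thinLower ε) (Ioc 0 1) :=
  ContinuousOn.mul (by fun_prop) continuousOn_wave

theorem isStripFunction_thin {ε : ℝ} (hε : 0 < ε) (hle : ε ≤ 1) :
    IsStripFunction (stripRoof (thinLower ε) fun x => thinLower ε x + ε * x) (thinLower ε)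
      (fun x => thinLower ε x + ε * x) :=
  isStripFunction_stripRoof continuousOn_thinLower
    (continuousOn_thinLower.add (by fun_prop)) (thin_bounds hε hle)

theorem nonempty_homotopyEquiv_thin {ε : ℝ} (hε : 0 < ε) (hle : ε ≤ 1) :
    Nonempty (doubleSquare (roof 0 ε) ≃ₕ
      doubleSquare (stripRoof (thinLower ε) fun x => thinLower ε x + ε * x)) := by
  have hw : ∀ x ∈ Ioc (0 : ℝ) 1, ε * x ≠ 0 := fun x hx => (mul_pos hε hx.1).ne'
  refine nonempty_homotopyEquiv_of_strips (C := ε + ε)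
    (isStripFunction_roof le_rfl hε.le (by linarith)) (isStripFunction_thin hε hle)
    continuousOn_lowerEdge (continuousOn_lowerEdge.add (by fun_prop)) continuousOn_thinLower
    (continuousOn_thinLower.add (by fun_prop))
    (lowerEdge_bounds le_rfl hε.le (by linarith) (by linarith)) (thin_bounds hε hle) ?_ ?_ ?_
  · intro x hx
    have h1 := abs_lowerEdge_sub_le (y := 0) hε.le hx.1 hx.2
    have h2 := abs_mul_wave_sub_le hε.le hx.1 hx.2 (1 - 0)
    rw [add_mul]
    refine (abs_sub_le _ _ _).trans (add_le_add h1 ?_)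
    rwa [sub_zero] at h2 ⊢
  · intro x hx
    rw [add_sub_cancel_left, add_sub_cancel_left, zero_add, div_self (hw x hx), sub_self, abs_zero]
    have := hx.1
    positivity
  · intro x hx
    rw [add_sub_cancel_left, add_sub_cancel_left, zero_add, div_self (hw x hx), sub_self, abs_zero]
    have := hx.1
    positivity

/-- In a convex target, the starting points of the arcs may be changed freely away from `L`. -/
theorem ArcSpace.nonempty_homotopyEquiv_square {W : Type} [TopologicalSpace W] {L : Set W}
    {f f' : W → unitSquare} (hf : Continuous f) (hf' : Continuous f') (f₁ : W → unitSquare)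
    (h : ∀ w ∈ L, f' w = f w) : Nonempty (ArcSpace f f₁ L ≃ₕ ArcSpace f' f₁ L) := by
  refine ArcSpace.nonempty_homotopyEquiv_start (fun w s => sqPt
    ((1 - s) * (f w : ℝ × ℝ).1 + s * (f' w : ℝ × ℝ).1,
      (1 - s) * (f w : ℝ × ℝ).2 + s * (f' w : ℝ × ℝ).2)) ?_ f₁ ?_ ?_ ?_
  · exact continuous_sqPt.comp (by fun_prop)
  · intro w
    simp
  · intro w
    simp
  · intro w hw s
    rw [h w hw, ← add_mul, ← add_mul, sub_add_cancel, one_mul, one_mul, Prod.mk.eta, sqPt_coe]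

/-! ### The thin strip and the space `SC(S¹)` -/

/-- The topologist's sine curve that is the closure of the graph of the triangle wave. -/
def waveCurve : Set (ℝ × ℝ) := {p | p ∈ unitSquare ∧ (p.1 = 0 ∨ p.2 = wave p.1)}

theorem isCompact_unitSquare : IsCompact unitSquare := isCompact_Icc.prod isCompact_Icc

theorem isCompact_waveCurve : IsCompact waveCurve := by
  -- multiplied by the first coordinate, the equation of the curve is continuous on the square
  have c := continuousOn_mul_of_bounded continuousOn_wave (C := 1) fun x hx =>
    abs_le.2 ⟨by linarith [wave_nonneg hx.1 hx.2], wave_le_one hx.1 hx.2⟩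
  have c1 : ContinuousOn (fun p : ℝ × ℝ => p.1 * wave p.1) unitSquare :=
    c.comp continuous_fst.continuousOn fun p hp => hp.1
  have c2 : ContinuousOn (fun p : ℝ × ℝ => p.1 * p.2) unitSquare := by fun_prop
  have h := (isCompact_unitSquare.isClosed.isClosed_le c1 c2).inter
    (isCompact_unitSquare.isClosed.isClosed_le c2 c1)
  refine isCompact_unitSquare.of_isClosed_subset ?_ fun p hp => hp.1
  convert h using 1
  ext p
  refine Iff.symm ⟨?_, ?_⟩
  · rintro ⟨⟨hp, h1⟩, -, h2⟩
    have h3 : p.1 * wave p.1 = p.1 * p.2 := le_antisymm h1 h2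
    exact ⟨hp, or_iff_not_imp_left.2 fun hx => (mul_left_cancel₀ hx h3).symm⟩
  · rintro ⟨hp, h1⟩
    have h3 : p.1 * wave p.1 = p.1 * p.2 := by
      rcases h1 with h1 | h1 <;> rw [h1]
      simp
    exact ⟨⟨hp, h3.le⟩, hp, h3.ge⟩

instance : CompactSpace waveCurve := isCompact_iff_compactSpace.1 isCompact_waveCurve

instance : CompactSpace unitSquare := isCompact_iff_compactSpace.1 isCompact_unitSquare

/-- The points of `waveCurve` on the limit segment. -/
def limitSegment : Set waveCurve := {w | (w : ℝ × ℝ).1 = 0}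

/-- The end points and the interior points of the vertical segments of the thin strip: the point
over `w` at the ratio `θ` from the lower boundary. -/
noncomputable def thinPoint (ε : ℝ) (w : waveCurve) (θ : ℝ) : unitSquare :=
  sqPt ((w : ℝ × ℝ).1, (1 - ε * (w : ℝ × ℝ).1) * (w : ℝ × ℝ).2 + θ * (ε * (w : ℝ × ℝ).1))

theorem continuous_thinPoint (ε : ℝ) :
    Continuous fun p : waveCurve × ℝ => thinPoint ε p.1 p.2 :=
  continuous_sqPt.comp (by fun_prop)

theorem thinPoint_val {ε : ℝ} (hε : 0 < ε) (hle : ε ≤ 1) (w : waveCurve) {θ : ℝ} (h0 : 0 ≤ θ)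
    (h1 : θ ≤ 1) : (thinPoint ε w θ : ℝ × ℝ) = ((w : ℝ × ℝ).1,
      (1 - ε * (w : ℝ × ℝ).1) * (w : ℝ × ℝ).2 + θ * (ε * (w : ℝ × ℝ).1)) := by
  have a1 := w.2.1.1.1
  have a2 := w.2.1.1.2
  have a3 := w.2.1.2.1
  have a4 := w.2.1.2.2
  have a5 : 0 ≤ ε * (w : ℝ × ℝ).1 := by positivity
  have a6 : ε * (w : ℝ × ℝ).1 ≤ 1 := by nlinarith
  refine sqPt_val a1 a2 ?_ ?_
  · dsimp only
    have : 0 ≤ (1 - ε * (w : ℝ × ℝ).1) * (w : ℝ × ℝ).2 := mul_nonneg (by linarith) a3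
    positivity
  · dsimp only
    nlinarith

theorem thinPoint_of_mem {ε : ℝ} {w : waveCurve} (hw : w ∈ limitSegment) (θ : ℝ) :
    (thinPoint ε w θ : ℝ × ℝ) = w := by
  have h : (w : ℝ × ℝ).1 = 0 := hw
  rw [thinPoint, h, sqPt_val le_rfl zero_le_one]
  · ext
    · exact h.symm
    · simp
  · simpa using w.2.1.2.1
  · simpa using w.2.1.2.2

open doubleSquare in
/-- The upper sheet over a thin strip consists of vertical arcs, and elsewhere it is identified with
the flat sheet. -/
theorem nonempty_homotopyEquiv_thin_arcSpace {ε : ℝ} (hε : 0 < ε) (hle : ε ≤ 1) :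
    Nonempty (ArcSpace (fun w => thinPoint ε w 0) (fun w => thinPoint ε w 1) limitSegment ≃ₕ
      doubleSquare (stripRoof (thinLower ε) fun x => thinLower ε x + ε * x)) := by
  set G := stripRoof (thinLower ε) fun x => thinLower ε x + ε * x with hGdef
  have hG : IsStripFunction G _ _ := isStripFunction_thin hε hle
  have hzero : ∀ (w : waveCurve) (θ : unitInterval), w ∈ limitSegment ∨ (θ : ℝ) = 0 ∨
      (θ : ℝ) = 1 → G (thinPoint ε w θ) = 0 := by
    intro w θ h
    rw [hG.2, thinPoint_val hε hle w θ.2.1 θ.2.2]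
    rcases h with h | h | h
    · exact Or.inl h
    · rcases w.2.2 with h' | h'
      · exact Or.inl h'
      · refine Or.inr (Or.inl ?_)
        simp only [h, h', thinLower]
        simp
    · rcases w.2.2 with h' | h'
      · exact Or.inl h'
      · refine Or.inr (Or.inr ?_)
        simp only [h, h', thinLower]
        simp
  have hpos : ∀ (w : waveCurve) (θ : unitInterval), w ∉ limitSegment → 0 < (θ : ℝ) →
      (θ : ℝ) < 1 → G (thinPoint ε w θ) ≠ 0 := by
    intro w θ hw h0 h1 h
    rw [hG.2, thinPoint_val hε hle w h0.le h1.le] at h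
    have hx : 0 < (w : ℝ × ℝ).1 := lt_of_le_of_ne w.2.1.1.1 (Ne.symm hw)
    have hεx : 0 < ε * (w : ℝ × ℝ).1 := mul_pos hε hx
    have hv := w.2.2.resolve_left hw
    dsimp only at h
    rw [hv, thinLower, or_iff_right hx.ne'] at h
    rcases h with h | h
    · have := mul_pos h0 hεx
      linarith
    · have := mul_lt_mul_of_pos_right h1 hεx
      linarith
  have hpt : ∀ w ∈ limitSegment, ∀ θ, thinPoint ε w θ = thinPoint ε w 0 := fun w hw θ =>
    Subtype.ext ((thinPoint_of_mem hw θ).trans (thinPoint_of_mem hw 0).symm)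
  refine nonempty_homotopyEquiv_of_bijective (f := ArcSpace.desc (fun w => thinPoint ε w 0)
    (fun w => thinPoint ε w 1) limitSegment (flat G)
    (fun w θ => doubleSquare.top G (thinPoint ε w θ)) ?_ ?_ ?_) ?_ ⟨?_, ?_⟩
  · exact fun w => (flat_eq_top (hzero w 0 (by simp))).symm
  · exact fun w => (flat_eq_top (hzero w 1 (by simp))).symm
  · intro w hw θ
    rw [← flat_eq_top (hzero w θ (Or.inl hw)), hpt w hw]
  · refine ArcSpace.continuous_desc continuous_flat ((continuous_top hG.1).comp ?_)
    exact (continuous_thinPoint ε).comp (by fun_prop :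
      Continuous fun p : waveCurve × unitInterval => (p.1, (p.2 : ℝ)))
  · refine ArcSpace.desc_injective ?_ ?_ ?_
    · intro p p' h
      have h1 := congrArg (fun q : doubleSquare G => (q : ℝ × ℝ × ℝ)) h
      simp only [flat, Prod.mk.injEq, and_true] at h1
      exact Subtype.ext (Prod.ext h1.1 h1.2)
    · intro w hw w' hw' θ θ' h0 h1 h0' h1' h
      have h2 : (proj (doubleSquare.top G (thinPoint ε w θ)) : ℝ × ℝ) =
          proj (doubleSquare.top G (thinPoint ε w' θ')) := by rw [h]
      change (thinPoint ε w θ : ℝ × ℝ) = thinPoint ε w' θ' at h2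
      rw [thinPoint_val hε hle w h0.le h1.le, thinPoint_val hε hle w' h0'.le h1'.le,
        Prod.mk.injEq] at h2
      have hv := w.2.2.resolve_left hw
      have hv' := w'.2.2.resolve_left hw'
      have hww : w = w' := Subtype.ext (Prod.ext h2.1 (by rw [hv, hv', h2.1]))
      subst hww
      refine ⟨rfl, Subtype.ext ?_⟩
      have hx : 0 < (w : ℝ × ℝ).1 := lt_of_le_of_ne w.2.1.1.1 (Ne.symm hw)
      exact mul_right_cancel₀ (mul_pos hε hx).ne' (add_left_cancel h2.2)
    · intro p w hw θ h0 h1 h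
      have h2 := congrArg (fun q : doubleSquare G => (q : ℝ × ℝ × ℝ).2.2) h
      exact hpos w θ hw h0 h1 h2.symm
  · intro q
    rcases exists_rep q with ⟨p, rfl⟩ | ⟨p, rfl⟩
    · exact ⟨ArcSpace.pt _ _ _ p, rfl⟩
    by_cases hp : G p = 0
    · exact ⟨ArcSpace.pt _ _ _ p, flat_eq_top hp⟩
    rw [hG.2] at hp
    push Not at hp
    obtain ⟨h0, h1, h2⟩ := hp
    have hx : (p : ℝ × ℝ).1 ∈ Ioc (0 : ℝ) 1 := ⟨lt_of_le_of_ne p.2.1.1 (Ne.symm h0), p.2.1.2⟩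
    have hεx : 0 < ε * (p : ℝ × ℝ).1 := mul_pos hε hx.1
    let w : waveCurve := ⟨((p : ℝ × ℝ).1, wave (p : ℝ × ℝ).1),
      ⟨p.2.1, wave_nonneg hx.1 hx.2, wave_le_one hx.1 hx.2⟩, Or.inr rfl⟩
    let θ : unitInterval := ⟨((p : ℝ × ℝ).2 - thinLower ε (p : ℝ × ℝ).1) / (ε * (p : ℝ × ℝ).1),
      div_nonneg (by linarith) hεx.le, by rw [div_le_one hεx]; linarith⟩
    refine ⟨ArcSpace.arc _ _ _ w θ, ?_⟩
    rw [ArcSpace.desc_arc]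
    congr 1
    apply Subtype.ext
    rw [thinPoint_val hε hle w θ.2.1 θ.2.2]
    ext
    · rfl
    · simp only [w, θ]
      rw [div_mul_cancel₀ _ hεx.ne', thinLower]
      ring

/-! ### Reparametrizing the sine curve -/

/-- The first coordinate of the piecewise linear sine curve as a function of the first coordinate
of `waveCurve`: it is `2⁻ⁿ` at `1 / (2n + 1)` and at `1 / (2n + 2)`. -/
noncomputable def dyadicScale (u : ℝ) : ℝ :=
  if u = 0 then 0 else interp (fun k => (1 / 2 : ℝ) ^ ((k - 1) / 2)) u

theorem interp_dyadic_le {u : ℝ} (h0 : 0 < u) (h1 : u ≤ 1) :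
    interp (fun k => (1 / 2 : ℝ) ^ ((k - 1) / 2)) u ≤ 2 * u := by
  rw [← interp_inv h0 h1, ← interp_const_mul, interp_inv h0 h1]
  refine interp_mono (fun k hk => ?_) h0 h1
  have hk' : (0 : ℝ) < k := by exact_mod_cast hk
  have h2 : (k : ℝ) ≤ 2 * 2 ^ ((k - 1) / 2) := by
    have : k ≤ 2 * 2 ^ ((k - 1) / 2) := by
      have := Nat.lt_two_pow_self (n := (k - 1) / 2)
      omega
    exact_mod_cast this
  rw [one_div_pow, mul_one_div, div_le_div_iff₀ (by positivity) hk', one_mul]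
  exact h2

theorem interp_dyadic_nonneg {u : ℝ} (h0 : 0 < u) (h1 : u ≤ 1) :
    0 ≤ interp (fun k => (1 / 2 : ℝ) ^ ((k - 1) / 2)) u := by
  rw [← interp_const 0 u]
  exact interp_mono (fun k _ => by positivity) h0 h1

theorem continuousOn_dyadicScale : ContinuousOn dyadicScale (Icc 0 1) := by
  rw [continuousOn_iff_continuous_domRestrict]
  refine continuous_of_abs_le (φ := fun x : Icc (0 : ℝ) 1 => (x : ℝ)) (by fun_prop)
    (fun x => x.2.1) (C := 2) ?_ ?_
  · intro x
    rw [domRestrict_apply, dyadicScale]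
    split_ifs with h
    · simp [h]
    · have hx := lt_of_le_of_ne x.2.1 (Ne.symm h)
      rw [abs_of_nonneg (interp_dyadic_nonneg hx x.2.2)]
      exact interp_dyadic_le hx x.2.2
  · refine ((continuousOn_interp fun k => (1 / 2 : ℝ) ^ ((k - 1) / 2)).comp
      continuous_subtype_val.continuousOn fun x hx => ⟨hx, x.2.2⟩).congr fun x hx => ?_
    rw [domRestrict_apply, dyadicScale, if_neg (ne_of_gt hx)]
    rfl

/-- The points of `(0, 1]` whose triangle wave runs upwards, towards `1 / (2n + 2)`. -/
noncomputable def upPoint (n : ℕ) (c : ℝ) : ℝ := 1 / (2 * n + 1) - c / ((2 * n + 1) * (2 * n + 2))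

/-- The points of `(0, 1]` whose triangle wave runs downwards, towards `1 / (2n + 3)`. -/
noncomputable def downPoint (n : ℕ) (c : ℝ) : ℝ := 1 / (2 * n + 2) - c / ((2 * n + 2) * (2 * n + 3))

theorem upPoint_slab (n : ℕ) {c : ℝ} (h0 : 0 ≤ c) (h1 : c ≤ 1) :
    1 / (((2 * n + 1 : ℕ) : ℝ) + 1) ≤ upPoint n c ∧ upPoint n c ≤ 1 / ((2 * n + 1 : ℕ) : ℝ) := by
  push_cast
  have e : 1 / ((2 * n + 1 : ℝ) + 1) = 1 / (2 * n + 1) - 1 / ((2 * n + 1) * (2 * n + 2)) := by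
    field_simp
    ring
  rw [e, upPoint]
  constructor
  · gcongr
  · have : 0 ≤ c / ((2 * (n : ℝ) + 1) * (2 * n + 2)) := by positivity
    linarith

theorem downPoint_slab (n : ℕ) {c : ℝ} (h0 : 0 ≤ c) (h1 : c ≤ 1) :
    1 / (((2 * n + 2 : ℕ) : ℝ) + 1) ≤ downPoint n c ∧
      downPoint n c ≤ 1 / ((2 * n + 2 : ℕ) : ℝ) := by
  push_cast
  have e : 1 / ((2 * n + 2 : ℝ) + 1) = 1 / (2 * n + 2) - 1 / ((2 * n + 2) * (2 * n + 3)) := by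
    field_simp
    ring
  rw [e, downPoint]
  constructor
  · gcongr
  · have : 0 ≤ c / ((2 * (n : ℝ) + 2) * (2 * n + 3)) := by positivity
    linarith

theorem interp_upPoint (a : ℕ → ℝ) (n : ℕ) {c : ℝ} (h0 : 0 ≤ c) (h1 : c ≤ 1) :
    interp a (upPoint n c) = a (2 * n + 1) + c * (a (2 * n + 2) - a (2 * n + 1)) := by
  obtain ⟨h2, h3⟩ := upPoint_slab n h0 h1
  rw [interp_eq a (by omega) h2 h3]
  congr 2
  rw [upPoint]
  push_cast
  field_simp
  ring

theorem interp_downPoint (a : ℕ → ℝ) (n : ℕ) {c : ℝ} (h0 : 0 ≤ c) (h1 : c ≤ 1) :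
    interp a (downPoint n c) = a (2 * n + 2) + c * (a (2 * n + 3) - a (2 * n + 2)) := by
  obtain ⟨h2, h3⟩ := downPoint_slab n h0 h1
  rw [interp_eq a (by omega) h2 h3]
  congr 2
  rw [downPoint]
  push_cast
  field_simp
  ring

theorem upPoint_mem (n : ℕ) {c : ℝ} (h0 : 0 ≤ c) (h1 : c ≤ 1) : upPoint n c ∈ Ioc (0 : ℝ) 1 := by
  obtain ⟨h2, h3⟩ := upPoint_slab n h0 h1
  refine ⟨lt_of_lt_of_le (by positivity) h2, h3.trans ?_⟩
  rw [div_le_one (by positivity)]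
  exact_mod_cast (by omega : 1 ≤ 2 * n + 1)

theorem downPoint_mem (n : ℕ) {c : ℝ} (h0 : 0 ≤ c) (h1 : c ≤ 1) :
    downPoint n c ∈ Ioc (0 : ℝ) 1 := by
  obtain ⟨h2, h3⟩ := downPoint_slab n h0 h1
  refine ⟨lt_of_lt_of_le (by positivity) h2, h3.trans ?_⟩
  rw [div_le_one (by positivity)]
  exact_mod_cast (by omega : 1 ≤ 2 * n + 2)

theorem wave_upPoint (n : ℕ) {c : ℝ} (h0 : 0 ≤ c) (h1 : c ≤ 1) : wave (upPoint n c) = c := by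
  rw [wave, interp_upPoint _ n h0 h1, if_neg (by simp), if_pos (by simp [parity_simps])]
  ring

theorem wave_downPoint (n : ℕ) {c : ℝ} (h0 : 0 ≤ c) (h1 : c ≤ 1) :
    wave (downPoint n c) = 1 - c := by
  rw [wave, interp_downPoint _ n h0 h1, if_pos (by simp [parity_simps]),
    if_neg (by rw [Nat.not_even_iff_odd]; exact ⟨n + 1, by ring⟩)]
  ring

theorem dyadicScale_upPoint (n : ℕ) {c : ℝ} (h0 : 0 ≤ c) (h1 : c ≤ 1) :
    dyadicScale (upPoint n c) = (1 / 2) ^ n := by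
  rw [dyadicScale, if_neg (upPoint_mem n h0 h1).1.ne', interp_upPoint _ n h0 h1,
    show (2 * n + 1 - 1) / 2 = n by omega, show (2 * n + 2 - 1) / 2 = n by omega]
  ring

theorem dyadicScale_downPoint (n : ℕ) {c : ℝ} (h0 : 0 ≤ c) (h1 : c ≤ 1) :
    dyadicScale (downPoint n c) = (1 / 2) ^ n * (1 - c / 2) := by
  rw [dyadicScale, if_neg (downPoint_mem n h0 h1).1.ne', interp_downPoint _ n h0 h1,
    show (2 * n + 3 - 1) / 2 = n + 1 by omega, show (2 * n + 2 - 1) / 2 = n by omega]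
  ring

/-- Every point of `(0, 1]` lies on an upward piece or in the interior of a downward piece. -/
theorem exists_upPoint_or_downPoint {u : ℝ} (hu : u ∈ Ioc (0 : ℝ) 1) :
    (∃ n c, 0 ≤ c ∧ c ≤ 1 ∧ u = upPoint n c) ∨ ∃ n c, 0 < c ∧ c < 1 ∧ u = downPoint n c := by
  obtain ⟨k, hk, h1, h2⟩ := exists_slab hu.1 hu.2
  obtain ⟨h3, h4⟩ := slab_coord_mem hk h1 h2
  rcases Nat.even_or_odd' (k - 1) with ⟨n, hn | hn⟩
  · obtain rfl : k = 2 * n + 1 := by omega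
    refine Or.inl ⟨n, _, h3, h4, ?_⟩
    rw [upPoint]
    push_cast
    field_simp
    ring
  · obtain rfl : k = 2 * n + 2 := by omega
    have hd : u = downPoint n (((2 * n + 2 : ℕ) + 1) * (1 - (2 * n + 2 : ℕ) * u)) := by
      rw [downPoint]
      push_cast
      field_simp
      ring
    rcases h3.eq_or_lt with h | h
    · refine Or.inl ⟨n, 1, zero_le_one, le_rfl, ?_⟩
      rw [hd, ← h, upPoint, downPoint]
      field_simp
      ring
    rcases h4.eq_or_lt with h' | h'
    · refine Or.inl ⟨n + 1, 0, le_rfl, zero_le_one, ?_⟩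
      rw [hd, h', upPoint, downPoint]
      push_cast
      field_simp
      ring
    · exact Or.inr ⟨n, _, h, h', hd⟩

/-- The reparametrization of `waveCurve` as the curve `sineCurve`. -/
noncomputable def toSineCurve (w : waveCurve) : unitSquare :=
  sqPt (dyadicScale (w : ℝ × ℝ).1, (w : ℝ × ℝ).2)

theorem dyadicScale_mem {u : ℝ} (hu : u ∈ Icc (0 : ℝ) 1) : dyadicScale u ∈ Icc (0 : ℝ) 1 := by
  rcases hu.1.eq_or_lt with h | h
  · simp [dyadicScale, ← h]
  have hp : ∀ n, (0 : ℝ) ≤ (1 / 2) ^ n ∧ (1 / 2 : ℝ) ^ n ≤ 1 := fun n =>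
    ⟨by positivity, pow_le_one₀ (by norm_num) (by norm_num)⟩
  rcases exists_upPoint_or_downPoint ⟨h, hu.2⟩ with ⟨n, c, h0, h1, rfl⟩ | ⟨n, c, h0, h1, rfl⟩
  · rw [dyadicScale_upPoint n h0 h1]
    exact hp n
  · rw [dyadicScale_downPoint n h0.le h1.le]
    have := hp n
    exact ⟨mul_nonneg this.1 (by linarith), mul_le_one₀ this.2 (by linarith) (by linarith)⟩

theorem toSineCurve_val (w : waveCurve) :
    (toSineCurve w : ℝ × ℝ) = (dyadicScale (w : ℝ × ℝ).1, (w : ℝ × ℝ).2) :=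
  sqPt_val (dyadicScale_mem w.2.1.1).1 (dyadicScale_mem w.2.1.1).2 w.2.1.2.1 w.2.1.2.2

theorem continuous_toSineCurve : Continuous toSineCurve := by
  have : Continuous fun w : waveCurve => dyadicScale (w : ℝ × ℝ).1 :=
    continuousOn_dyadicScale.comp_continuous (by fun_prop) fun w => w.2.1.1
  exact continuous_sqPt.comp (this.prodMk (by fun_prop))

theorem toSineCurve_of_mem {w : waveCurve} (hw : w ∈ limitSegment) :
    (toSineCurve w : ℝ × ℝ) = w := by
  have h : (w : ℝ × ℝ).1 = 0 := hw
  rw [toSineCurve_val, h]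
  ext
  · simp [dyadicScale, h]
  · rfl

theorem dyadicScale_eq_zero {u : ℝ} (hu : u ∈ Icc (0 : ℝ) 1) (h : dyadicScale u = 0) : u = 0 := by
  by_contra hne
  rcases exists_upPoint_or_downPoint ⟨lt_of_le_of_ne hu.1 (Ne.symm hne), hu.2⟩ with
    ⟨n, c, h0, h1, rfl⟩ | ⟨n, c, h0, h1, rfl⟩
  · rw [dyadicScale_upPoint n h0 h1] at h
    exact absurd h (by positivity)
  · rw [dyadicScale_downPoint n h0.le h1.le] at h
    have : (0 : ℝ) < (1 / 2) ^ n * (1 - c / 2) := mul_pos (by positivity) (by linarith)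
    exact this.ne' h

theorem half_pow_lt_iff {m n : ℕ} : (1 / 2 : ℝ) ^ m < (1 / 2) ^ n ↔ n < m :=
  pow_lt_pow_iff_right_of_lt_one₀ (by norm_num) (by norm_num)

theorem downPoint_scale_bounds (n : ℕ) {c : ℝ} (h0 : 0 < c) (h1 : c < 1) :
    (1 / 2) ^ (n + 1) < (1 / 2) ^ n * (1 - c / 2) ∧
      (1 / 2) ^ n * (1 - c / 2) < (1 / 2 : ℝ) ^ n := by
  have : (0 : ℝ) < (1 / 2) ^ n := by positivity
  rw [pow_succ]
  constructor <;> nlinarith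

theorem toSineCurve_ne_of_up_down {m n : ℕ} {c : ℝ} (h0 : 0 < c) (h1 : c < 1) :
    (1 / 2 : ℝ) ^ m ≠ (1 / 2) ^ n * (1 - c / 2) := by
  intro h
  obtain ⟨h2, h3⟩ := downPoint_scale_bounds n h0 h1
  rw [← h, half_pow_lt_iff] at h2 h3
  omega

theorem toSineCurve_injOn {w w' : waveCurve} (hw : w ∉ limitSegment) (hw' : w' ∉ limitSegment)
    (h : toSineCurve w = toSineCurve w') : w = w' := by
  have h' := congrArg (Subtype.val : unitSquare → ℝ × ℝ) h
  rw [toSineCurve_val, toSineCurve_val, Prod.mk.injEq] at h'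
  obtain ⟨h1, h2⟩ := h'
  refine Subtype.ext (Prod.ext ?_ h2)
  have hv := w.2.2.resolve_left hw
  have hv' := w'.2.2.resolve_left hw'
  have hu : (w : ℝ × ℝ).1 ∈ Ioc (0 : ℝ) 1 := ⟨lt_of_le_of_ne w.2.1.1.1 (Ne.symm hw), w.2.1.1.2⟩
  have hu' : (w' : ℝ × ℝ).1 ∈ Ioc (0 : ℝ) 1 :=
    ⟨lt_of_le_of_ne w'.2.1.1.1 (Ne.symm hw'), w'.2.1.1.2⟩
  rw [hv, hv'] at h2
  rcases exists_upPoint_or_downPoint hu with ⟨n, c, c0, c1, e⟩ | ⟨n, c, c0, c1, e⟩ <;>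
  rcases exists_upPoint_or_downPoint hu' with ⟨n', c', c0', c1', e'⟩ | ⟨n', c', c0', c1', e'⟩ <;>
  rw [e, e'] at h1 h2 ⊢
  · rw [dyadicScale_upPoint n c0 c1, dyadicScale_upPoint n' c0' c1'] at h1
    rw [wave_upPoint n c0 c1, wave_upPoint n' c0' c1'] at h2
    have : n = n' := pow_right_injective₀ (by norm_num : (0 : ℝ) < 1 / 2) (by norm_num) h1
    rw [this, h2]
  · rw [dyadicScale_upPoint n c0 c1, dyadicScale_downPoint n' c0'.le c1'.le] at h1
    exact absurd h1 (toSineCurve_ne_of_up_down c0' c1')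
  · rw [dyadicScale_downPoint n c0.le c1.le, dyadicScale_upPoint n' c0' c1'] at h1
    exact absurd h1.symm (toSineCurve_ne_of_up_down c0 c1)
  · rw [dyadicScale_downPoint n c0.le c1.le, dyadicScale_downPoint n' c0'.le c1'.le] at h1
    rw [wave_downPoint n c0.le c1.le, wave_downPoint n' c0'.le c1'.le] at h2
    obtain ⟨h3, h4⟩ := downPoint_scale_bounds n c0 c1
    obtain ⟨h5, h6⟩ := downPoint_scale_bounds n' c0' c1'
    rw [h1] at h3 h4
    have h7 := half_pow_lt_iff.1 (h3.trans h6)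
    have h8 := half_pow_lt_iff.1 (h5.trans h4)
    obtain rfl : n = n' := by omega
    rw [sub_right_inj.1 h2]

theorem toSineCurve_mem (w : waveCurve) : (toSineCurve w : ℝ × ℝ) ∈ sineCurve := by
  by_cases hw : w ∈ limitSegment
  · rw [toSineCurve_of_mem hw]
    have h : (w : ℝ × ℝ).1 = 0 := hw
    refine Or.inl ?_
    rw [segment_eq_image']
    refine ⟨(w : ℝ × ℝ).2, w.2.1.2, ?_⟩
    ext <;> simp [h]
  have hv := w.2.2.resolve_left hw
  have hu : (w : ℝ × ℝ).1 ∈ Ioc (0 : ℝ) 1 := ⟨lt_of_le_of_ne w.2.1.1.1 (Ne.symm hw), w.2.1.1.2⟩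
  rw [toSineCurve_val, hv]
  refine Or.inr (mem_iUnion.2 ?_)
  rcases exists_upPoint_or_downPoint hu with ⟨n, c, c0, c1, e⟩ | ⟨n, c, c0, c1, e⟩ <;> rw [e]
  · rw [dyadicScale_upPoint n c0 c1, wave_upPoint n c0 c1]
    refine ⟨n, Or.inl ?_⟩
    rw [segment_eq_image']
    refine ⟨c, ⟨c0, c1⟩, ?_⟩
    ext <;> simp
  · rw [dyadicScale_downPoint n c0.le c1.le, wave_downPoint n c0.le c1.le]
    refine ⟨n, Or.inr ?_⟩
    rw [segment_eq_image']
    refine ⟨c, ⟨c0.le, c1.le⟩, ?_⟩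
    ext
    · simp [pow_succ]; ring
    · simp; ring

theorem exists_toSineCurve {t : ℝ × ℝ} (ht : t ∈ sineCurve) :
    ∃ w : waveCurve, (toSineCurve w : ℝ × ℝ) = t := by
  rcases ht with ht | ht
  · rw [segment_eq_image'] at ht
    obtain ⟨c, hc, rfl⟩ := ht
    refine ⟨⟨(0, c), ⟨by simp, hc⟩, Or.inl rfl⟩, ?_⟩
    rw [toSineCurve_of_mem rfl]
    ext <;> simp
  · obtain ⟨n, ht | ht⟩ := mem_iUnion.1 ht <;> rw [segment_eq_image'] at ht <;>
      obtain ⟨c, hc, rfl⟩ := ht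
    · have hm := upPoint_mem n hc.1 hc.2
      refine ⟨⟨(upPoint n c, c), ⟨⟨hm.1.le, hm.2⟩, hc⟩,
        Or.inr (wave_upPoint n hc.1 hc.2).symm⟩, ?_⟩
      rw [toSineCurve_val, dyadicScale_upPoint n hc.1 hc.2]
      ext <;> simp
    · have hm := downPoint_mem n hc.1 hc.2
      refine ⟨⟨(downPoint n c, 1 - c), ⟨⟨hm.1.le, hm.2⟩, by linarith [hc.2], by linarith [hc.1]⟩,
        Or.inr (wave_downPoint n hc.1 hc.2).symm⟩, ?_⟩
      rw [toSineCurve_val, dyadicScale_downPoint n hc.1 hc.2]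
      ext
      · simp [pow_succ]; ring
      · simp; ring

/-! ### The space `SC(S¹)` as a square with attached circles -/

/-- An injective map of `SC(S¹)` to `ℝ² × ℂ`: over a point `t` of the sine curve there is a circle
of radius `t.1`. -/
noncomputable def scEmbedding (s₀ : Circle) : SCSpace Circle s₀ → (ℝ × ℝ) × ℂ :=
  Quot.lift (Sum.elim (fun p => ((p : ℝ × ℝ), 0))
    fun q => ((q.1 : ℝ × ℝ), ((q.1 : ℝ × ℝ).1 : ℂ) * ((q.2 * s₀⁻¹ : Circle) - 1))) (by
    rintro _ _ (⟨p, t, h⟩ | ⟨p, t, x, h, h0⟩)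
    · simp [h]
    · simp [h, h0])

theorem continuous_scEmbedding (s₀ : Circle) : Continuous (scEmbedding s₀) := by
  refine continuous_quot_lift _ (Continuous.sumElim (by fun_prop) ?_)
  refine (by fun_prop : Continuous fun q : sineCurve × Circle => (q.1 : ℝ × ℝ)).prodMk ?_
  refine Continuous.mul (Complex.continuous_ofReal.comp (by fun_prop)) ?_
  refine Continuous.sub ?_ continuous_const
  exact (continuous_subtype_val : Continuous ((↑) : Circle → ℂ)).comp
    (continuous_snd.mul continuous_const)

theorem sineCurve_subset {t : ℝ × ℝ} (ht : t ∈ sineCurve) : t ∈ unitSquare := by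
  obtain ⟨w, rfl⟩ := exists_toSineCurve ht
  exact (toSineCurve w).2

theorem scSpace_exists_rep {s₀ : Circle} (q : SCSpace Circle s₀) :
    (∃ p, q = Quot.mk _ (Sum.inl p)) ∨ ∃ t : sineCurve, (t : ℝ × ℝ).1 ≠ 0 ∧ ∃ s, s ≠ s₀ ∧
      q = Quot.mk _ (Sum.inr (t, s)) := by
  obtain ⟨p | ⟨t, s⟩, rfl⟩ := Quot.exists_rep q
  · exact Or.inl ⟨p, rfl⟩
  · by_cases h0 : (t : ℝ × ℝ).1 = 0
    · exact Or.inl ⟨⟨t, sineCurve_subset t.2⟩, (Quot.sound (SCRel.collapse _ t s rfl h0)).symm⟩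
    by_cases hs : s = s₀
    · rw [hs]
      exact Or.inl ⟨⟨t, sineCurve_subset t.2⟩, (Quot.sound (SCRel.base _ t rfl)).symm⟩
    · exact Or.inr ⟨t, h0, s, hs, rfl⟩

theorem circle_coe_sub_one_eq_zero {s s₀ : Circle} (h : ((s * s₀⁻¹ : Circle) : ℂ) - 1 = 0) :
    s = s₀ := by
  rw [sub_eq_zero] at h
  exact mul_inv_eq_one.1 (Circle.ext h)

theorem scEmbedding_injective (s₀ : Circle) : Function.Injective (scEmbedding s₀) := by
  intro a b hab
  rcases scSpace_exists_rep a with ⟨p, rfl⟩ | ⟨t, h0, s, hs, rfl⟩ <;>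
  rcases scSpace_exists_rep b with ⟨p', rfl⟩ | ⟨t', h0', s', hs', rfl⟩ <;>
  simp only [scEmbedding, Sum.elim_inl, Sum.elim_inr, Prod.mk.injEq] at hab
  · rw [Subtype.ext hab.1]
  · rcases mul_eq_zero.1 hab.2.symm with h | h
    · exact absurd (Complex.ofReal_eq_zero.1 h) h0'
    · exact absurd (circle_coe_sub_one_eq_zero h) hs'
  · rcases mul_eq_zero.1 hab.2 with h | h
    · exact absurd (Complex.ofReal_eq_zero.1 h) h0
    · exact absurd (circle_coe_sub_one_eq_zero h) hs
  · obtain rfl : t = t' := Subtype.ext hab.1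
    have := mul_left_cancel₀ (Complex.ofReal_ne_zero.2 h0) hab.2
    rw [mul_right_cancel (Circle.ext (sub_left_inj.1 this))]

instance (s₀ : Circle) : T2Space (SCSpace Circle s₀) :=
  T2Space.of_injective_continuous (scEmbedding_injective s₀) (continuous_scEmbedding s₀)

theorem exists_circle_param (s : Circle) :
    ∃ θ : unitInterval, Circle.exp (2 * Real.pi * θ) = s := by
  have hp := Real.pi_pos
  rcases le_or_gt 0 (Complex.arg s) with h | h
  · refine ⟨⟨Complex.arg s / (2 * Real.pi), by positivity, ?_⟩, ?_⟩
    · rw [div_le_one (by positivity)]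
      linarith [Complex.arg_le_pi s]
    · rw [mul_div_cancel₀ _ (by positivity), Circle.exp_arg]
  · refine ⟨⟨Complex.arg s / (2 * Real.pi) + 1, ?_, ?_⟩, ?_⟩
    · rw [← sub_nonneg, sub_zero, div_add_one (by positivity)]
      exact div_nonneg (by linarith [Complex.neg_pi_lt_arg s]) (by positivity)
    · have : Complex.arg s / (2 * Real.pi) ≤ 0 :=
        div_nonpos_of_nonpos_of_nonneg h.le (by positivity)
      linarith
    · rw [mul_add, mul_div_cancel₀ _ (by positivity), mul_one, Circle.exp_add_two_pi,
        Circle.exp_arg]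

theorem circle_param_injective {θ θ' : ℝ} (h0 : 0 ≤ θ) (h1 : θ < 1) (h0' : 0 ≤ θ') (h1' : θ' < 1)
    (h : Circle.exp (2 * Real.pi * θ) = Circle.exp (2 * Real.pi * θ')) : θ = θ' := by
  have hp := Real.pi_pos
  have := Circle.exp_injOn_Ico (a := 0) (b := 2 * Real.pi) (by simp)
    (x₁ := 2 * Real.pi * θ) (x₂ := 2 * Real.pi * θ')
    ⟨by positivity, by nlinarith⟩ ⟨by positivity, by nlinarith⟩ h
  exact mul_left_cancel₀ (by positivity) this

theorem nonempty_homotopyEquiv_scSpace (s₀ : Circle) :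
    Nonempty (ArcSpace toSineCurve toSineCurve limitSegment ≃ₕ SCSpace Circle s₀) := by
  have e0 : ∀ w, (Quot.mk (SCRel Circle s₀) (Sum.inr (⟨_, toSineCurve_mem w⟩, s₀))) =
      Quot.mk _ (Sum.inl (toSineCurve w)) := fun w => (Quot.sound (SCRel.base _ _ rfl)).symm
  refine nonempty_homotopyEquiv_of_bijective (f := ArcSpace.desc toSineCurve toSineCurve
    limitSegment (fun p => Quot.mk _ (Sum.inl p)) (fun w θ => Quot.mk _ (Sum.inr
      (⟨_, toSineCurve_mem w⟩, s₀ * Circle.exp (2 * Real.pi * θ)))) ?_ ?_ ?_) ?_ ⟨?_, ?_⟩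
  · intro w
    simp [e0]
  · intro w
    simp [e0]
  · intro w hw θ
    refine (Quot.sound (SCRel.collapse _ _ _ rfl ?_)).symm
    rw [toSineCurve_of_mem hw]
    exact hw
  · refine ArcSpace.continuous_desc (continuous_quot_mk.comp continuous_inl)
      (continuous_quot_mk.comp (continuous_inr.comp ?_))
    refine Continuous.prodMk (Continuous.subtype_mk (continuous_subtype_val.comp
      (continuous_toSineCurve.comp continuous_fst)) _) ?_
    exact continuous_const.mul (Circle.exp.continuous.comp (by fun_prop))
  · have hne : ∀ w ∉ limitSegment, (((toSineCurve w : ℝ × ℝ).1 : ℝ) : ℂ) ≠ 0 := by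
      intro w hw h
      rw [Complex.ofReal_eq_zero, toSineCurve_val] at h
      exact hw (dyadicScale_eq_zero w.2.1.1 h)
    refine ArcSpace.desc_injective ?_ ?_ ?_
    · intro p p' h
      exact Subtype.ext (congrArg (fun q => (scEmbedding s₀ q).1) h)
    · intro w hw w' hw' θ θ' h0 h1 h0' h1' h
      have h2 := congrArg (scEmbedding s₀) h
      simp only [scEmbedding, Sum.elim_inr, Prod.mk.injEq] at h2
      obtain rfl := toSineCurve_injOn hw hw' (Subtype.ext h2.1)
      have h3 := sub_left_inj.1 (mul_left_cancel₀ (hne w hw) h2.2)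
      have h4 := mul_left_cancel (mul_right_cancel (Circle.ext h3))
      exact ⟨rfl, Subtype.ext (circle_param_injective h0.le h1 h0'.le h1' h4)⟩
    · intro p w hw θ h0 h1 h
      have h2 := congrArg (scEmbedding s₀) h
      simp only [scEmbedding, Sum.elim_inl, Sum.elim_inr, Prod.mk.injEq] at h2
      have h3 := circle_coe_sub_one_eq_zero ((mul_eq_zero.1 h2.2.symm).resolve_left (hne w hw))
      rw [mul_eq_left] at h3
      have h4 := circle_param_injective h0.le h1 le_rfl zero_lt_one (h3.trans (by simp))
      exact h0.ne' h4
  · intro q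
    rcases scSpace_exists_rep q with ⟨p, rfl⟩ | ⟨t, h0, s, hs, rfl⟩
    · exact ⟨ArcSpace.pt _ _ _ p, rfl⟩
    · obtain ⟨w, hw⟩ := exists_toSineCurve t.2
      obtain ⟨θ, hθ⟩ := exists_circle_param (s₀⁻¹ * s)
      refine ⟨ArcSpace.arc _ _ _ w θ, ?_⟩
      rw [ArcSpace.desc_arc, hθ, mul_inv_cancel_left]
      congr 3
      exact Subtype.ext hw

theorem nonempty_homotopyEquiv_of_eq_zero {ε : ℝ} (hε : 0 < ε) (hle : ε ≤ 1) (s₀ : Circle) :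
    Nonempty (plSpace 0 ε ≃ₕ SCSpace Circle s₀) := by
  rw [plSpace_eq_doubleSquare le_rfl hε.le (by linarith) (by linarith)]
  obtain ⟨e1⟩ := nonempty_homotopyEquiv_thin hε hle
  obtain ⟨e2⟩ := nonempty_homotopyEquiv_thin_arcSpace hε hle
  have hc : ∀ θ, Continuous fun w => thinPoint ε w θ := fun θ =>
    (continuous_thinPoint ε).comp (by fun_prop : Continuous fun w : waveCurve => (w, θ))
  have hT : ∀ w ∈ limitSegment, ∀ θ, toSineCurve w = thinPoint ε w θ := fun w hw θ =>
    Subtype.ext ((toSineCurve_of_mem hw).trans (thinPoint_of_mem hw θ).symm)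
  obtain ⟨e3⟩ := ArcSpace.nonempty_homotopyEquiv_square (L := limitSegment) (hc 0)
    continuous_toSineCurve (fun w => thinPoint ε w 1) fun w hw => hT w hw 0
  obtain ⟨e4⟩ := ArcSpace.nonempty_homotopyEquiv_reverse (L := limitSegment) (f₀ := toSineCurve)
    (f₁ := fun w => thinPoint ε w 1) fun w hw => hT w hw 1
  obtain ⟨e5⟩ := ArcSpace.nonempty_homotopyEquiv_square (L := limitSegment) (hc 1)
    continuous_toSineCurve toSineCurve fun w hw => hT w hw 1
  obtain ⟨e6⟩ := nonempty_homotopyEquiv_scSpace s₀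
  exact ⟨e1.trans (e2.symm.trans (e3.trans (e4.trans (e5.trans e6))))⟩

/-! ### Strips that contain a horizontal strip -/

theorem contractibleSpace_plSpace {y ε : ℝ} (hε : 0 ≤ ε) (hle : y + ε ≤ 1)
    (hy : 1 / 2 < y) : ContractibleSpace (plSpace y ε) := by
  have hy0 : 0 ≤ y := by linarith
  have hpos : 0 < y + ε := by linarith
  rw [plSpace_eq_doubleSquare hy0 hε hpos hle]
  have hb := fun (x : ℝ) (h0 : 0 < x) (h1 : x ≤ 1) => lowerEdge_bounds hy0 hε hpos hle x ⟨h0, h1⟩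
  refine contractibleSpace_doubleSquare (isStripFunction_roof hy0 hε hpos) (c := y - 1 / 2)
    (by linarith) (fun x h0 h1 => (hb x h0 h1).1) (fun x h0 h1 => (hb x h0 h1).2.2) ?_ ?_
  · intro x h0 h1
    have h2 := (hb x h0 h1).2.2
    have : 0 ≤ ε * x := by positivity
    linarith
  · intro x h0 h1
    have h2 := (hb x h0 h1).1
    have : 0 ≤ ε * x := by positivity
    linarith

/-! ### The collar of a strip of constant width -/

/-- A function on the square that is positive exactly over the strip of width `y` above `l`. -/
noncomputable def bandRoof (l : ℝ → ℝ) (y : ℝ) : ℝ × ℝ → ℝ := stripRoof l fun x => l x + y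

/-- The points of the square whose vertical distance to the complement of the strip of width `y`
above `l` is at most `y x / 8`. The neighbourhood shrinks towards the side `x = 0`. -/
def collar (l : ℝ → ℝ) (y : ℝ) : Set unitSquare :=
  {p | bandRoof l y p ≤ (p : ℝ × ℝ).1 * (y * (p : ℝ × ℝ).1 / 8)}

/-- The points of the square that are not in the interior of the collar. -/
def collarCore (l : ℝ → ℝ) (y : ℝ) : Set unitSquare :=
  {p | (p : ℝ × ℝ).1 * (y * (p : ℝ × ℝ).1 / 8) ≤ bandRoof l y p}

/-- The part of the collar on the side `x = 0`. -/
def collarLimit (l : ℝ → ℝ) (y : ℝ) : Set (collar l y) := {w | (w : unitSquare).1.1 = 0}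

/-- The distance of a point from the complement of the strip as a fraction of the width of the
collar. -/
noncomputable def collarFraction (l : ℝ → ℝ) (y : ℝ) (p : unitSquare) : unitInterval :=
  projIcc 0 1 zero_le_one (bandRoof l y p / ((p : ℝ × ℝ).1 * (y * (p : ℝ × ℝ).1 / 8)))

open Classical in
/-- The function on the square that is `γ` on the collar, evaluated at the fraction, and `μ`
elsewhere. -/
noncomputable def collarGlue {V K : Type*} {l : ℝ → ℝ} {y : ℝ}
    (γ : collar l y → unitInterval → K → V) (μ : unitSquare → K → V) (p : unitSquare) (k : K) : V :=
  if h : p ∈ collar l y then γ ⟨p, h⟩ (collarFraction l y p) k else μ p k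

/-- The boundary function `l` of a strip of constant width `y` in the square. -/
structure IsBand (l : ℝ → ℝ) (y : ℝ) : Prop where
  pos : 0 < y
  continuousOn : ContinuousOn l (Ioc 0 1)
  bounds : ∀ x ∈ Ioc (0 : ℝ) 1, 0 ≤ l x ∧ l x + y ≤ 1

section Collar

variable {l : ℝ → ℝ} {y : ℝ}

theorem IsBand.isStripFunction (h : IsBand l y) :
    IsStripFunction (bandRoof l y) l fun x => l x + y :=
  isStripFunction_stripRoof h.continuousOn (h.continuousOn.add continuousOn_const) fun x hx =>
    ⟨(h.bounds x hx).1, by linarith [h.pos], (h.bounds x hx).2⟩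

theorem mem_collar_iff (h : IsBand l y) {p : unitSquare} : p ∈ collar l y ↔
    p.1.1 = 0 ∨ p.1.2 ≤ l p.1.1 + y * p.1.1 / 8 ∨ l p.1.1 + y - y * p.1.1 / 8 ≤ p.1.2 := by
  have hy := h.pos
  have hx := p.2.1.1
  have hd : 0 ≤ p.1.1 * (y * p.1.1 / 8) := by positivity
  rw [collar, mem_ofPred_eq, bandRoof, stripRoof, max_le_iff, and_iff_right hd, min_le_iff,
    ← mul_sub, ← mul_sub]
  rcases hx.eq_or_lt with h0 | h0
  · simp [← h0]
  · rw [mul_le_mul_iff_right₀ h0, mul_le_mul_iff_right₀ h0, or_iff_right h0.ne']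
    constructor <;> rintro (h1 | h1)
    · exact Or.inl (by linarith)
    · exact Or.inr (by linarith)
    · exact Or.inl (by linarith)
    · exact Or.inr (by linarith)

theorem continuous_bandRoof (h : IsBand l y) : Continuous fun p : unitSquare => bandRoof l y p :=
  h.isStripFunction.1.domRestrict

theorem isClosed_collar (h : IsBand l y) : IsClosed (collar l y) :=
  isClosed_le (continuous_bandRoof h) (by fun_prop)

theorem isClosed_collarCore (h : IsBand l y) : IsClosed (collarCore l y) :=
  isClosed_le (by fun_prop) (continuous_bandRoof h)

theorem mem_collar_of_zero (h : IsBand l y) {p : unitSquare} (hp : bandRoof l y p = 0) :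
    p ∈ collar l y := by
  have := h.pos
  have := p.2.1.1
  rw [collar, mem_ofPred_eq, hp]
  positivity

theorem collarFraction_of_zero {p : unitSquare} (hp : bandRoof l y p = 0) :
    collarFraction l y p = 0 := by
  rw [collarFraction, hp, zero_div]
  exact projIcc_left zero_le_one

theorem collarFraction_of_core (h : IsBand l y) {p : unitSquare} (hx : p.1.1 ≠ 0)
    (hp : p ∈ collarCore l y) : collarFraction l y p = 1 := by
  have := h.pos
  have : 0 < p.1.1 := lt_of_le_of_ne p.2.1.1 (Ne.symm hx)
  refine projIcc_of_right_le _ ?_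
  rw [one_le_div (by positivity)]
  exact hp

theorem continuousAt_collarFraction (h : IsBand l y) {p : unitSquare} (hx : p.1.1 ≠ 0) :
    ContinuousAt (collarFraction l y) p := by
  have hy := h.pos
  refine continuous_projIcc.continuousAt.comp (ContinuousAt.div
    (continuous_bandRoof h).continuousAt (by fun_prop) ?_)
  positivity

variable {V K : Type*} [TopologicalSpace V] [TopologicalSpace K]

theorem continuous_collarGlue (h : IsBand l y) {γ : collar l y → unitInterval → K → V}
    {μ : unitSquare → K → V}
    (hγ : Continuous fun p : collar l y × unitInterval × K => γ p.1 p.2.1 p.2.2)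
    (hL : ∀ w ∈ collarLimit l y, ∀ θ k, γ w θ k = γ w 0 k)
    (hμ : Continuous fun p : unitSquare × K => μ p.1 p.2) (h1 : ∀ w k, γ w 1 k = μ w k) :
    Continuous fun p : unitSquare × K => collarGlue γ μ p.1 p.2 := by
  rw [← continuousOn_univ]
  have hu : (univ : Set (unitSquare × K)) =
      {p | p.1 ∈ collar l y} ∪ {p | p.1 ∈ collarCore l y} := by
    ext p
    exact iff_of_true trivial (le_total (bandRoof l y p.1) _)
  rw [hu]
  refine ContinuousOn.union_of_isClosed ?_ ?_ ((isClosed_collar h).preimage continuous_fst)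
    ((isClosed_collarCore h).preimage continuous_fst)
  · rw [continuousOn_iff_continuous_domRestrict]
    have hc := continuous_of_collapse (Y := {p : unitSquare × K | p.1 ∈ collar l y})
      hγ hL (w := fun q => ⟨q.1.1, q.2⟩) (θ := fun q => collarFraction l y q.1.1)
      (k := fun q => q.1.2) (by fun_prop)
      (fun q hq => (continuousAt_collarFraction h hq).comp (f := fun q :
        {p : unitSquare × K | p.1 ∈ collar l y} => q.1.1) (by fun_prop)) (by fun_prop)
    refine hc.congr fun q => ?_
    have hq : q.1.1 ∈ collar l y := q.2
    rw [domRestrict_apply, collarGlue, dif_pos hq]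
  · refine hμ.continuousOn.congr fun q hq => ?_
    rw [collarGlue]
    split_ifs with hq'
    · by_cases hx : q.1.1.1 = 0
      · rw [hL ⟨q.1, hq'⟩ hx, ← hL ⟨q.1, hq'⟩ hx 1, h1]
      · rw [collarFraction_of_core h hx hq, h1]
    · rfl

/-- The vertical displacement of a point of the collar from the complement of the strip. The second
factor is the sign of the displacement: `1` at the lower and `-1` at the upper boundary. -/
noncomputable def collarShift (w : collar l y) : ℝ :=
  min (y * w.1.1.1 / 8) (max 0 (min (w.1.1.2 - l w.1.1.1) (l w.1.1.1 + y - w.1.1.2))) *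
    max (-1) (min 1 ((l w.1.1.1 + y / 2 - w.1.1.2) * (4 / y)))

theorem collarShift_cases (h : IsBand l y) {w : collar l y} (hw : w ∉ collarLimit l y) :
    (w.1.1.2 ≤ l w.1.1.1 + y * w.1.1.1 / 8 ∧ collarShift w = max 0 (w.1.1.2 - l w.1.1.1)) ∨
    (l w.1.1.1 + y - y * w.1.1.1 / 8 ≤ w.1.1.2 ∧
      collarShift w = -max 0 (l w.1.1.1 + y - w.1.1.2)) := by
  have hy := h.pos
  have hx0 := w.1.2.1.1
  have hx1 := w.1.2.1.2
  have hd : y * w.1.1.1 ≤ y := mul_le_of_le_one_right hy.le hx1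
  have hd0 : 0 ≤ y * w.1.1.1 / 8 := by positivity
  rcases ((mem_collar_iff h).1 w.2).resolve_left hw with h1 | h1
  · refine Or.inl ⟨h1, ?_⟩
    have h2 : 1 ≤ (l w.1.1.1 + y / 2 - w.1.1.2) * (4 / y) := by
      rw [mul_div_assoc', le_div_iff₀ hy]
      linarith
    rw [collarShift, min_eq_left h2, max_eq_right (a := (-1 : ℝ)) (by norm_num), mul_one,
      min_eq_left (b := l w.1.1.1 + y - w.1.1.2) (by linarith),
      min_eq_right (max_le hd0 (by linarith))]
  · refine Or.inr ⟨h1, ?_⟩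
    have h2 : (l w.1.1.1 + y / 2 - w.1.1.2) * (4 / y) ≤ -1 := by
      rw [mul_div_assoc', div_le_iff₀ hy]
      linarith
    rw [collarShift, max_eq_left ((min_le_right _ _).trans h2),
      min_eq_right (a := w.1.1.2 - l w.1.1.1) (by linarith),
      min_eq_right (max_le hd0 (by linarith)), mul_neg_one]

theorem abs_collarShift_le (h : IsBand l y) (w : collar l y) :
    |collarShift w| ≤ y / 8 * w.1.1.1 := by
  have hy := h.pos
  have hx0 := w.1.2.1.1
  rw [collarShift, abs_mul]
  refine (mul_le_of_le_one_right (abs_nonneg _) (abs_le.2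
    ⟨le_max_left _ _, max_le (by norm_num) (min_le_left _ _)⟩)).trans ?_
  rw [abs_of_nonneg (le_min (by positivity) (le_max_left _ _))]
  exact (min_le_left _ _).trans_eq (by ring)

theorem collarShift_of_mem (h : IsBand l y) {w : collar l y} (hw : w ∈ collarLimit l y) :
    collarShift w = 0 := by
  have h0 : w.1.1.1 = 0 := hw
  have := abs_collarShift_le h w
  rw [h0, mul_zero] at this
  exact abs_nonpos_iff.1 this

theorem continuous_collarShift (h : IsBand l y) :
    Continuous (collarShift : collar l y → ℝ) := by
  refine continuous_of_abs_le (φ := fun w : collar l y => w.1.1.1) (by fun_prop)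
    (fun w => w.1.2.1.1) (abs_collarShift_le h) ?_
  have hl : ContinuousOn (fun w : collar l y => l w.1.1.1) {w | 0 < w.1.1.1} :=
    h.continuousOn.comp (by fun_prop) fun w hw => ⟨hw, w.1.2.1.2⟩
  have hx : ContinuousOn (fun w : collar l y => w.1.1.1) {w | 0 < w.1.1.1} := by fun_prop
  have hv : ContinuousOn (fun w : collar l y => w.1.1.2) {w | 0 < w.1.1.1} := by fun_prop
  have hF : Continuous fun q : ℝ × ℝ × ℝ =>
      min (y * q.1 / 8) (max 0 (min (q.2.1 - q.2.2) (q.2.2 + y - q.2.1))) *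
        max (-1) (min 1 ((q.2.2 + y / 2 - q.2.1) * (4 / y))) := by fun_prop
  exact hF.comp_continuousOn (hx.prodMk (hv.prodMk hl))

/-- Moving a point of the collar towards the complement of the strip does not leave the square. -/
theorem sub_collarShift_mem (h : IsBand l y) (w : collar l y) {b : ℝ} (h0 : 0 ≤ b) (h1 : b ≤ 1) :
    w.1.1.2 - b * collarShift w ∈ Icc (0 : ℝ) 1 := by
  have hv := w.1.2.2
  by_cases hw : w ∈ collarLimit l y
  · rw [collarShift_of_mem h hw, mul_zero, sub_zero]
    exact hv
  have hx : w.1.1.1 ∈ Ioc (0 : ℝ) 1 := ⟨lt_of_le_of_ne w.1.2.1.1 (Ne.symm hw), w.1.2.1.2⟩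
  obtain ⟨h2, h3⟩ := h.bounds _ hx
  have hy := h.pos
  rcases collarShift_cases h hw with ⟨-, h4⟩ | ⟨-, h4⟩ <;> rw [h4]
  · have h5 : 0 ≤ max 0 (w.1.1.2 - l w.1.1.1) := le_max_left _ _
    have h6 : max 0 (w.1.1.2 - l w.1.1.1) ≤ w.1.1.2 := max_le hv.1 (by linarith)
    have h7 := mul_le_of_le_one_left h5 h1
    have h8 := mul_nonneg h0 h5
    exact ⟨by linarith, by linarith [hv.2]⟩
  · have h5 : 0 ≤ max 0 (l w.1.1.1 + y - w.1.1.2) := le_max_left _ _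
    have h6 : max 0 (l w.1.1.1 + y - w.1.1.2) ≤ 1 - w.1.1.2 :=
      max_le (by linarith [hv.2]) (by linarith)
    have h7 := mul_le_of_le_one_left h5 h1
    have h8 := mul_nonneg h0 h5
    exact ⟨by linarith [hv.1], by linarith⟩

/-- The point over `x` at the height of `w`, moved by `b` times the displacement of `w`. -/
noncomputable def shifted (w : collar l y) (x b : ℝ) : unitSquare :=
  sqPt (x, w.1.1.2 - b * collarShift w)

theorem continuous_shifted (h : IsBand l y) {Y : Type*} [TopologicalSpace Y] {w : Y → collar l y}
    {x b : Y → ℝ} (hw : Continuous w) (hx : Continuous x) (hb : Continuous b) :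
    Continuous fun q => shifted (w q) (x q) (b q) := by
  have := (continuous_collarShift h).comp hw
  exact continuous_sqPt.comp (hx.prodMk ((by fun_prop : Continuous fun q => (w q).1.1.2).sub
    (hb.mul this)))

theorem shifted_val (h : IsBand l y) (w : collar l y) {x b : ℝ} (hx0 : 0 ≤ x) (hx1 : x ≤ 1)
    (h0 : 0 ≤ b) (h1 : b ≤ 1) :
    (shifted w x b : ℝ × ℝ) = (x, w.1.1.2 - b * collarShift w) :=
  sqPt_val hx0 hx1 (sub_collarShift_mem h w h0 h1).1 (sub_collarShift_mem h w h0 h1).2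

theorem shifted_zero (w : collar l y) : shifted w w.1.1.1 0 = w := by
  rw [shifted, zero_mul, sub_zero, Prod.mk.eta, sqPt_coe]

theorem shifted_of_mem (h : IsBand l y) {w : collar l y} (hw : w ∈ collarLimit l y) (x b : ℝ) :
    shifted w x b = sqPt (x, w.1.1.2) := by
  rw [shifted, collarShift_of_mem h hw, mul_zero, sub_zero]

theorem bandRoof_sqPt_zero (h : IsBand l y) (v : ℝ) : bandRoof l y (sqPt (0, v)) = 0 := by
  rw [h.isStripFunction.2, sqPt_fst]
  simp

theorem bandRoof_shifted_one (h : IsBand l y) (w : collar l y) :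
    bandRoof l y (shifted w w.1.1.1 1) = 0 := by
  rw [h.isStripFunction.2, shifted_val h w w.1.2.1.1 w.1.2.1.2 zero_le_one le_rfl]
  by_cases hw : w ∈ collarLimit l y
  · exact Or.inl hw
  refine Or.inr ?_
  rcases collarShift_cases h hw with ⟨-, h4⟩ | ⟨-, h4⟩ <;> rw [h4]
  · refine Or.inl ?_
    have := le_max_right 0 (w.1.1.2 - l w.1.1.1)
    dsimp only
    linarith
  · refine Or.inr ?_
    have := le_max_right 0 (l w.1.1.1 + y - w.1.1.2)
    dsimp only
    linarith

theorem collarShift_of_zero (h : IsBand l y) {w : collar l y} (hw : bandRoof l y w = 0) :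
    collarShift w = 0 := by
  by_cases hL : w ∈ collarLimit l y
  · exact collarShift_of_mem h hL
  have h3 := (h.isStripFunction.2 _).1 hw
  have hx0 := w.1.2.1.1
  have hx1 := w.1.2.1.2
  have hy := h.pos
  have hd : y * w.1.1.1 ≤ y := mul_le_of_le_one_right hy.le hx1
  have hd0 : 0 ≤ y * w.1.1.1 := by positivity
  rcases collarShift_cases h hL with ⟨h4, h5⟩ | ⟨h4, h5⟩ <;> rw [h5] <;>
    rcases h3.resolve_left hL with h6 | h6
  · rw [max_eq_left (by linarith)]
  · dsimp only at h6
    linarith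
  · linarith
  · rw [max_eq_left (by linarith), neg_zero]

theorem shifted_mem_collar (h : IsBand l y) (w : collar l y) {b : ℝ} (h0 : 0 ≤ b) (h1 : b ≤ 1) :
    shifted w w.1.1.1 b ∈ collar l y := by
  rw [mem_collar_iff h, shifted_val h w w.1.2.1.1 w.1.2.1.2 h0 h1]
  by_cases hw : w ∈ collarLimit l y
  · exact Or.inl hw
  refine Or.inr ?_
  rcases collarShift_cases h hw with ⟨h3, h4⟩ | ⟨h3, h4⟩ <;> rw [h4]
  · have := mul_nonneg h0 (le_max_left 0 (w.1.1.2 - l w.1.1.1))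
    exact Or.inl (by dsimp only; linarith)
  · have := mul_nonneg h0 (le_max_left 0 (l w.1.1.1 + y - w.1.1.2))
    exact Or.inr (by dsimp only; linarith)

/-- The point of the collar that is obtained from `w` by moving it towards the complement of the
strip by `b` times its displacement. -/
noncomputable def collarMove (h : IsBand l y) (w : collar l y) (b : unitInterval) : collar l y :=
  ⟨shifted w w.1.1.1 b, shifted_mem_collar h w b.2.1 b.2.2⟩

theorem continuous_collarMove (h : IsBand l y) {Y : Type*} [TopologicalSpace Y]
    {w : Y → collar l y} {b : Y → unitInterval} (hw : Continuous w) (hb : Continuous b) :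
    Continuous fun q => collarMove h (w q) (b q) :=
  Continuous.subtype_mk (continuous_shifted h hw (by fun_prop) (by fun_prop)) _

theorem collarMove_zero (h : IsBand l y) (w : collar l y) : collarMove h w 0 = w :=
  Subtype.ext (shifted_zero w)

end Collar

/-! ### Collapsing the doubled square to a segment with attached arcs -/

theorem doubleSquare.exists_map {G : ℝ × ℝ → ℝ} {V : Type} [TopologicalSpace V]
    (hG : ContinuousOn G unitSquare) {α β : unitSquare → V} (hα : Continuous α) (hβ : Continuous β)
    (h : ∀ p : unitSquare, G p = 0 → α p = β p) :
    ∃ F : C(doubleSquare G, V), (∀ p, F (flat G p) = α p) ∧ ∀ p, F (top G p) = β p :=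
  ⟨⟨_, continuous_desc hG hα hβ h⟩, fun p => desc_flat α β p, fun p => desc_top h p⟩

theorem ArcSpace.exists_map {X W V : Type} [TopologicalSpace X] [TopologicalSpace W]
    [TopologicalSpace V] {f₀ f₁ : W → X} {L : Set W} {α : X → V} {γ : W → unitInterval → V}
    (hα : Continuous α) (hγ : Continuous fun p : W × unitInterval => γ p.1 p.2)
    (h0 : ∀ w, γ w 0 = α (f₀ w)) (h1 : ∀ w, γ w 1 = α (f₁ w))
    (hc : ∀ w ∈ L, ∀ θ, γ w θ = α (f₀ w)) :
    ∃ F : C(ArcSpace f₀ f₁ L, V), (∀ x, F (pt f₀ f₁ L x) = α x) ∧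
      ∀ w, ∀ θ : unitInterval, F (arc f₀ f₁ L w θ) = γ w θ :=
  ⟨⟨desc f₀ f₁ L α γ h0 h1 hc, continuous_desc hα hγ⟩, fun _ => rfl,
    fun w θ => desc_arc (h0 := h0) (h1 := h1) (hc := hc) w θ⟩

/-- The function on `[0, 1]` that rises linearly from `0` to `1` and falls back to `0`. -/
noncomputable def bump (θ : unitInterval) : unitInterval :=
  ⟨1 - |2 * (θ : ℝ) - 1|, by
    have h0 := θ.2.1
    have h1 := θ.2.2
    have : |2 * (θ : ℝ) - 1| ≤ 1 := abs_le.2 ⟨by linarith, by linarith⟩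
    exact ⟨by linarith, by linarith [abs_nonneg (2 * (θ : ℝ) - 1)]⟩⟩

theorem continuous_bump : Continuous bump := Continuous.subtype_mk (by fun_prop) _

theorem bump_zero : bump 0 = 0 := Subtype.ext (by simp [bump])

theorem bump_one : bump 1 = 0 := Subtype.ext (by norm_num [bump])

theorem bump_of_eq_half {θ : unitInterval} (h : (θ : ℝ) = 1 / 2) : bump θ = 1 :=
  Subtype.ext (by simp [bump, h])

theorem bump_of_half_lt {θ : unitInterval} (h : 1 / 2 < (θ : ℝ)) : (bump θ : ℝ) = 2 - 2 * θ := by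
  change 1 - |2 * (θ : ℝ) - 1| = _
  rw [abs_of_pos (by linarith)]
  ring

section Collapse

variable {l : ℝ → ℝ} {y : ℝ}

/-- The height of a point of the collar. -/
def collarHeight (w : collar l y) : unitInterval := ⟨w.1.1.2, w.1.2.2⟩

theorem continuous_collarHeight : Continuous (collarHeight : collar l y → unitInterval) :=
  Continuous.subtype_mk (by fun_prop) _

/-- The side `x = 0` of the square with a loop attached at the height of each point of the
collar. -/
abbrev CollarLoops (l : ℝ → ℝ) (y : ℝ) : Type :=
  ArcSpace (collarHeight : collar l y → unitInterval) collarHeight (collarLimit l y)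

theorem collarMove_of_mem (h : IsBand l y) {w : collar l y} (hw : w ∈ collarLimit l y)
    (b : unitInterval) : collarMove h w b = w :=
  Subtype.ext (by
    change shifted w w.1.1.1 b = _
    rw [shifted_of_mem h hw, Prod.mk.eta, sqPt_coe])

/-- The point of the segment at the height of `p`. -/
def loopsPt (l : ℝ → ℝ) (y : ℝ) (p : unitSquare) : CollarLoops l y :=
  ArcSpace.pt _ _ _ ⟨p.1.2, p.2.2⟩

theorem continuous_loopsPt : Continuous (loopsPt l y) :=
  ArcSpace.continuous_pt.comp (Continuous.subtype_mk (by fun_prop) _)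

/-- The loop at the height of `w`. -/
noncomputable def loopsArc (w : collar l y) (θ : ℝ) : CollarLoops l y := ArcSpace.arc _ _ _ w θ

theorem continuous_loopsArc {Y : Type*} [TopologicalSpace Y] {w : Y → collar l y} {θ : Y → ℝ}
    (hw : Continuous w) (hθ : Continuous θ) : Continuous fun q => loopsArc (w q) (θ q) :=
  ArcSpace.continuous_arc.comp (hw.prodMk hθ)

theorem loopsArc_of_le_zero (w : collar l y) {θ : ℝ} (h : θ ≤ 0) :
    loopsArc w θ = loopsPt l y w := ArcSpace.arc_of_le_zero w h

theorem loopsArc_of_one_le (w : collar l y) {θ : ℝ} (h : 1 ≤ θ) :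
    loopsArc w θ = loopsPt l y w := ArcSpace.arc_of_one_le w h

theorem loopsArc_of_mem {w : collar l y} (h : w ∈ collarLimit l y) (θ : ℝ) :
    loopsArc w θ = loopsPt l y w := ArcSpace.arc_of_mem h θ

/-- The map of the upper sheet which sends a point of the collar to its loop, with the fraction of
the point as parameter. For `t = 1` it is the projection to the segment. -/
noncomputable def upperMap (p : unitSquare) (t : unitInterval) : CollarLoops l y :=
  collarGlue (fun w θ (t : unitInterval) => loopsArc w (max t θ)) (fun p _ => loopsPt l y p) p t

theorem continuous_upperMap (h : IsBand l y) :
    Continuous fun p : unitSquare × unitInterval => (upperMap p.1 p.2 : CollarLoops l y) := by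
  refine continuous_collarGlue h ?_ ?_ ?_ ?_
  · exact continuous_loopsArc (by fun_prop) (by fun_prop)
  · intro w hw θ t
    rw [loopsArc_of_mem hw, loopsArc_of_mem hw]
  · exact continuous_loopsPt.comp continuous_fst
  · intro w t
    exact loopsArc_of_one_le w (le_max_right _ _)

theorem upperMap_of_zero (h : IsBand l y) {p : unitSquare} (hp : bandRoof l y p = 0)
    (t : unitInterval) : upperMap p t = loopsArc ⟨p, mem_collar_of_zero h hp⟩ (t : ℝ) := by
  rw [upperMap, collarGlue, dif_pos (mem_collar_of_zero h hp), collarFraction_of_zero hp]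
  congr 1
  exact max_eq_left t.2.1

theorem upperMap_one (p : unitSquare) : (upperMap p 1 : CollarLoops l y) = loopsPt l y p := by
  rw [upperMap, collarGlue]
  split_ifs with hp
  · exact loopsArc_of_one_le _ (le_max_left _ _)
  · rfl

theorem loopsPt_eq {p q : unitSquare} (hpq : p.1.2 = q.1.2) : loopsPt l y p = loopsPt l y q := by
  rw [loopsPt, loopsPt]
  congr 2

theorem exists_collapse (h : IsBand l y) : ∃ Φ : C(doubleSquare (bandRoof l y), CollarLoops l y),
    (∀ p, Φ (doubleSquare.flat _ p) = loopsPt l y p) ∧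
      ∀ p, Φ (doubleSquare.top _ p) = upperMap p 0 := by
  refine doubleSquare.exists_map h.isStripFunction.1 continuous_loopsPt
    ((continuous_upperMap h).comp (by fun_prop : Continuous fun p : unitSquare =>
      (p, (0 : unitInterval)))) ?_
  intro p hp
  rw [upperMap_of_zero h hp, loopsArc_of_le_zero _ (by simp)]

/-- The loop through the doubled square that runs from the side `x = 0` through the flat sheet to
the complement of the strip, close to `w`, and back through the upper sheet. -/
noncomputable def sheetLoop (w : collar l y) (θ : unitInterval) : doubleSquare (bandRoof l y) :=
  if (θ : ℝ) ≤ 1 / 2 then doubleSquare.flat _ (shifted w (bump θ * w.1.1.1) (bump θ))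
  else doubleSquare.top _ (shifted w (bump θ * w.1.1.1) (bump θ))

theorem flat_eq_top_shifted (h : IsBand l y) (w : collar l y) :
    doubleSquare.flat (bandRoof l y) (shifted w w.1.1.1 1) =
      doubleSquare.top _ (shifted w w.1.1.1 1) :=
  doubleSquare.flat_eq_top (bandRoof_shifted_one h w)

theorem flat_eq_top_left (h : IsBand l y) (v : ℝ) :
    doubleSquare.flat (bandRoof l y) (sqPt (0, v)) = doubleSquare.top _ (sqPt (0, v)) :=
  doubleSquare.flat_eq_top (bandRoof_sqPt_zero h v)

theorem exists_expand (h : IsBand l y) : ∃ Ψ : C(CollarLoops l y, doubleSquare (bandRoof l y)),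
    (∀ p, Ψ (loopsPt l y p) = doubleSquare.flat _ (sqPt (0, p.1.2))) ∧
      ∀ w, ∀ θ : unitInterval, Ψ (loopsArc w θ) = sheetLoop w θ := by
  have hflat : Continuous fun v : unitInterval =>
      doubleSquare.flat (bandRoof l y) (sqPt (0, (v : ℝ))) :=
    doubleSquare.continuous_flat.comp (continuous_sqPt.comp (by fun_prop))
  refine (ArcSpace.exists_map (f₀ := (collarHeight : collar l y → unitInterval))
    (f₁ := collarHeight) (L := collarLimit l y) hflat (γ := sheetLoop) ?_ ?_ ?_ ?_).imp
      fun Ψ hh => ⟨fun p => hh.1 _, hh.2⟩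
  · have hs : Continuous fun p : collar l y × unitInterval =>
        shifted p.1 (bump p.2 * p.1.1.1.1) (bump p.2) := by
      have := continuous_bump
      exact continuous_shifted h continuous_fst (by fun_prop) (by fun_prop)
    refine Continuous.if_le (doubleSquare.continuous_flat.comp hs)
      ((doubleSquare.continuous_top h.isStripFunction.1).comp hs) (by fun_prop) continuous_const ?_
    intro p hp
    simp only [bump_of_eq_half hp, Icc.coe_one, one_mul]
    exact flat_eq_top_shifted h p.1
  · intro w
    rw [sheetLoop, if_pos (by simp), bump_zero]
    simp [shifted, collarHeight]
  · intro w
    rw [sheetLoop, if_neg (by norm_num), bump_one]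
    simp [shifted, collarHeight, flat_eq_top_left h]
  · intro w hw θ
    have h0 : w.1.1.1 = 0 := hw
    rw [sheetLoop, shifted_of_mem h hw, h0, mul_zero, ← flat_eq_top_left h]
    simp [collarHeight]

/-- The composition sends the first half of the loop at `w` into the segment, and the second half to
points of loops at positions that move from near the complement of the strip to the side `x = 0`. A
homotopy moves these positions back to `w`. -/
theorem collapse_comp_expand (h : IsBand l y)
    {Φ : C(doubleSquare (bandRoof l y), CollarLoops l y)}
    {Ψ : C(CollarLoops l y, doubleSquare (bandRoof l y))}
    (hΦ : ∀ p, Φ (doubleSquare.flat _ p) = loopsPt l y p)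
    (hΦ' : ∀ p, Φ (doubleSquare.top _ p) = upperMap p 0)
    (hΨ : ∀ p, Ψ (loopsPt l y p) = doubleSquare.flat _ (sqPt (0, p.1.2)))
    (hΨ' : ∀ w, ∀ θ : unitInterval, Ψ (loopsArc w θ) = sheetLoop w θ) :
    (Φ.comp Ψ).Homotopic (ContinuousMap.id _) := by
  -- a point of the flat half of the loop is moved on the loop over its projection to the collar
  let γ₁ : collar l y → unitInterval → unitInterval → CollarLoops l y := fun w θ s =>
    if (θ : ℝ) ≤ 1 / 2 then loopsArc (collarMove h w (bump θ)) (2 * θ * s)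
    else upperMap (shifted w (bump θ * w.1.1.1) (bump θ)) s
  -- the loops are then moved back to `w`, and their parameters become linear
  let γ₂ : collar l y → unitInterval → unitInterval → CollarLoops l y := fun w θ s =>
    loopsArc (collarMove h w (unitInterval.symm s * bump θ))
      ((1 - s) * min 1 (2 * (θ : ℝ)) + s * θ)
  have hpt : Continuous fun p : unitInterval × unitInterval =>
      (ArcSpace.pt collarHeight collarHeight (collarLimit l y) p.1 : CollarLoops l y) :=
    ArcSpace.continuous_pt.comp continuous_fst
  have hb := continuous_bump
  have c1 : Continuous fun p : collar l y × unitInterval × unitInterval =>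
      γ₁ p.1 p.2.1 p.2.2 := by
    refine Continuous.if_le (continuous_loopsArc (continuous_collarMove h (by fun_prop)
      (by fun_prop)) (by fun_prop)) ((continuous_upperMap h).comp
        ((continuous_shifted h continuous_fst (by fun_prop) (by fun_prop)).prodMk (by fun_prop)))
      (by fun_prop) continuous_const ?_
    intro p hp
    simp only [bump_of_eq_half hp, Icc.coe_one, one_mul]
    rw [upperMap_of_zero h (bandRoof_shifted_one h p.1), hp]
    congr 1
    ring
  have c2 : Continuous fun p : collar l y × unitInterval × unitInterval =>
      γ₂ p.1 p.2.1 p.2.2 :=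
    continuous_loopsArc (continuous_collarMove h (by fun_prop) (by fun_prop)) (by fun_prop)
  have e0 : ∀ w s, γ₁ w 0 s = loopsPt l y w := by
    intro w s
    simp only [γ₁]
    rw [if_pos (by simp), bump_zero, collarMove_zero, loopsArc_of_le_zero _ (by simp)]
  have e1 : ∀ w s, γ₁ w 1 s = loopsPt l y w := by
    intro w s
    simp only [γ₁]
    rw [if_neg (by norm_num), bump_one, upperMap_of_zero h (by
      rw [Icc.coe_zero, zero_mul]; exact bandRoof_sqPt_zero h _), loopsArc_of_mem]
    · refine loopsPt_eq ?_
      simp [shifted, sqPt_snd, w.1.2.2.1, w.1.2.2.2]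
    · simp [collarLimit, shifted, sqPt_fst]
  have eL : ∀ w ∈ collarLimit l y, ∀ θ s, γ₁ w θ s = loopsPt l y w := by
    intro w hw θ s
    have h0 : w.1.1.1 = 0 := hw
    simp only [γ₁]
    split_ifs
    · rw [collarMove_of_mem h hw, loopsArc_of_mem hw]
    · have e : shifted w (bump θ * w.1.1.1) (bump θ) = w := by
        rw [shifted_of_mem h hw, h0, mul_zero, ← h0, Prod.mk.eta, sqPt_coe]
      rw [e, upperMap, collarGlue, dif_pos w.2]
      exact loopsArc_of_mem hw _
  obtain ⟨F, hF, hF'⟩ := ArcSpace.exists_map (L := collarLimit l y)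
    (f₀ := collarHeight) (f₁ := collarHeight)
    (α := fun v => ArcSpace.pt collarHeight collarHeight (collarLimit l y) v)
    (γ := fun w θ => γ₁ w θ 1) ArcSpace.continuous_pt
    (c1.comp (by fun_prop : Continuous fun p : collar l y × unitInterval =>
      (p.1, p.2, (1 : unitInterval)))) (fun w => e0 w 1) (fun w => e1 w 1)
    (fun w hw θ => eL w hw θ 1)
  have hv : ∀ v : unitInterval, ((sqPt (0, (v : ℝ)) : unitSquare) : ℝ × ℝ).2 = v := fun v => by
    simp [sqPt_snd, v.2.1, v.2.2]
  have hpt' : ∀ v : unitInterval, (ArcSpace.pt collarHeight collarHeight (collarLimit l y) v :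
      CollarLoops l y) = loopsPt l y (sqPt (0, (v : ℝ))) := fun v => by
    rw [loopsPt]
    congr 1
    exact Subtype.ext (hv v).symm
  refine (ArcSpace.homotopic_of_family (G := F) (fun v _ => ArcSpace.pt _ _ _ v) γ₁ hpt c1 e0 e1 eL
    ?_ ?_ hF hF').trans (ArcSpace.homotopic_of_family (fun v _ => ArcSpace.pt _ _ _ v) γ₂ hpt c2
      ?_ ?_ ?_ hF ?_ (fun _ => rfl) ?_)
  · intro v
    rw [hpt', ContinuousMap.comp_apply, hΨ, hΦ]
    exact loopsPt_eq (by rw [hv, hv])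
  · intro w θ
    rw [ContinuousMap.comp_apply]
    refine (congrArg Φ (hΨ' w θ)).trans ?_
    simp only [sheetLoop, γ₁]
    split_ifs
    · rw [hΦ, loopsArc_of_le_zero _ (by simp)]
      refine loopsPt_eq ?_
      rw [shifted_val h w (mul_nonneg (bump θ).2.1 w.1.2.1.1)
        (mul_le_one₀ (bump θ).2.2 w.1.2.1.1 w.1.2.1.2) (bump θ).2.1 (bump θ).2.2, collarMove,
        shifted_val h w w.1.2.1.1 w.1.2.1.2 (bump θ).2.1 (bump θ).2.2]
    · exact hΦ' _
  · intro w s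
    simp only [γ₂]
    rw [bump_zero, mul_zero, collarMove_zero, loopsArc_of_le_zero _ (by simp)]
    rfl
  · intro w s
    simp only [γ₂]
    rw [bump_one, mul_zero, collarMove_zero, loopsArc_of_one_le _ (by norm_num)]
    rfl
  · intro w hw θ s
    simp only [γ₂]
    rw [collarMove_of_mem h hw, loopsArc_of_mem hw]
    rfl
  · intro w θ
    rw [hF']
    simp only [γ₁, γ₂]
    have hs : unitInterval.symm 0 * bump θ = bump θ := by simp
    rw [hs]
    split_ifs with hθ
    · rw [min_eq_right (by linarith)]
      congr 1
      simp
    · rw [upperMap_one, loopsArc_of_one_le _ (by simp; linarith)]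
      refine loopsPt_eq ?_
      rw [shifted_val h w (mul_nonneg (bump θ).2.1 w.1.2.1.1)
        (mul_le_one₀ (bump θ).2.2 w.1.2.1.1 w.1.2.1.2) (bump θ).2.1 (bump θ).2.2, collarMove,
        shifted_val h w w.1.2.1.1 w.1.2.1.2 (bump θ).2.1 (bump θ).2.2]
  · intro w θ
    have hs : unitInterval.symm 1 * bump θ = 0 := by simp
    simp only [γ₂]
    rw [hs, collarMove_zero]
    simp [loopsArc]

end Collapse

/-! ### The collapse of the doubled square is a homotopy equivalence -/

section Collapse

variable {l : ℝ → ℝ} {y : ℝ}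

theorem collarGlue_of_zero {V K : Type*} (h : IsBand l y) {γ : collar l y → unitInterval → K → V}
    {μ : unitSquare → K → V} {p : unitSquare} (hp : bandRoof l y p = 0) (k : K) :
    collarGlue γ μ p k = γ ⟨p, mem_collar_of_zero h hp⟩ 0 k := by
  rw [collarGlue, dif_pos (mem_collar_of_zero h hp), collarFraction_of_zero hp]

/-- The composition sends a point `w` of the upper sheet over the collar to a point of the loop
through `w`, on either sheet, and all other points to the side `x = 0`. A homotopy to the identity
moves the points back, first horizontally and then vertically. -/
theorem expand_comp_collapse (h : IsBand l y)
    {Φ : C(doubleSquare (bandRoof l y), CollarLoops l y)}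
    {Ψ : C(CollarLoops l y, doubleSquare (bandRoof l y))}
    (hΦ : ∀ p, Φ (doubleSquare.flat _ p) = loopsPt l y p)
    (hΦ' : ∀ p, Φ (doubleSquare.top _ p) = upperMap p 0)
    (hΨ : ∀ p, Ψ (loopsPt l y p) = doubleSquare.flat _ (sqPt (0, p.1.2)))
    (hΨ' : ∀ w, ∀ θ : unitInterval, Ψ (loopsArc w θ) = sheetLoop w θ) :
    (Ψ.comp Φ).Homotopic (ContinuousMap.id _) := by
  have hG := h.isStripFunction.1
  have hb := continuous_bump
  have hsq : ∀ w : collar l y, sqPt (w.1.1.1, w.1.1.2) = w := fun w => sqPt_coe _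
  -- the horizontal positions are restored
  let γ₁ : collar l y → unitInterval → unitInterval → doubleSquare (bandRoof l y) := fun w θ s =>
    if (θ : ℝ) ≤ 1 / 2 then doubleSquare.flat _
      (shifted w (w.1.1.1 * (s + bump θ * (1 - s))) (bump θ))
    else doubleSquare.top _ (shifted w (w.1.1.1 * (s + bump θ * (1 - s))) (bump θ))
  let μ₁ : unitSquare → unitInterval → doubleSquare (bandRoof l y) := fun p s =>
    doubleSquare.top _ (sqPt (p.1.1 * s, p.1.2))
  let α₁ : unitSquare → unitInterval → doubleSquare (bandRoof l y) := fun p s =>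
    doubleSquare.flat _ (sqPt (p.1.1 * s, p.1.2))
  -- the part in the flat sheet is pushed into the complement of the strip
  let γ₂ : collar l y → unitInterval → unitInterval → doubleSquare (bandRoof l y) := fun w θ s =>
    if (θ : ℝ) ≤ 1 / 2 then doubleSquare.flat _ (shifted w w.1.1.1 ((1 - s) * bump θ + s))
    else doubleSquare.top _ (shifted w w.1.1.1 (bump θ))
  -- the heights are restored in the upper sheet
  let γ₃ : collar l y → unitInterval → unitInterval → doubleSquare (bandRoof l y) := fun w θ s =>
    doubleSquare.top _ (shifted w w.1.1.1 ((1 - s) * min 1 (2 - 2 * (θ : ℝ))))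
  let μ₂ : unitSquare → unitInterval → doubleSquare (bandRoof l y) := fun p _ =>
    doubleSquare.top _ p
  let α₂ : unitSquare → unitInterval → doubleSquare (bandRoof l y) := fun p _ =>
    doubleSquare.flat _ p
  have hx : Continuous fun p : collar l y × unitInterval × unitInterval => p.1.1.1.1 := by fun_prop
  have c1 : Continuous fun p : collar l y × unitInterval × unitInterval =>
      γ₁ p.1 p.2.1 p.2.2 := by
    have hs : Continuous fun p : collar l y × unitInterval × unitInterval =>
        shifted p.1 (p.1.1.1.1 * (p.2.2 + bump p.2.1 * (1 - p.2.2))) (bump p.2.1) :=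
      continuous_shifted h continuous_fst (by fun_prop) (by fun_prop)
    refine Continuous.if_le (doubleSquare.continuous_flat.comp hs)
      ((doubleSquare.continuous_top hG).comp hs) (by fun_prop) continuous_const ?_
    intro p hp
    have e : (p.2.2 : ℝ) + 1 * (1 - p.2.2) = 1 := by ring
    simp only [bump_of_eq_half hp, Icc.coe_one, e, mul_one]
    exact flat_eq_top_shifted h p.1
  have c2 : Continuous fun p : collar l y × unitInterval × unitInterval =>
      γ₂ p.1 p.2.1 p.2.2 := by
    refine Continuous.if_le (doubleSquare.continuous_flat.comp
      (continuous_shifted h continuous_fst hx (by fun_prop)))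
      ((doubleSquare.continuous_top hG).comp (continuous_shifted h continuous_fst hx
        (by fun_prop))) (by fun_prop) continuous_const ?_
    intro p hp
    have e : (1 - (p.2.2 : ℝ)) * 1 + p.2.2 = 1 := by ring
    simp only [bump_of_eq_half hp, Icc.coe_one, e]
    exact flat_eq_top_shifted h p.1
  have c3 : Continuous fun p : collar l y × unitInterval × unitInterval =>
      γ₃ p.1 p.2.1 p.2.2 :=
    (doubleSquare.continuous_top hG).comp (continuous_shifted h continuous_fst hx (by fun_prop))
  have m1 : Continuous fun p : unitSquare × unitInterval => μ₁ p.1 p.2 :=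
    (doubleSquare.continuous_top hG).comp (continuous_sqPt.comp (by fun_prop))
  have m2 : Continuous fun p : unitSquare × unitInterval => μ₂ p.1 p.2 :=
    (doubleSquare.continuous_top hG).comp continuous_fst
  have a1 : Continuous fun p : unitSquare × unitInterval => α₁ p.1 p.2 :=
    doubleSquare.continuous_flat.comp (continuous_sqPt.comp (by fun_prop))
  have a2 : Continuous fun p : unitSquare × unitInterval => α₂ p.1 p.2 :=
    doubleSquare.continuous_flat.comp continuous_fst
  have hleft : ∀ w ∈ collarLimit l y, ∀ b : ℝ, shifted w w.1.1.1 b = w := fun w hw b => by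
    rw [shifted_of_mem h hw, hsq]
  have hleft' : ∀ w ∈ collarLimit l y, doubleSquare.flat (bandRoof l y) w.1 =
      doubleSquare.top (bandRoof l y) w.1 :=
    fun w hw => by
      have h0 : w.1.1.1 = 0 := hw
      have := flat_eq_top_left h w.1.1.2
      rwa [← h0, hsq] at this
  have L1 : ∀ w ∈ collarLimit l y, ∀ θ s, γ₁ w θ s = doubleSquare.top (bandRoof l y) w.1 := by
    intro w hw θ s
    have h0 : w.1.1.1 = 0 := hw
    have e : ∀ a b : ℝ, shifted w (w.1.1.1 * a) b = w := fun a b => by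
      have := hleft w hw b
      rw [h0] at this ⊢
      rwa [zero_mul]
    simp only [γ₁, e, hleft' w hw, ite_self]
  have L2 : ∀ w ∈ collarLimit l y, ∀ θ s, γ₂ w θ s = doubleSquare.top (bandRoof l y) w.1 := by
    intro w hw θ s
    simp only [γ₂, hleft w hw, hleft' w hw, ite_self]
  have L3 : ∀ w ∈ collarLimit l y, ∀ θ s, γ₃ w θ s = doubleSquare.top (bandRoof l y) w.1 := by
    intro w hw θ s
    simp only [γ₃, hleft w hw]
  have b1 := continuous_collarGlue h c1 (fun w hw θ s => by rw [L1 w hw, L1 w hw]) m1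
    (fun w s => by
      simp only [γ₁, μ₁]
      rw [if_neg (by norm_num), bump_one]
      simp [shifted])
  have b2 := continuous_collarGlue h c2 (fun w hw θ s => by rw [L2 w hw, L2 w hw]) m2
    (fun w s => by
      simp only [γ₂, μ₂]
      rw [if_neg (by norm_num), bump_one, Icc.coe_zero, shifted_zero])
  have b3 := continuous_collarGlue h c3 (fun w hw θ s => by rw [L3 w hw, L3 w hw]) m2
    (fun w s => by
      simp only [γ₃, μ₂]
      rw [Icc.coe_one, show (2 : ℝ) - 2 * 1 = 0 by norm_num, min_eq_right zero_le_one, mul_zero,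
        shifted_zero])
  have hz : ∀ (p : unitSquare) (hp : bandRoof l y p = 0) (b : ℝ),
      shifted ⟨p, mem_collar_of_zero h hp⟩ p.1.1 b = p := by
    intro p hp b
    rw [shifted, collarShift_of_zero h hp, mul_zero, sub_zero]
    exact sqPt_coe p
  have z1 : ∀ (p : unitSquare) s, bandRoof l y p = 0 → α₁ p s = collarGlue γ₁ μ₁ p s := by
    intro p s hp
    rw [collarGlue_of_zero h hp]
    simp only [γ₁, α₁]
    rw [if_pos (by simp), bump_zero]
    simp [shifted]
  have z2 : ∀ (p : unitSquare) s, bandRoof l y p = 0 → α₂ p s = collarGlue γ₂ μ₂ p s := by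
    intro p s hp
    rw [collarGlue_of_zero h hp]
    simp only [γ₂, α₂]
    rw [if_pos (by simp), hz p hp]
  have z3 : ∀ (p : unitSquare) s, bandRoof l y p = 0 → α₂ p s = collarGlue γ₃ μ₂ p s := by
    intro p s hp
    rw [collarGlue_of_zero h hp]
    simp only [γ₃, α₂]
    rw [hz p hp]
    exact doubleSquare.flat_eq_top hp
  have at1 : Continuous fun p : unitSquare => (p, (1 : unitInterval)) := by fun_prop
  obtain ⟨F₁, f1, f1'⟩ := doubleSquare.exists_map hG (α := fun p => α₁ p 1)
    (β := fun p => collarGlue γ₁ μ₁ p 1) (a1.comp at1) (b1.comp at1) fun p hp => z1 p 1 hp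
  obtain ⟨F₂, f2, f2'⟩ := doubleSquare.exists_map hG (α := fun p => α₂ p 1)
    (β := fun p => collarGlue γ₂ μ₂ p 1) (a2.comp at1) (b2.comp at1) fun p hp => z2 p 1 hp
  have hα : ∀ p, α₁ p 1 = α₂ p 0 := fun p => by simp [α₁, α₂]
  refine ((doubleSquare.homotopic_of_family hG (F' := F₁) α₁ (collarGlue γ₁ μ₁) a1 b1 z1
    ?_ ?_ f1 f1').trans (doubleSquare.homotopic_of_family hG (F' := F₂) α₂ (collarGlue γ₂ μ₂) a2 b2
      z2 (fun p => (f1 p).trans (hα p)) ?_ f2 f2')).trans (doubleSquare.homotopic_of_family hG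
        α₂ (collarGlue γ₃ μ₂) a2 b3 z3 f2 ?_ (fun _ => rfl) ?_)
  · intro p
    rw [ContinuousMap.comp_apply, hΦ, hΨ]
    simp [α₁]
  · intro p
    rw [ContinuousMap.comp_apply, hΦ', upperMap, collarGlue, collarGlue]
    split_ifs with hp
    · rw [Icc.coe_zero, max_eq_right (collarFraction l y p).2.1, hΨ', sheetLoop]
      simp only [γ₁, Icc.coe_zero, sub_zero, mul_one, zero_add, mul_comm]
    · rw [hΨ, flat_eq_top_left h]
      simp [μ₁]
  · intro p
    rw [f1', collarGlue, collarGlue]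
    split_ifs with hp
    · simp only [γ₁, γ₂, Icc.coe_zero, Icc.coe_one, sub_zero, sub_self, mul_zero, add_zero,
        mul_one, one_mul]
    · simp [μ₁, μ₂]
  · intro p
    rw [f2', collarGlue, collarGlue]
    split_ifs with hp
    · simp only [γ₂, γ₃, Icc.coe_zero, Icc.coe_one, sub_zero, sub_self, zero_mul, zero_add,
        one_mul]
      split_ifs with hθ
      · rw [min_eq_left (by linarith), flat_eq_top_shifted h]
      · push Not at hθ
        rw [min_eq_right (by linarith), bump_of_half_lt hθ]
    · rfl
  · intro p
    rw [ContinuousMap.id_apply, collarGlue]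
    split_ifs with hp
    · simp only [γ₃, Icc.coe_one, sub_self, zero_mul]
      exact congrArg _ (shifted_zero ⟨p, hp⟩).symm
    · rfl

/-- The doubled square of a strip of constant width is homotopy equivalent to a segment with a loop
attached for each point of the collar of the strip. -/
theorem nonempty_homotopyEquiv_collarLoops (h : IsBand l y) :
    Nonempty (doubleSquare (bandRoof l y) ≃ₕ CollarLoops l y) := by
  obtain ⟨Φ, h1, h2⟩ := exists_collapse h
  obtain ⟨Ψ, h3, h4⟩ := exists_expand h
  exact ⟨⟨Φ, Ψ, expand_comp_collapse h h1 h2 h3 h4, collapse_comp_expand h h1 h2 h3 h4⟩⟩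

end Collapse

/-! ### The strip of constant width between the fingers of the complement -/

theorem isBand_wave {y : ℝ} (hy : 0 < y) (hy1 : y ≤ 1) : IsBand (fun x => (1 - y) * wave x) y where
  pos := hy
  continuousOn := continuousOn_const.mul continuousOn_wave
  bounds := fun x hx => by
    have h0 := wave_nonneg hx.1 hx.2
    have h1 := wave_le_one hx.1 hx.2
    exact ⟨mul_nonneg (by linarith) h0, by nlinarith⟩

theorem nonempty_homotopyEquiv_band {y ε : ℝ} (hy : 0 < y) (hε : 0 ≤ ε) (hle : y + ε ≤ 1) :
    Nonempty (doubleSquare (roof y ε) ≃ₕ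
      doubleSquare (bandRoof (fun x => (1 - y) * wave x) y)) := by
  have hB := isBand_wave hy (by linarith)
  refine nonempty_homotopyEquiv_of_strips (C := ε + ε / y)
    (isStripFunction_roof hy.le hε (by linarith)) hB.isStripFunction continuousOn_lowerEdge
    (continuousOn_lowerEdge.add (by fun_prop)) hB.continuousOn
    (hB.continuousOn.add continuousOn_const)
    (lowerEdge_bounds hy.le hε (by linarith) hle)
    (fun x hx => ⟨(hB.bounds x hx).1, by linarith, (hB.bounds x hx).2⟩) ?_ ?_ ?_
  · intro x hx
    have h1 := abs_lowerEdge_sub_le (y := y) hε hx.1 hx.2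
    have := mul_nonneg (div_nonneg hε hy.le) hx.1.le
    linarith
  · intro x hx
    have hx0 := hx.1
    have h2 : 0 < y + ε * x := by positivity
    have e : y / (y + ε * x) - 1 = -(ε * x / (y + ε * x)) := by
      field_simp
      ring
    rw [add_sub_cancel_left, add_sub_cancel_left, e, abs_neg, abs_of_nonneg (by positivity)]
    have h3 : ε * x / (y + ε * x) ≤ ε * x / y :=
      div_le_div_of_nonneg_left (by positivity) hy (le_add_of_nonneg_right (by positivity))
    have h4 : ε * x / y = ε / y * x := by ring
    have h5 : 0 ≤ ε * x := by positivity
    linarith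
  · intro x hx
    have hx0 := hx.1
    have e : (y + ε * x) / y - 1 = ε / y * x := by
      field_simp
      ring
    rw [add_sub_cancel_left, add_sub_cancel_left, e, abs_of_nonneg (by positivity)]
    have h5 : 0 ≤ ε * x := by positivity
    linarith

theorem interp_node (a : ℕ → ℝ) {k : ℕ} (hk : 1 ≤ k) : interp a (1 / (k : ℝ)) = a k := by
  have hk' : (0 : ℝ) < k := by exact_mod_cast hk
  rw [interp_eq a hk (one_div_le_one_div_of_le hk' (by linarith)) le_rfl,
    mul_one_div_cancel hk'.ne']
  ring

theorem wave_node_even {k : ℕ} (hk : 1 ≤ k) (h : Even k) : wave (1 / (k : ℝ)) = 1 := by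
  rw [wave, interp_node _ hk, if_pos h]

theorem wave_node_odd {k : ℕ} (hk : 1 ≤ k) (h : Odd k) : wave (1 / (k : ℝ)) = 0 := by
  rw [wave, interp_node _ hk, if_neg (Nat.not_even_iff_odd.2 h)]

/-- The interval between two successive nodes. -/
def slab (k : ℕ) : Set ℝ := Icc (1 / ((k : ℝ) + 1)) (1 / (k : ℝ))

theorem slab_subset {k : ℕ} (hk : 1 ≤ k) : slab k ⊆ Ioc 0 1 := by
  intro x hx
  have hk' : (1 : ℝ) ≤ k := by exact_mod_cast hk
  exact ⟨lt_of_lt_of_le (by positivity) hx.1, hx.2.trans ((div_le_one (by linarith)).2 hk')⟩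

theorem floor_slab {x : ℝ} (hx : x ∈ Ioc (0 : ℝ) 1) : 1 ≤ ⌊1 / x⌋₊ ∧ x ∈ slab ⌊1 / x⌋₊ := by
  obtain ⟨hx0, hx1⟩ := hx
  have h1 : 1 ≤ 1 / x := (one_le_div hx0).2 hx1
  have hk : 1 ≤ ⌊1 / x⌋₊ := (Nat.one_le_floor_iff _).2 h1
  have hk' : (0 : ℝ) < ⌊1 / x⌋₊ := by exact_mod_cast hk
  have h2 := Nat.lt_floor_add_one (1 / x)
  have h3 := Nat.floor_le (a := 1 / x) (by positivity)
  rw [div_lt_iff₀ hx0] at h2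
  rw [le_div_iff₀ hx0] at h3
  refine ⟨hk, ?_, ?_⟩
  · rw [div_le_iff₀ (by positivity)]
    linarith
  · rw [le_div_iff₀ hk']
    linarith

theorem node_mem_slab {k e : ℕ} (hk : 1 ≤ k) (he : e = k ∨ e = k + 1) : 1 / (e : ℝ) ∈ slab k := by
  have hk' : (0 : ℝ) < k := by exact_mod_cast hk
  have h : 1 / ((k : ℝ) + 1) ≤ 1 / k := one_div_le_one_div_of_le hk' (by linarith)
  rcases he with rfl | rfl
  · exact ⟨h, le_rfl⟩
  · push_cast
    exact ⟨le_rfl, h⟩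

theorem wave_combination {k : ℕ} (hk : 1 ≤ k) {x x' : ℝ} (hx : x ∈ slab k) (hx' : x' ∈ slab k)
    {c : ℝ} (h0 : 0 ≤ c) (h1 : c ≤ 1) :
    wave ((1 - c) * x' + c * x) = (1 - c) * wave x' + c * wave x := by
  have hm : (1 - c) * x' + c * x ∈ slab k :=
    (convex_Icc _ _) hx' hx (by linarith) h0 (by ring)
  rw [wave, interp_eq _ hk hx.1 hx.2, interp_eq _ hk hx'.1 hx'.2, interp_eq _ hk hm.1 hm.2]
  ring

theorem abs_sub_node_le {k e : ℕ} (hk : 1 ≤ k) (he : e = k ∨ e = k + 1) {x : ℝ} (hx : x ∈ slab k) :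
    |1 / (e : ℝ) - x| ≤ |wave (1 / (e : ℝ)) - wave x| := by
  have hk' : (1 : ℝ) ≤ k := by exact_mod_cast hk
  obtain ⟨h0, h1⟩ := slab_coord_mem hk hx.1 hx.2
  set c := ((k : ℝ) + 1) * (1 - k * x) with hc
  have hw : wave x = (if Even k then 1 else 0) + c * ((if Even (k + 1) then 1 else 0) -
      (if Even k then 1 else 0)) := by
    rw [wave, interp_eq _ hk hx.1 hx.2]
  have hkk : (1 : ℝ) ≤ k * (k + 1) := by nlinarith
  have hxc : x = 1 / k - c / (k * (k + 1)) := by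
    rw [hc]
    field_simp
    ring
  have hc1 : c / (k * (k + 1)) ≤ c := div_le_self h0 hkk
  have hc2 : (1 - c) / (k * (k + 1)) ≤ 1 - c := div_le_self (by linarith) hkk
  have hc3 : 0 ≤ c / (k * (k + 1)) := by positivity
  have hc4 : 0 ≤ (1 - c) / (k * (k + 1)) := div_nonneg (by linarith) (by positivity)
  have hnode : ∀ e : ℕ, 1 ≤ e → wave (1 / (e : ℝ)) = if Even e then 1 else 0 := fun e he => by
    rw [wave, interp_node _ he]
  rcases he with rfl | rfl
  · have e1 : |1 / (e : ℝ) - x| = c / (e * (e + 1)) := by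
      rw [hxc, sub_sub_cancel, abs_of_nonneg hc3]
    rw [e1, hnode e hk, hw]
    refine hc1.trans ?_
    by_cases h : Even e
    · rw [if_pos h, if_neg (by simpa [parity_simps] using h)]
      exact (le_abs_self c).trans_eq (by congr 1; ring)
    · rw [if_neg h, if_pos (by simpa [parity_simps] using h)]
      exact (le_abs_self c).trans_eq (by rw [← abs_neg]; congr 1; ring)
  · have e1 : |1 / ((k + 1 : ℕ) : ℝ) - x| = (1 - c) / (k * (k + 1)) := by
      rw [← abs_of_nonneg hc4, ← abs_neg, hxc]
      congr 1
      push_cast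
      field_simp
      ring
    rw [e1, hnode _ (by omega), hw]
    refine hc2.trans ?_
    by_cases h : Even k
    · rw [if_pos h, if_neg (by simpa [parity_simps] using h)]
      exact (le_abs_self (1 - c)).trans_eq (by rw [← abs_neg]; congr 1; ring)
    · rw [if_neg h, if_pos (by simpa [parity_simps] using h)]
      exact (le_abs_self (1 - c)).trans_eq (by congr 1; ring)

/-- The upper boundary of the collar of a lower finger rises towards the tip of the finger. -/
theorem le_towards_even_node {y : ℝ} (hy : 0 < y) (hy2 : y ≤ 1 / 2) {k e : ℕ} (hk : 1 ≤ k)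
    (he : e = k ∨ e = k + 1) (hev : Even e) {x : ℝ} (hx : x ∈ slab k) {c : ℝ} (h0 : 0 ≤ c)
    (h1 : c ≤ 1) : (1 - y) * wave x + y * x / 8 ≤
      (1 - y) * wave ((1 - c) * (1 / (e : ℝ)) + c * x) +
        y * ((1 - c) * (1 / (e : ℝ)) + c * x) / 8 := by
  have h2 := abs_sub_node_le hk he hx
  have hx1 := slab_subset hk hx
  have h3 := wave_le_one hx1.1 hx1.2
  rw [wave_combination hk hx (node_mem_slab hk he) h0 h1]
  rw [wave_node_even (by omega) hev, abs_of_nonneg (sub_nonneg.2 h3)] at h2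
  rw [wave_node_even (by omega) hev]
  have h4 := (abs_le.1 h2).1
  have h5 : 0 ≤ (1 - c) * ((1 - y) * (1 - wave x) + y * (1 / (e : ℝ) - x) / 8) := by
    refine mul_nonneg (by linarith) ?_
    nlinarith
  linarith

/-- The lower boundary of the collar of an upper finger falls towards the tip of the finger. -/
theorem towards_odd_node_le {y : ℝ} (hy : 0 < y) (hy2 : y ≤ 1 / 2) {k e : ℕ} (hk : 1 ≤ k)
    (he : e = k ∨ e = k + 1) (hodd : Odd e) {x : ℝ} (hx : x ∈ slab k) {c : ℝ} (h0 : 0 ≤ c)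
    (h1 : c ≤ 1) : (1 - y) * wave ((1 - c) * (1 / (e : ℝ)) + c * x) -
        y * ((1 - c) * (1 / (e : ℝ)) + c * x) / 8 ≤ (1 - y) * wave x - y * x / 8 := by
  have h2 := abs_sub_node_le hk he hx
  have hx1 := slab_subset hk hx
  have h3 := wave_nonneg hx1.1 hx1.2
  rw [wave_combination hk hx (node_mem_slab hk he) h0 h1]
  rw [wave_node_odd (by omega) hodd, zero_sub, abs_neg, abs_of_nonneg h3] at h2
  rw [wave_node_odd (by omega) hodd]
  have h4 := (abs_le.1 h2).1
  have h5 : 0 ≤ (1 - c) * ((1 - y) * wave x + y * (1 / (e : ℝ) - x) / 8) := by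
    refine mul_nonneg (by linarith) ?_
    nlinarith
  linarith

/-! ### The fingers and the leaves of the fan -/

/-- The function that falls from `1` on `(-∞, y / 2]` to `0` on `[3 y / 4, ∞)`. -/
noncomputable def ramp (y v : ℝ) : ℝ := max 0 (min 1 (3 - 4 * v / y))

/-- The map of the heights to `[-1, 1]`, constant on both ends and on a middle interval. -/
noncomputable def level (y v : ℝ) : ℝ := ramp y (1 - v) - ramp y v

theorem ramp_nonneg (y v : ℝ) : 0 ≤ ramp y v := le_max_left _ _

theorem ramp_le_one (y v : ℝ) : ramp y v ≤ 1 := max_le zero_le_one (min_le_left _ _)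

theorem ramp_eq_one {y v : ℝ} (hy : 0 < y) (h : v ≤ y / 2) : ramp y v = 1 := by
  have : 1 ≤ 3 - 4 * v / y := by
    have : 4 * v / y ≤ 2 := by rw [div_le_iff₀ hy]; linarith
    linarith
  rw [ramp, min_eq_left this, max_eq_right zero_le_one]

theorem ramp_eq_zero {y v : ℝ} (hy : 0 < y) (h : 3 * y / 4 ≤ v) : ramp y v = 0 := by
  have : 3 - 4 * v / y ≤ 0 := by
    have : 3 ≤ 4 * v / y := by rw [le_div_iff₀ hy]; linarith
    linarith
  rw [ramp, min_eq_right (by linarith), max_eq_left this]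

theorem continuous_level (y : ℝ) : Continuous (level y) := by
  unfold level ramp
  fun_prop

theorem abs_level_le (y v : ℝ) : |level y v| ≤ 1 :=
  abs_le.2 ⟨by rw [level]; linarith [ramp_nonneg y (1 - v), ramp_le_one y v],
    by rw [level]; linarith [ramp_nonneg y v, ramp_le_one y (1 - v)]⟩

theorem level_low {y v : ℝ} (hy : 0 < y) (h : v ≤ 1 - 3 * y / 4) : level y v = -ramp y v := by
  rw [level, ramp_eq_zero hy (by linarith), zero_sub]

theorem level_high {y v : ℝ} (hy : 0 < y) (h : 3 * y / 4 ≤ v) : level y v = ramp y (1 - v) := by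
  rw [level, ramp_eq_zero hy h, sub_zero]

theorem abs_level_eq_one {y v : ℝ} (hy : 0 < y) (hy2 : y ≤ 1 / 2)
    (h : v ≤ y / 2 ∨ 1 - y / 2 ≤ v) : |level y v| = 1 := by
  rcases h with h | h
  · rw [level_low hy (by linarith), ramp_eq_one hy h, abs_neg, abs_one]
  · rw [level_high hy (by linarith), ramp_eq_one hy (by linarith), abs_one]

/-- The first coordinate of the tip of the finger that corresponds to the slope `τ`: it is
`1 / (2n)` for `τ = -1 / n` and `1 / (2n - 1)` for `τ = 1 / n`. -/
noncomputable def tipPos (τ : ℝ) : ℝ := |τ| / (2 - max 0 (min 1 τ))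

theorem one_le_tipPos_denominator (τ : ℝ) : 1 ≤ 2 - max 0 (min 1 τ) := by
  have : max 0 (min 1 τ) ≤ 1 := max_le zero_le_one (min_le_left _ _)
  linarith

theorem continuous_tipPos : Continuous tipPos := by
  refine Continuous.div (by fun_prop) (by fun_prop) fun τ => ?_
  have := one_le_tipPos_denominator τ
  linarith

theorem tipPos_nonneg (τ : ℝ) : 0 ≤ tipPos τ :=
  div_nonneg (abs_nonneg _) (by linarith [one_le_tipPos_denominator τ])

theorem tipPos_le (τ : ℝ) : tipPos τ ≤ |τ| :=
  div_le_self (abs_nonneg _) (one_le_tipPos_denominator τ)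

theorem tipPos_zero : tipPos 0 = 0 := by simp [tipPos]

theorem tipPos_neg {n : ℕ} (hn : 1 ≤ n) : tipPos (-(1 / (n : ℝ))) = 1 / ((2 * n : ℕ) : ℝ) := by
  have hn' : (0 : ℝ) < n := by exact_mod_cast hn
  have : 0 < 1 / (n : ℝ) := by positivity
  rw [tipPos, abs_neg, abs_of_pos this, min_eq_right (by linarith), max_eq_left (by linarith)]
  push_cast
  field_simp
  ring

theorem tipPos_pos {n : ℕ} (hn : 1 ≤ n) :
    tipPos (1 / (n : ℝ)) = 1 / ((2 * n - 1 : ℕ) : ℝ) := by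
  have hn' : (1 : ℝ) ≤ n := by exact_mod_cast hn
  have h0 : 0 < 1 / (n : ℝ) := by positivity
  have h1 : 1 / (n : ℝ) ≤ 1 := (div_le_one (by linarith)).2 hn'
  have hc : ((2 * n - 1 : ℕ) : ℝ) = 2 * n - 1 := by
    rw [Nat.cast_sub (by omega)]
    push_cast
    ring
  have h2 : (2 : ℝ) - 1 / n ≠ 0 := by linarith
  have h3 : (2 : ℝ) * n - 1 ≠ 0 := by linarith
  rw [tipPos, abs_of_pos h0, min_eq_right h1, max_eq_right h0.le, hc, div_eq_div_iff h2 h3]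
  field_simp

/-- The lower boundary of a strip of width `y` which oscillates between the bottom and the top of
the square. -/
noncomputable abbrev bandEdge (y x : ℝ) : ℝ := (1 - y) * wave x

/-- The slope of a point of the collar. Away from the side `x = 0` the collar consists, up to its
width, of the points below the strip, which form fingers that rise from the bottom to tips over
`1 / (2n)`, and of the points above the strip, which form fingers that hang from the top, with tips
over `1 / (2n - 1)`. The slope is `-1 / n` on the former and `1 / n` on the latter. -/
noncomputable def fingerSlope {y : ℝ} (w : collar (bandEdge y) y) : ℝ :=
  if w.1.1.1 = 0 then 0
  else if w.1.1.2 ≤ bandEdge y w.1.1.1 + y / 2 then -(1 / (((⌊1 / w.1.1.1⌋₊ + 1) / 2 : ℕ) : ℝ))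
  else 1 / ((⌊1 / w.1.1.1⌋₊ / 2 + 1 : ℕ) : ℝ)

section Fan

variable {y : ℝ}

theorem fingerSlope_of_mem {w : collar (bandEdge y) y} (hw : w ∈ collarLimit (bandEdge y) y) :
    fingerSlope w = 0 := if_pos hw

theorem collar_cases (hy : 0 < y) (hy2 : y ≤ 1 / 2) {w : collar (bandEdge y) y}
    (hw : w ∉ collarLimit (bandEdge y) y) :
    (w.1.1.2 ≤ bandEdge y w.1.1.1 + y * w.1.1.1 / 8 ∧
      w.1.1.2 ≤ bandEdge y w.1.1.1 + y / 2 ∧ w.1.1.2 ≤ 1 - 3 * y / 4) ∨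
    (bandEdge y w.1.1.1 + y - y * w.1.1.1 / 8 ≤ w.1.1.2 ∧
      ¬ w.1.1.2 ≤ bandEdge y w.1.1.1 + y / 2 ∧ 3 * y / 4 ≤ w.1.1.2) := by
  have hB := isBand_wave hy (by linarith : y ≤ 1)
  have hx1 := w.1.2.1.2
  have hd : y * w.1.1.1 ≤ y := mul_le_of_le_one_right hy.le hx1
  obtain ⟨h0, h1⟩ := hB.bounds w.1.1.1 ⟨lt_of_le_of_ne w.1.2.1.1 (Ne.symm hw), hx1⟩
  have e : bandEdge y w.1.1.1 = (1 - y) * wave w.1.1.1 := rfl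
  rcases ((mem_collar_iff hB).1 w.2).resolve_left hw with h | h
  · exact Or.inl ⟨h, by linarith, by linarith⟩
  · exact Or.inr ⟨h, by linarith, by linarith⟩

/-- The position of a point of the collar off the limit: it lies on a lower finger or on an upper
finger, and the finger contains the points between it and the vertical line through the tip. -/
theorem finger_cases (hy : 0 < y) (hy2 : y ≤ 1 / 2) {w : collar (bandEdge y) y}
    (hw : w ∉ collarLimit (bandEdge y) y) :
    (fingerSlope w < 0 ∧ bandEdge y (tipPos (fingerSlope w)) = 1 - y ∧
      level y w.1.1.2 = -ramp y w.1.1.2 ∧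
      ∀ c, 0 ≤ c → c ≤ 1 → w.1.1.2 ≤ bandEdge y ((1 - c) * tipPos (fingerSlope w) + c * w.1.1.1) +
        y * ((1 - c) * tipPos (fingerSlope w) + c * w.1.1.1) / 8) ∨
    (0 < fingerSlope w ∧ bandEdge y (tipPos (fingerSlope w)) = 0 ∧
      level y w.1.1.2 = ramp y (1 - w.1.1.2) ∧
      ∀ c, 0 ≤ c → c ≤ 1 → bandEdge y ((1 - c) * tipPos (fingerSlope w) + c * w.1.1.1) + y -
        y * ((1 - c) * tipPos (fingerSlope w) + c * w.1.1.1) / 8 ≤ w.1.1.2) := by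
  have hx : w.1.1.1 ∈ Ioc (0 : ℝ) 1 := ⟨lt_of_le_of_ne w.1.2.1.1 (Ne.symm hw), w.1.2.1.2⟩
  obtain ⟨hk, hs⟩ := floor_slab hx
  have hne : w.1.1.1 ≠ 0 := hw
  rcases collar_cases hy hy2 hw with ⟨h1, h2, h3⟩ | ⟨h1, h2, h3⟩
  · have hn : 1 ≤ (⌊1 / w.1.1.1⌋₊ + 1) / 2 := by omega
    have hsl : fingerSlope w = -(1 / (((⌊1 / w.1.1.1⌋₊ + 1) / 2 : ℕ) : ℝ)) := by
      rw [fingerSlope, if_neg hne, if_pos h2]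
    have hn' : (0 : ℝ) < ((⌊1 / w.1.1.1⌋₊ + 1) / 2 : ℕ) := by exact_mod_cast hn
    refine Or.inl ⟨?_, ?_, level_low hy h3, ?_⟩
    · rw [hsl]
      exact neg_neg_of_pos (by positivity)
    · rw [hsl, tipPos_neg hn, bandEdge, wave_node_even (by omega) (even_two_mul _), mul_one]
    · intro c h0 h1'
      rw [hsl, tipPos_neg hn]
      exact h1.trans (le_towards_even_node hy hy2 hk (by omega) (even_two_mul _) hs h0 h1')
  · have hsl : fingerSlope w = 1 / ((⌊1 / w.1.1.1⌋₊ / 2 + 1 : ℕ) : ℝ) := by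
      rw [fingerSlope, if_neg hne, if_neg h2]
    have hodd : Odd (2 * (⌊1 / w.1.1.1⌋₊ / 2 + 1) - 1) :=
      ⟨⌊1 / w.1.1.1⌋₊ / 2, by omega⟩
    refine Or.inr ⟨?_, ?_, level_high hy h3, ?_⟩
    · rw [hsl]
      positivity
    · rw [hsl, tipPos_pos (by omega), bandEdge, wave_node_odd (by omega) hodd, mul_zero]
    · intro c h0 h1'
      rw [hsl, tipPos_pos (by omega)]
      have := towards_odd_node_le hy hy2 hk (by omega) hodd hs h0 h1'
      exact le_trans (by rw [bandEdge]; linarith) h1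

theorem abs_fingerSlope_le (w : collar (bandEdge y) y) : |fingerSlope w| ≤ 4 * w.1.1.1 := by
  rw [fingerSlope]
  split_ifs with h1 h2
  · rw [h1]
    simp
  all_goals
    obtain ⟨hk, hs⟩ := floor_slab ⟨lt_of_le_of_ne w.1.2.1.1 (Ne.symm h1), w.1.2.1.2⟩
    have hs1 := hs.1
    set k := ⌊1 / w.1.1.1⌋₊
    have hk' : (0 : ℝ) < k := by exact_mod_cast hk
    rw [div_le_iff₀ (by positivity)] at hs1
  · have hn : (k : ℝ) + 1 ≤ 4 * ((k + 1) / 2 : ℕ) := by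
      exact_mod_cast (by omega : k + 1 ≤ 4 * ((k + 1) / 2))
    have hn' : (0 : ℝ) < ((k + 1) / 2 : ℕ) := by linarith
    rw [abs_neg, abs_of_pos (by positivity), div_le_iff₀ hn']
    nlinarith [w.1.2.1.1]
  · have hn : (k : ℝ) + 1 ≤ 4 * (k / 2 + 1 : ℕ) := by
      exact_mod_cast (by omega : k + 1 ≤ 4 * (k / 2 + 1))
    have hn' : (0 : ℝ) < (k / 2 + 1 : ℕ) := by positivity
    rw [abs_of_pos (by positivity), div_le_iff₀ hn']
    nlinarith [w.1.2.1.1]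

/-- The slope of a point of the slab `k`, as read off from that slab, agrees with its slope except
at the ends of the slab over the valleys between the fingers, where the level is `1` or `-1`. -/
theorem mul_fingerSlope_slab (hy : 0 < y) (hy2 : y ≤ 1 / 2) {k : ℕ} (hk : 1 ≤ k) (f : ℝ → ℝ)
    {a : ℝ} {w : collar (bandEdge y) y} (hw : w.1.1.1 ∈ slab k)
    (ha : w.1.1.2 ≤ y / 2 ∨ 1 - y / 2 ≤ w.1.1.2 → a = 0) :
    a * f (fingerSlope w) = a * if w.1.1.2 ≤ bandEdge y w.1.1.1 + y / 2
      then f (-(1 / (((k + 1) / 2 : ℕ) : ℝ))) else f (1 / ((k / 2 + 1 : ℕ) : ℝ)) := by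
  have hx := slab_subset hk hw
  have hne : w.1.1.1 ≠ 0 := hx.1.ne'
  have hk' : (0 : ℝ) < k := by exact_mod_cast hk
  rw [fingerSlope, if_neg hne, ← apply_ite f]
  rcases hw.1.eq_or_lt with h | h
  · have hfl : ⌊1 / w.1.1.1⌋₊ = k + 1 := by
      rw [← h, one_div_one_div]
      exact_mod_cast Nat.floor_natCast (k + 1)
    have hxe : w.1.1.1 = 1 / ((k + 1 : ℕ) : ℝ) := by rw [← h]; push_cast; rfl
    rw [hfl]
    have hd : y * w.1.1.1 ≤ y := mul_le_of_le_one_right hy.le hx.2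
    rcases collar_cases hy hy2 (w := w) hne with ⟨h1, h2, h3⟩ | ⟨h1, h2, h3⟩
    · rw [if_pos h2, if_pos h2]
      rcases Nat.even_or_odd k with hev | hodd
      · rw [ha (Or.inl ?_), zero_mul, zero_mul]
        rw [bandEdge, hxe, wave_node_odd (by omega) hev.add_one, ← hxe] at h1
        linarith
      · obtain ⟨j, rfl⟩ := hodd
        rw [show (2 * j + 1 + 1 + 1) / 2 = (2 * j + 1 + 1) / 2 by omega]
    · rw [if_neg h2, if_neg h2]
      rcases Nat.even_or_odd k with hev | hodd
      · obtain ⟨j, rfl⟩ := hev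
        rw [show (j + j + 1) / 2 = (j + j) / 2 by omega]
      · rw [ha (Or.inr ?_), zero_mul, zero_mul]
        rw [bandEdge, hxe, wave_node_even (by omega) hodd.add_one, ← hxe] at h1
        linarith
  · have hfl : ⌊1 / w.1.1.1⌋₊ = k := by
      have hx2 := hw.2
      rw [Nat.floor_eq_iff (by have := hx.1; positivity)]
      constructor
      · rw [le_div_iff₀ hx.1]
        rw [le_div_iff₀ hk'] at hx2
        linarith
      · rw [div_lt_iff₀ hx.1]
        rw [div_lt_iff₀ (by positivity)] at h
        linarith
    rw [hfl]

/-- A function of the slope becomes continuous on the collar when it is multiplied by a continuous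
function that vanishes at the heights of the valleys between the fingers. -/
theorem continuous_mul_fingerSlope (hy : 0 < y) (hy2 : y ≤ 1 / 2) {a : collar (bandEdge y) y → ℝ}
    (ha : Continuous a) (ha1 : ∀ w, |a w| ≤ 1)
    (ha0 : ∀ w, w.1.1.2 ≤ y / 2 ∨ 1 - y / 2 ≤ w.1.1.2 → a w = 0) {f : ℝ → ℝ}
    (hf : ∀ τ, |f τ| ≤ |τ|) : Continuous fun w => a w * f (fingerSlope w) := by
  refine continuous_of_abs_le (φ := fun w : collar (bandEdge y) y => w.1.1.1) (by fun_prop)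
    (fun w => w.1.2.1.1) (C := 4) ?_ ?_
  · intro w
    rw [abs_mul]
    exact (mul_le_of_le_one_left (abs_nonneg _) (ha1 w)).trans
      ((hf _).trans (abs_fingerSlope_le w))
  · have hslabs := continuousOn_of_slabs (φ := fun w : collar (bandEdge y) y => w.1.1.1)
      (A := univ) (f := fun w => a w * f (fingerSlope w)) (by fun_prop) ?_
    · refine hslabs.mono fun w hw => ⟨trivial, hw, w.1.2.1.2⟩
    intro k hk
    -- on a slab the lower and the upper finger are separated by a continuous function
    have hl : ContinuousOn (fun w : collar (bandEdge y) y => bandEdge y w.1.1.1)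
        (univ ∩ (fun w : collar (bandEdge y) y => w.1.1.1) ⁻¹' slab k) :=
      (isBand_wave hy (by linarith)).continuousOn.comp (by fun_prop)
        fun w hw => slab_subset hk hw.2
    have hv : ContinuousOn (fun w : collar (bandEdge y) y => (a w, w.1.1.2))
        (univ ∩ (fun w : collar (bandEdge y) y => w.1.1.1) ⁻¹' slab k) := by fun_prop
    have hF : Continuous fun q : (ℝ × ℝ) × ℝ => q.1.1 *
        (f (1 / ((k / 2 + 1 : ℕ) : ℝ)) + max 0 (min 1 ((q.2 + y / 2 - q.1.2) * (4 / y))) *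
          (f (-(1 / (((k + 1) / 2 : ℕ) : ℝ))) - f (1 / ((k / 2 + 1 : ℕ) : ℝ)))) := by fun_prop
    refine (hF.comp_continuousOn (hv.prodMk hl)).congr fun w hw => ?_
    have hx := slab_subset hk hw.2
    have hd : y * w.1.1.1 ≤ y := mul_le_of_le_one_right hy.le hx.2
    dsimp only [Function.comp_apply]
    rw [mul_fingerSlope_slab hy hy2 hk f hw.2 (ha0 w)]
    rcases collar_cases hy hy2 (w := w) hx.1.ne' with ⟨h1, h2, h3⟩ | ⟨h1, h2, h3⟩
    · have h4 : 1 ≤ (bandEdge y w.1.1.1 + y / 2 - w.1.1.2) * (4 / y) := by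
        rw [mul_div_assoc', le_div_iff₀ hy]
        linarith
      rw [if_pos h2, min_eq_left h4, max_eq_right zero_le_one]
      ring
    · have h4 : (bandEdge y w.1.1.1 + y / 2 - w.1.1.2) * (4 / y) ≤ 0 :=
        mul_nonpos_of_nonpos_of_nonneg (by linarith) (by positivity)
      rw [if_neg h2, min_eq_right (h4.trans zero_le_one), max_eq_left h4]
      ring

end Fan

/-! ### From the fingers to the fan -/

/-- The slopes `0` and `± 1 / n` of the leaves of the fan. -/
def leafSlopes : Set ℝ := {τ | τ = 0 ∨ ∃ n : ℕ, 1 ≤ n ∧ (τ = -(1 / (n : ℝ)) ∨ τ = 1 / (n : ℝ))}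

/-- The segment from `(τ, 0)` to `(0, 1)` or `(0, -1)`, according to the sign of `τ`; for `τ = 0` it
is the segment from `(0, -1)` to `(0, 1)`. -/
def leaf (τ : ℝ) : Set (ℝ × ℝ) := {p | |p.2| ≤ 1 ∧ p.1 = (1 - |p.2|) * τ ∧ 0 ≤ τ * p.2}

/-- The union of two cones over the sequence `1 / n` with its limit, with common limit line. -/
def fan : Set (ℝ × ℝ) := {p | ∃ τ ∈ leafSlopes, p ∈ leaf τ}

/-- The limit line of the fan. -/
def fanLimit : Set fan := {w | (w : ℝ × ℝ).1 = 0}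

/-- The height of a point of the fan. -/
def fanHeight (w : fan) : Icc (-1 : ℝ) 1 :=
  ⟨(w : ℝ × ℝ).2, by obtain ⟨τ, -, h, -⟩ := w.2; exact abs_le.1 h⟩

/-- The segment `[-1, 1]` with a loop attached at the height of each point of the fan. -/
abbrev FanLoops : Type := ArcSpace fanHeight fanHeight fanLimit

theorem leaf_combination {τ : ℝ} {p q : ℝ × ℝ} (hp : p ∈ leaf τ) (hq : q ∈ leaf τ) {s : ℝ}
    (h0 : 0 ≤ s) (h1 : s ≤ 1) : ((1 - s) * p.1 + s * q.1, (1 - s) * p.2 + s * q.2) ∈ leaf τ := by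
  obtain ⟨hp1, hp2, hp3⟩ := hp
  obtain ⟨hq1, hq2, hq3⟩ := hq
  have h1' : 0 ≤ 1 - s := by linarith
  have habs : |(1 - s) * p.2 + s * q.2| ≤ (1 - s) * |p.2| + s * |q.2| := by
    refine (abs_add_le _ _).trans_eq ?_
    rw [abs_mul, abs_mul, abs_of_nonneg h0, abs_of_nonneg h1']
  refine ⟨habs.trans (by nlinarith), ?_, ?_⟩
  · dsimp only
    have hτ : |(1 - s) * p.2 + s * q.2| * τ = ((1 - s) * |p.2| + s * |q.2|) * τ := by
      rcases lt_trichotomy τ 0 with h | h | h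
      · have hp4 : p.2 ≤ 0 := nonpos_of_mul_nonneg_right hp3 h
        have hq4 : q.2 ≤ 0 := nonpos_of_mul_nonneg_right hq3 h
        rw [abs_of_nonpos hp4, abs_of_nonpos hq4, abs_of_nonpos (by nlinarith)]
        ring
      · simp [h]
      · have hp4 : 0 ≤ p.2 := nonneg_of_mul_nonneg_right hp3 h
        have hq4 : 0 ≤ q.2 := nonneg_of_mul_nonneg_right hq3 h
        rw [abs_of_nonneg hp4, abs_of_nonneg hq4, abs_of_nonneg (by positivity)]
    rw [hp2, hq2]
    linear_combination hτ
  · have := mul_nonneg h1' hp3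
    have := mul_nonneg h0 hq3
    dsimp only
    linarith

section Fan

variable {y : ℝ}

theorem fingerSlope_mem (w : collar (bandEdge y) y) : fingerSlope w ∈ leafSlopes := by
  rw [fingerSlope]
  split_ifs with h1 h2
  · exact Or.inl rfl
  · obtain ⟨hk, -⟩ := floor_slab ⟨lt_of_le_of_ne w.1.2.1.1 (Ne.symm h1), w.1.2.1.2⟩
    exact Or.inr ⟨_, by omega, Or.inl rfl⟩
  · exact Or.inr ⟨_, by omega, Or.inr rfl⟩

/-- The image of a point of the collar in the fan. -/
noncomputable def collarToFanPoint (w : collar (bandEdge y) y) : ℝ × ℝ :=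
  ((1 - |level y w.1.1.2|) * fingerSlope w, level y w.1.1.2)

theorem collarToFanPoint_mem (hy : 0 < y) (hy2 : y ≤ 1 / 2) (w : collar (bandEdge y) y) :
    collarToFanPoint w ∈ leaf (fingerSlope w) := by
  refine ⟨abs_level_le _ _, rfl, ?_⟩
  dsimp only [collarToFanPoint]
  by_cases hw : w ∈ collarLimit (bandEdge y) y
  · rw [fingerSlope_of_mem hw, zero_mul]
  rcases finger_cases hy hy2 hw with ⟨h1, -, h2, -⟩ | ⟨h1, -, h2, -⟩ <;> rw [h2]
  · nlinarith [ramp_nonneg y w.1.1.2]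
  · nlinarith [ramp_nonneg y (1 - w.1.1.2)]

theorem continuous_collarToFanPoint (hy : 0 < y) (hy2 : y ≤ 1 / 2) :
    Continuous (collarToFanPoint : collar (bandEdge y) y → ℝ × ℝ) := by
  have hl := continuous_level y
  refine Continuous.prodMk ?_ (hl.comp (by fun_prop))
  refine continuous_mul_fingerSlope hy hy2 (f := id)
    (a := fun w => 1 - |level y w.1.1.2|) (by fun_prop) ?_ ?_ fun τ => le_rfl
  · intro w
    have := abs_level_le y w.1.1.2
    exact abs_le.2 ⟨by linarith, by linarith [abs_nonneg (level y w.1.1.2)]⟩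
  · intro w hw
    rw [abs_level_eq_one hy hy2 hw, sub_self]

/-- The map of the collar to the fan. -/
noncomputable def collarToFan (hy : 0 < y) (hy2 : y ≤ 1 / 2) : C(collar (bandEdge y) y, fan) where
  toFun w := ⟨collarToFanPoint w, _, fingerSlope_mem w, collarToFanPoint_mem hy hy2 w⟩
  continuous_toFun := Continuous.subtype_mk (continuous_collarToFanPoint hy hy2) _

/-- The heights in the square that belong to the heights in the fan. -/
noncomputable def levelInv (h : ℝ) : unitInterval := projIcc 0 1 zero_le_one (1 / 2 + h)

theorem continuous_levelInv : Continuous levelInv := continuous_projIcc.comp (by fun_prop)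

theorem levelInv_of_le {h : ℝ} (h1 : h ≤ -(1 / 2)) : levelInv h = 0 :=
  projIcc_of_le_left _ (by linarith)

theorem levelInv_of_ge {h : ℝ} (h1 : 1 / 2 ≤ h) : levelInv h = 1 :=
  projIcc_of_right_le _ (by linarith)

theorem levelInv_nonpos {h : ℝ} (h1 : h ≤ 0) : (levelInv h : ℝ) ≤ 1 / 2 := by
  rw [levelInv, coe_projIcc]
  exact max_le (by norm_num) ((min_le_right _ _).trans (by linarith))

theorem levelInv_nonneg {h : ℝ} (h1 : 0 ≤ h) : 1 / 2 ≤ (levelInv h : ℝ) := by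
  rw [levelInv, coe_projIcc]
  exact le_max_of_le_right (le_min (by norm_num) (by linarith))

/-- The image of a point of the fan in the square: the lower and upper halves of the leaves are
mapped to the vertical lines through the tips of the fingers, and the ends of the leaves are
mapped to the horizontal sides. -/
noncomputable def fanPos (p : ℝ × ℝ) : ℝ := tipPos (p.1 / max (1 - |p.2|) (1 / 2))

theorem continuous_fanPos : Continuous fanPos := by
  refine continuous_tipPos.comp (Continuous.div (by fun_prop) (by fun_prop) fun p => ?_)
  have : (1 / 2 : ℝ) ≤ max (1 - |p.2|) (1 / 2) := le_max_right _ _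
  linarith

theorem fanPos_of_leaf {τ : ℝ} {p : ℝ × ℝ} (hp : p ∈ leaf τ) (h : |p.2| ≤ 1 / 2) :
    fanPos p = tipPos τ := by
  rw [fanPos, hp.2.1, max_eq_left (by linarith), mul_div_cancel_left₀ _ (by linarith)]

theorem fanPos_le_one {τ : ℝ} (hτ : τ ∈ leafSlopes) {p : ℝ × ℝ} (hp : p ∈ leaf τ) :
    fanPos p ≤ 1 := by
  have hτ1 : |τ| ≤ 1 := by
    rcases hτ with rfl | ⟨n, hn, rfl | rfl⟩
    · simp
    all_goals
      have hn' : (1 : ℝ) ≤ n := by exact_mod_cast hn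
      have : 1 / (n : ℝ) ≤ 1 := (div_le_one (by linarith)).2 hn'
      have : 0 ≤ 1 / (n : ℝ) := by positivity
      rw [abs_le]
      constructor <;> linarith
  refine (tipPos_le _).trans ?_
  have h2 : (0 : ℝ) < max (1 - |p.2|) (1 / 2) := lt_max_of_lt_right (by norm_num)
  have h3 : 0 ≤ 1 - |p.2| := by linarith [hp.1]
  rw [abs_div, abs_of_pos h2, div_le_one h2, hp.2.1, abs_mul, abs_of_nonneg h3]
  exact (mul_le_of_le_one_right h3 hτ1).trans (le_max_left _ _)

theorem mem_collar_low (hy : 0 < y) (hy2 : y ≤ 1 / 2) {x v : ℝ} (hx0 : 0 ≤ x) (hx1 : x ≤ 1)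
    (hv0 : 0 ≤ v) (hv1 : v ≤ 1) (h : 0 < x → v ≤ bandEdge y x + y * x / 8) :
    sqPt (x, v) ∈ collar (bandEdge y) y := by
  rw [mem_collar_iff (isBand_wave hy (by linarith)), sqPt_val hx0 hx1 hv0 hv1]
  rcases hx0.eq_or_lt with h0 | h0
  · exact Or.inl h0.symm
  · exact Or.inr (Or.inl (h h0))

theorem mem_collar_high (hy : 0 < y) (hy2 : y ≤ 1 / 2) {x v : ℝ} (hx0 : 0 ≤ x) (hx1 : x ≤ 1)
    (hv0 : 0 ≤ v) (hv1 : v ≤ 1) (h : 0 < x → bandEdge y x + y - y * x / 8 ≤ v) :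
    sqPt (x, v) ∈ collar (bandEdge y) y := by
  rw [mem_collar_iff (isBand_wave hy (by linarith)), sqPt_val hx0 hx1 hv0 hv1]
  rcases hx0.eq_or_lt with h0 | h0
  · exact Or.inl h0.symm
  · exact Or.inr (Or.inr (h h0))

theorem bottom_mem_collar (hy : 0 < y) (hy2 : y ≤ 1 / 2) {x : ℝ} (hx0 : 0 ≤ x) (hx1 : x ≤ 1) :
    sqPt (x, 0) ∈ collar (bandEdge y) y := by
  refine mem_collar_low hy hy2 hx0 hx1 le_rfl zero_le_one fun h => ?_
  have := ((isBand_wave hy (by linarith)).bounds x ⟨h, hx1⟩).1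
  positivity

theorem top_mem_collar (hy : 0 < y) (hy2 : y ≤ 1 / 2) {x : ℝ} (hx0 : 0 ≤ x) (hx1 : x ≤ 1) :
    sqPt (x, 1) ∈ collar (bandEdge y) y := by
  refine mem_collar_high hy hy2 hx0 hx1 zero_le_one le_rfl fun h => ?_
  have := ((isBand_wave hy (by linarith)).bounds x ⟨h, hx1⟩).2
  have : 0 ≤ y * x / 8 := by positivity
  linarith

theorem bandEdge_tip_neg {n : ℕ} (hn : 1 ≤ n) : bandEdge y (tipPos (-(1 / (n : ℝ)))) = 1 - y := by
  rw [tipPos_neg hn, bandEdge, wave_node_even (by omega) (even_two_mul _), mul_one]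

theorem bandEdge_tip_pos {n : ℕ} (hn : 1 ≤ n) : bandEdge y (tipPos (1 / (n : ℝ))) = 0 := by
  rw [tipPos_pos hn, bandEdge, wave_node_odd (by omega) ⟨n - 1, by omega⟩, mul_zero]

theorem fanToCollar_mem (hy : 0 < y) (hy2 : y ≤ 1 / 2) (w : fan) :
    sqPt (fanPos w, levelInv (w : ℝ × ℝ).2) ∈ collar (bandEdge y) y := by
  obtain ⟨τ, hτ, hw⟩ := w.2
  have hx0 : 0 ≤ fanPos w := tipPos_nonneg _
  have hx1 := fanPos_le_one hτ hw
  have hv := (levelInv (w : ℝ × ℝ).2).2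
  rcases le_or_gt (w : ℝ × ℝ).2 (-(1 / 2)) with h1 | h1
  · rw [levelInv_of_le h1]
    exact bottom_mem_collar hy hy2 hx0 hx1
  rcases le_or_gt (1 / 2) (w : ℝ × ℝ).2 with h2 | h2
  · rw [levelInv_of_ge h2]
    exact top_mem_collar hy hy2 hx0 hx1
  have hp := fanPos_of_leaf hw (abs_le.2 ⟨h1.le, h2.le⟩)
  rw [hp] at hx0 hx1 ⊢
  have hyx : 0 ≤ y * tipPos τ / 8 := by positivity
  rcases hτ with rfl | ⟨n, hn, hτ | hτ⟩
  · exact mem_collar_low hy hy2 hx0 hx1 hv.1 hv.2 fun h => by simp [tipPos_zero] at h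
  · have hneg : τ < 0 := by
      have : (0 : ℝ) < n := by exact_mod_cast hn
      rw [hτ]
      exact neg_neg_of_pos (by positivity)
    refine mem_collar_low hy hy2 hx0 hx1 hv.1 hv.2 fun _ => ?_
    have h3 := levelInv_nonpos (nonpos_of_mul_nonneg_right hw.2.2 hneg)
    have h4 : bandEdge y (tipPos τ) = 1 - y := by rw [hτ]; exact bandEdge_tip_neg hn
    linarith
  · have hpos : 0 < τ := by
      have : (0 : ℝ) < n := by exact_mod_cast hn
      rw [hτ]
      positivity
    refine mem_collar_high hy hy2 hx0 hx1 hv.1 hv.2 fun _ => ?_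
    have h3 := levelInv_nonneg (nonneg_of_mul_nonneg_right hw.2.2 hpos)
    have h4 : bandEdge y (tipPos τ) = 0 := by rw [hτ]; exact bandEdge_tip_pos hn
    linarith

/-- The map of the fan to the collar. -/
noncomputable def fanToCollar (hy : 0 < y) (hy2 : y ≤ 1 / 2) : C(fan, collar (bandEdge y) y) where
  toFun w := ⟨sqPt (fanPos w, levelInv (w : ℝ × ℝ).2), fanToCollar_mem hy hy2 w⟩
  continuous_toFun := by
    have h1 := continuous_fanPos
    have h2 := continuous_levelInv
    exact Continuous.subtype_mk (continuous_sqPt.comp (by fun_prop)) _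

theorem fanToCollar_val (hy : 0 < y) (hy2 : y ≤ 1 / 2) (w : fan) :
    ((fanToCollar hy hy2 w : unitSquare) : ℝ × ℝ) =
      (fanPos w, (levelInv (w : ℝ × ℝ).2 : ℝ)) := by
  obtain ⟨τ, hτ, hw⟩ := w.2
  exact sqPt_val (tipPos_nonneg _) (fanPos_le_one hτ hw) (levelInv _).2.1 (levelInv _).2.2

theorem level_zero (hy : 0 < y) (hy2 : y ≤ 1 / 2) : level y 0 = -1 := by
  rw [level_low hy (by linarith), ramp_eq_one hy (by linarith)]

theorem level_one (hy : 0 < y) (hy2 : y ≤ 1 / 2) : level y 1 = 1 := by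
  rw [level_high hy (by linarith), ramp_eq_one hy (by linarith)]

/-- On the middle part of a leaf the slope is recovered from the image in the collar. -/
theorem fingerSlope_fanToCollar (hy : 0 < y) (hy2 : y ≤ 1 / 2) {τ : ℝ} (hτ : τ ∈ leafSlopes)
    {w : fan} (hw : (w : ℝ × ℝ) ∈ leaf τ) (h : |(w : ℝ × ℝ).2| ≤ 1 / 2) :
    fingerSlope (fanToCollar hy hy2 w) = τ := by
  have hv := fanToCollar_val hy hy2 w
  rw [fanPos_of_leaf hw h] at hv
  have hx := congrArg Prod.fst hv
  have hv := congrArg Prod.snd hv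
  dsimp only at hx hv
  rw [fingerSlope, hx, hv]
  rcases hτ with rfl | ⟨n, hn, hτ | hτ⟩
  · rw [if_pos tipPos_zero]
  all_goals have hn' : (0 : ℝ) < n := by exact_mod_cast hn
  · have hneg : τ < 0 := by
      rw [hτ]
      exact neg_neg_of_pos (by positivity)
    have h3 := levelInv_nonpos (nonpos_of_mul_nonneg_right hw.2.2 hneg)
    rw [hτ, bandEdge_tip_neg hn, if_neg, if_pos (by linarith), tipPos_neg hn, one_div_one_div,
      Nat.floor_natCast, show (2 * n + 1) / 2 = n by omega]
    rw [tipPos_neg hn]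
    push_cast
    positivity
  · have hpos : 0 < τ := by
      rw [hτ]
      positivity
    have h3 := levelInv_nonneg (nonneg_of_mul_nonneg_right hw.2.2 hpos)
    rw [hτ, bandEdge_tip_pos hn, if_neg, if_neg (by linarith), tipPos_pos hn, one_div_one_div,
      Nat.floor_natCast, show (2 * n - 1) / 2 + 1 = n by omega]
    rw [tipPos_pos hn]
    have : (0 : ℝ) < (2 * n - 1 : ℕ) := by exact_mod_cast (by omega : 0 < 2 * n - 1)
    positivity

/-- The composition of the two maps moves each point of the fan within its leaf; the outer halves
of the leaves go to their ends, which are common to all leaves. -/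
theorem exists_common_leaf (hy : 0 < y) (hy2 : y ≤ 1 / 2) (w : fan) :
    ∃ τ ∈ leafSlopes, (collarToFan hy hy2 (fanToCollar hy hy2 w) : ℝ × ℝ) ∈ leaf τ ∧
      (w : ℝ × ℝ) ∈ leaf τ := by
  obtain ⟨τ, hτ, hw⟩ := w.2
  refine ⟨τ, hτ, ?_, hw⟩
  have hv := congrArg Prod.snd (fanToCollar_val hy hy2 w)
  dsimp only at hv
  change collarToFanPoint _ ∈ _
  rcases le_or_gt (w : ℝ × ℝ).2 (-(1 / 2)) with h1 | h1
  · rw [levelInv_of_le h1] at hv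
    have hτ0 : τ ≤ 0 := nonpos_of_mul_nonneg_left hw.2.2 (by linarith)
    rw [collarToFanPoint, hv, Icc.coe_zero, level_zero hy hy2]
    exact ⟨by simp, by simp, by dsimp only; linarith⟩
  rcases le_or_gt (1 / 2) (w : ℝ × ℝ).2 with h2 | h2
  · rw [levelInv_of_ge h2] at hv
    have hτ0 : 0 ≤ τ := nonneg_of_mul_nonneg_left hw.2.2 (by linarith)
    rw [collarToFanPoint, hv, Icc.coe_one, level_one hy hy2]
    exact ⟨by simp, by simp, by dsimp only; linarith⟩
  have := collarToFanPoint_mem hy hy2 (fanToCollar hy hy2 w)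
  rwa [fingerSlope_fanToCollar hy hy2 hτ hw (abs_le.2 ⟨h1.le, h2.le⟩)] at this

/-- The map of the segments that belongs to `collarToFan`. -/
noncomputable def levelMap (y : ℝ) : C(unitInterval, Icc (-1 : ℝ) 1) where
  toFun v := ⟨level y v, abs_le.1 (abs_level_le y v)⟩
  continuous_toFun := Continuous.subtype_mk ((continuous_level y).comp continuous_subtype_val) _

/-- The map of the segments that belongs to `fanToCollar`. -/
noncomputable def levelInvMap : C(Icc (-1 : ℝ) 1, unitInterval) where
  toFun h := levelInv h
  continuous_toFun := continuous_levelInv.comp continuous_subtype_val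

theorem collarToFan_mem_limit (hy : 0 < y) (hy2 : y ≤ 1 / 2) {w : collar (bandEdge y) y}
    (hw : w ∈ collarLimit (bandEdge y) y) : collarToFan hy hy2 w ∈ fanLimit := by
  change (1 - |level y w.1.1.2|) * fingerSlope w = 0
  rw [fingerSlope_of_mem hw, mul_zero]

theorem fanToCollar_mem_limit (hy : 0 < y) (hy2 : y ≤ 1 / 2) {w : fan} (hw : w ∈ fanLimit) :
    fanToCollar hy hy2 w ∈ collarLimit (bandEdge y) y := by
  have h0 : (w : ℝ × ℝ).1 = 0 := hw
  change ((fanToCollar hy hy2 w : unitSquare) : ℝ × ℝ).1 = 0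
  rw [fanToCollar_val, fanPos, h0, zero_div, tipPos_zero]

theorem fanHeight_collarToFan (hy : 0 < y) (hy2 : y ≤ 1 / 2) (w : collar (bandEdge y) y) :
    fanHeight (collarToFan hy hy2 w) = levelMap y (collarHeight w) := rfl

theorem collarHeight_fanToCollar (hy : 0 < y) (hy2 : y ≤ 1 / 2) (w : fan) :
    collarHeight (fanToCollar hy hy2 w) = levelInvMap (fanHeight w) :=
  Subtype.ext (congrArg Prod.snd (fanToCollar_val hy hy2 w))

/-- The map of the spaces with attached loops that is induced by `collarToFan`. -/
noncomputable def collarToFanLoops (hy : 0 < y) (hy2 : y ≤ 1 / 2) :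
    C(CollarLoops (bandEdge y) y, FanLoops) :=
  ArcSpace.map _ _ _ (levelMap y) (collarToFan hy hy2) (fanHeight_collarToFan hy hy2)
    (fanHeight_collarToFan hy hy2)
    fun _ hw => collarToFan_mem_limit hy hy2 hw

/-- The map of the spaces with attached loops that is induced by `fanToCollar`. -/
noncomputable def fanToCollarLoops (hy : 0 < y) (hy2 : y ≤ 1 / 2) :
    C(FanLoops, CollarLoops (bandEdge y) y) :=
  ArcSpace.map _ _ _ levelInvMap (fanToCollar hy hy2)
    (collarHeight_fanToCollar hy hy2) (collarHeight_fanToCollar hy hy2)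
    fun _ hw => fanToCollar_mem_limit hy hy2 hw

theorem collarToFanLoops_pt (hy : 0 < y) (hy2 : y ≤ 1 / 2) (v : unitInterval) :
    collarToFanLoops hy hy2 (ArcSpace.pt _ _ _ v) = ArcSpace.pt _ _ _ (levelMap y v) := rfl

theorem collarToFanLoops_arc (hy : 0 < y) (hy2 : y ≤ 1 / 2) (w : collar (bandEdge y) y)
    (θ : unitInterval) : collarToFanLoops hy hy2 (ArcSpace.arc _ _ _ w θ) =
      ArcSpace.arc _ _ _ (collarToFan hy hy2 w) θ := ArcSpace.map_arc w θ

theorem fanToCollarLoops_pt (hy : 0 < y) (hy2 : y ≤ 1 / 2) (h : Icc (-1 : ℝ) 1) :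
    fanToCollarLoops hy hy2 (ArcSpace.pt _ _ _ h) = ArcSpace.pt _ _ _ (levelInvMap h) := rfl

theorem fanToCollarLoops_arc (hy : 0 < y) (hy2 : y ≤ 1 / 2) (w : fan) (θ : unitInterval) :
    fanToCollarLoops hy hy2 (ArcSpace.arc _ _ _ w θ) =
      ArcSpace.arc _ _ _ (fanToCollar hy hy2 w) θ := ArcSpace.map_arc w θ

theorem collarToFanLoops_comp (hy : 0 < y) (hy2 : y ≤ 1 / 2) :
    ((collarToFanLoops hy hy2).comp (fanToCollarLoops hy hy2)).Homotopic
      (ContinuousMap.id _) := by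
  have hmem : ∀ (w : fan) (s : unitInterval),
      ((1 - (s : ℝ)) * (collarToFan hy hy2 (fanToCollar hy hy2 w) : ℝ × ℝ).1 +
        s * (w : ℝ × ℝ).1, (1 - (s : ℝ)) * (collarToFan hy hy2 (fanToCollar hy hy2 w) : ℝ × ℝ).2 +
        s * (w : ℝ × ℝ).2) ∈ fan := by
    intro w s
    obtain ⟨τ, hτ, h1, h2⟩ := exists_common_leaf hy hy2 w
    exact ⟨τ, hτ, leaf_combination h1 h2 s.2.1 s.2.2⟩
  have hmem' : ∀ (h : Icc (-1 : ℝ) 1) (s : unitInterval),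
      (1 - (s : ℝ)) * level y (levelInv h) + s * h ∈ Icc (-1 : ℝ) 1 := fun h s =>
    (convex_Icc (-1 : ℝ) 1) (abs_le.1 (abs_level_le y (levelInv h))) h.2
      (by linarith [s.2.2]) s.2.1 (by ring)
  have hlev : ∀ w : fan, level y (fanToCollar hy hy2 w).1.1.2 = level y (levelInv (w : ℝ × ℝ).2) :=
    fun w => by rw [fanToCollar_val]
  have hcl := continuous_level y
  have hci := continuous_levelInv
  refine ArcSpace.homotopic_of_deformation (fun h s => ⟨_, hmem' h s⟩) (fun w s => ⟨_, hmem w s⟩)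
    ?_ ?_ ?_ ?_ ?_ ?_ ?_ ?_ ?_
  · exact Continuous.subtype_mk (by fun_prop) _
  · have hc : ∀ g : fan → ℝ × ℝ, Continuous g → Continuous fun p : fan × unitInterval =>
        ((1 - (p.2 : ℝ)) * (g p.1).1 + p.2 * (p.1 : ℝ × ℝ).1,
          (1 - (p.2 : ℝ)) * (g p.1).2 + p.2 * (p.1 : ℝ × ℝ).2) := fun g hg => by fun_prop
    exact Continuous.subtype_mk (hc _ (continuous_subtype_val.comp
      ((collarToFan hy hy2).continuous.comp (fanToCollar hy hy2).continuous))) _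
  · intro w s
    refine Subtype.ext ?_
    change (1 - (s : ℝ)) * level y (fanToCollar hy hy2 w).1.1.2 + _ = _
    rw [hlev]
    rfl
  · intro w s
    refine Subtype.ext ?_
    change (1 - (s : ℝ)) * level y (fanToCollar hy hy2 w).1.1.2 + _ = _
    rw [hlev]
    rfl
  · intro w hw s
    have h0 : (w : ℝ × ℝ).1 = 0 := hw
    have h1 : (collarToFan hy hy2 (fanToCollar hy hy2 w) : ℝ × ℝ).1 = 0 :=
      collarToFan_mem_limit hy hy2 (fanToCollar_mem_limit hy hy2 hw)
    change (1 - (s : ℝ)) * _ + s * (w : ℝ × ℝ).1 = 0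
    rw [h0, h1, mul_zero, mul_zero, add_zero]
  · intro h
    rw [ContinuousMap.comp_apply, fanToCollarLoops_pt, collarToFanLoops_pt]
    congr 1
    refine Subtype.ext ?_
    simp [levelMap, levelInvMap]
  · intro w θ
    rw [ContinuousMap.comp_apply, fanToCollarLoops_arc, collarToFanLoops_arc]
    congr 1
    refine Subtype.ext ?_
    simp
  · intro h
    rw [ContinuousMap.id_apply]
    congr 1
    refine Subtype.ext ?_
    simp
  · intro w θ
    rw [ContinuousMap.id_apply]
    congr 1
    refine Subtype.ext ?_
    simp

end Fan

/-! ### From the fan back to the fingers -/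

section Fan

variable {y : ℝ}

/-- The weight with which the first coordinate of a point of the collar is kept when it is pushed
towards the tip of its finger; it is `1` near the valleys between the fingers. -/
noncomputable def keepWeight (y v : ℝ) : ℝ := max 0 (2 * |level y v| - 1)

theorem keepWeight_nonneg (y v : ℝ) : 0 ≤ keepWeight y v := le_max_left _ _

theorem keepWeight_le_one (y v : ℝ) : keepWeight y v ≤ 1 :=
  max_le zero_le_one (by linarith [abs_level_le y v])

theorem continuous_keepWeight (y : ℝ) : Continuous (keepWeight y) := by
  have := continuous_level y
  unfold keepWeight
  fun_prop

/-- The first coordinate of a point of the collar after it is pushed towards the tip of its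
finger. -/
noncomputable def pushedPos (w : collar (bandEdge y) y) : ℝ :=
  (1 - keepWeight y w.1.1.2) * tipPos (fingerSlope w) + keepWeight y w.1.1.2 * w.1.1.1

theorem continuous_pushedPos (hy : 0 < y) (hy2 : y ≤ 1 / 2) :
    Continuous (pushedPos : collar (bandEdge y) y → ℝ) := by
  have hk := continuous_keepWeight y
  refine Continuous.add (continuous_mul_fingerSlope hy hy2
    (a := fun w => 1 - keepWeight y w.1.1.2) (by fun_prop) ?_ ?_ fun τ => ?_) (by fun_prop)
  · intro w
    have h0 := keepWeight_nonneg y w.1.1.2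
    have h1 := keepWeight_le_one y w.1.1.2
    exact abs_le.2 ⟨by linarith, by linarith⟩
  · intro w hw
    rw [keepWeight, abs_level_eq_one hy hy2 hw]
    norm_num
  · rw [abs_of_nonneg (tipPos_nonneg τ)]
    exact tipPos_le τ

theorem tipPos_fingerSlope_le_one (w : collar (bandEdge y) y) : tipPos (fingerSlope w) ≤ 1 := by
  have h : ((fingerSlope w, 0) : ℝ × ℝ) ∈ leaf (fingerSlope w) := ⟨by simp, by simp, by simp⟩
  have := fanPos_le_one (fingerSlope_mem w) h
  rwa [fanPos_of_leaf h (by norm_num)] at this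

theorem combination_mem_unit {a b s : ℝ} (ha0 : 0 ≤ a) (ha1 : a ≤ 1) (hb0 : 0 ≤ b) (hb1 : b ≤ 1)
    (h0 : 0 ≤ s) (h1 : s ≤ 1) : 0 ≤ (1 - s) * a + s * b ∧ (1 - s) * a + s * b ≤ 1 :=
  convex_Icc (0 : ℝ) 1 ⟨ha0, ha1⟩ ⟨hb0, hb1⟩ (by linarith) h0 (by ring)

theorem pushedPos_mem (w : collar (bandEdge y) y) : 0 ≤ pushedPos w ∧ pushedPos w ≤ 1 :=
  combination_mem_unit (tipPos_nonneg _) (tipPos_fingerSlope_le_one w) w.1.2.1.1 w.1.2.1.2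
    (keepWeight_nonneg _ _) (keepWeight_le_one _ _)

/-- The position of a point of the collar after the two maps to the fan and back. -/
noncomputable def returnPos (w : collar (bandEdge y) y) : ℝ := fanPos (collarToFanPoint w)

theorem returnPos_mem (hy : 0 < y) (hy2 : y ≤ 1 / 2) (w : collar (bandEdge y) y) :
    0 ≤ returnPos w ∧ returnPos w ≤ 1 :=
  ⟨tipPos_nonneg _, fanPos_le_one (fingerSlope_mem w) (collarToFanPoint_mem hy hy2 w)⟩

theorem pushedPos_of_mem {w : collar (bandEdge y) y} (hw : w ∈ collarLimit (bandEdge y) y) :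
    pushedPos w = 0 := by
  have h0 : w.1.1.1 = 0 := hw
  rw [pushedPos, fingerSlope_of_mem hw, tipPos_zero, h0, mul_zero, mul_zero, add_zero]

theorem returnPos_of_mem {w : collar (bandEdge y) y} (hw : w ∈ collarLimit (bandEdge y) y) :
    returnPos w = 0 := by
  rw [returnPos, collarToFanPoint, fanPos, fingerSlope_of_mem hw]
  simp [tipPos_zero]

theorem left_mem_collar (hy : 0 < y) (hy2 : y ≤ 1 / 2) (v : ℝ) :
    sqPt (0, v) ∈ collar (bandEdge y) y := by
  rw [mem_collar_iff (isBand_wave hy (by linarith))]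
  left
  simp [sqPt_fst]

theorem return_to_pushed_mem (hy : 0 < y) (hy2 : y ≤ 1 / 2) (w : collar (bandEdge y) y)
    (s : unitInterval) : sqPt ((1 - s) * returnPos w + s * pushedPos w,
      levelInv (level y w.1.1.2)) ∈ collar (bandEdge y) y := by
  by_cases hw : w ∈ collarLimit (bandEdge y) y
  · rw [returnPos_of_mem hw, pushedPos_of_mem hw, mul_zero, mul_zero, add_zero]
    exact left_mem_collar hy hy2 _
  obtain ⟨hx0, hx1⟩ := combination_mem_unit (returnPos_mem hy hy2 w).1 (returnPos_mem hy hy2 w).2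
    (pushedPos_mem w).1 (pushedPos_mem w).2 s.2.1 s.2.2
  have hv := (levelInv (level y w.1.1.2)).2
  rcases le_or_gt (level y w.1.1.2) (-(1 / 2)) with h1 | h1
  · rw [levelInv_of_le h1]
    exact bottom_mem_collar hy hy2 hx0 hx1
  rcases le_or_gt (1 / 2) (level y w.1.1.2) with h2 | h2
  · rw [levelInv_of_ge h2]
    exact top_mem_collar hy hy2 hx0 hx1
  have habs : |level y w.1.1.2| ≤ 1 / 2 := abs_le.2 ⟨h1.le, h2.le⟩
  have e1 : returnPos w = tipPos (fingerSlope w) :=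
    fanPos_of_leaf (collarToFanPoint_mem hy hy2 w) habs
  have e2 : pushedPos w = tipPos (fingerSlope w) := by
    rw [pushedPos, keepWeight, max_eq_left (by linarith)]
    ring
  have e3 : (1 - (s : ℝ)) * returnPos w + s * pushedPos w = tipPos (fingerSlope w) := by
    rw [e1, e2]
    ring
  rw [e3] at hx0 hx1 ⊢
  have hyx : 0 ≤ y * tipPos (fingerSlope w) / 8 := by positivity
  rcases finger_cases hy hy2 hw with ⟨-, h3, h4, -⟩ | ⟨-, h3, h4, -⟩
  · refine mem_collar_low hy hy2 hx0 hx1 hv.1 hv.2 fun _ => ?_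
    have := levelInv_nonpos (h := level y w.1.1.2) (by linarith [ramp_nonneg y w.1.1.2])
    linarith
  · refine mem_collar_high hy hy2 hx0 hx1 hv.1 hv.2 fun _ => ?_
    have := levelInv_nonneg (h := level y w.1.1.2) (by linarith [ramp_nonneg y (1 - w.1.1.2)])
    linarith

theorem raise_mem (hy : 0 < y) (hy2 : y ≤ 1 / 2) (w : collar (bandEdge y) y)
    (s : unitInterval) : sqPt (pushedPos w,
      (1 - s) * levelInv (level y w.1.1.2) + s * w.1.1.2) ∈ collar (bandEdge y) y := by
  by_cases hw : w ∈ collarLimit (bandEdge y) y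
  · rw [pushedPos_of_mem hw]
    exact left_mem_collar hy hy2 _
  obtain ⟨hx0, hx1⟩ := pushedPos_mem w
  have hω := (levelInv (level y w.1.1.2)).2
  have hv := w.1.2.2
  have h0 := s.2.1
  have h1 := s.2.2
  obtain ⟨hv0, hv1⟩ := combination_mem_unit hω.1 hω.2 hv.1 hv.2 h0 h1
  have hk0 := keepWeight_nonneg y w.1.1.2
  have hk1 := keepWeight_le_one y w.1.1.2
  have e2 : |level y w.1.1.2| ≤ 1 / 2 → pushedPos w = tipPos (fingerSlope w) := fun habs => by
    rw [pushedPos, keepWeight, max_eq_left (by linarith)]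
    ring
  have hyx : 0 ≤ y * pushedPos w / 8 := by positivity
  rcases finger_cases hy hy2 hw with ⟨-, h3, h4, h5⟩ | ⟨-, h3, h4, h5⟩
  · refine mem_collar_low hy hy2 hx0 hx1 hv0 hv1 fun hx => ?_
    have h6 : w.1.1.2 ≤ bandEdge y (pushedPos w) + y * pushedPos w / 8 := h5 _ hk0 hk1
    have h7 : (levelInv (level y w.1.1.2) : ℝ) ≤ bandEdge y (pushedPos w) +
        y * pushedPos w / 8 := by
      rcases le_or_gt (level y w.1.1.2) (-(1 / 2)) with h8 | h8
      · rw [levelInv_of_le h8, Icc.coe_zero]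
        have := ((isBand_wave hy (by linarith)).bounds _ ⟨hx, hx1⟩).1
        positivity
      · have h9 : level y w.1.1.2 ≤ 0 := by linarith [ramp_nonneg y w.1.1.2]
        have := levelInv_nonpos h9
        have h10 := e2 (abs_le.2 ⟨h8.le, by linarith⟩)
        rw [h10, h3]
        rw [h10] at hyx
        linarith
    nlinarith
  · refine mem_collar_high hy hy2 hx0 hx1 hv0 hv1 fun hx => ?_
    have h6 : bandEdge y (pushedPos w) + y - y * pushedPos w / 8 ≤ w.1.1.2 := h5 _ hk0 hk1
    have h7 : bandEdge y (pushedPos w) + y - y * pushedPos w / 8 ≤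
        (levelInv (level y w.1.1.2) : ℝ) := by
      rcases le_or_gt (1 / 2) (level y w.1.1.2) with h8 | h8
      · rw [levelInv_of_ge h8, Icc.coe_one]
        have := ((isBand_wave hy (by linarith)).bounds _ ⟨hx, hx1⟩).2
        have e : bandEdge y (pushedPos w) = (1 - y) * wave (pushedPos w) := rfl
        linarith
      · have h9 : 0 ≤ level y w.1.1.2 := by linarith [ramp_nonneg y (1 - w.1.1.2)]
        have := levelInv_nonneg h9
        have h10 := e2 (abs_le.2 ⟨by linarith, h8.le⟩)
        rw [h10, h3]
        rw [h10] at hyx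
        linarith
    nlinarith

theorem unpush_mem (hy : 0 < y) (hy2 : y ≤ 1 / 2) (w : collar (bandEdge y) y)
    (s : unitInterval) : sqPt ((1 - s) * pushedPos w + s * w.1.1.1, w.1.1.2) ∈
      collar (bandEdge y) y := by
  by_cases hw : w ∈ collarLimit (bandEdge y) y
  · have h0 : w.1.1.1 = 0 := hw
    rw [pushedPos_of_mem hw, h0, mul_zero, mul_zero, add_zero]
    exact left_mem_collar hy hy2 _
  obtain ⟨hx0, hx1⟩ := combination_mem_unit (pushedPos_mem w).1 (pushedPos_mem w).2 w.1.2.1.1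
    w.1.2.1.2 s.2.1 s.2.2
  obtain ⟨hc0, hc1⟩ := combination_mem_unit (keepWeight_nonneg y w.1.1.2)
    (keepWeight_le_one y w.1.1.2) zero_le_one le_rfl s.2.1 s.2.2
  have e : (1 - (s : ℝ)) * pushedPos w + s * w.1.1.1 =
      (1 - ((1 - s) * keepWeight y w.1.1.2 + s * 1)) * tipPos (fingerSlope w) +
        ((1 - s) * keepWeight y w.1.1.2 + s * 1) * w.1.1.1 := by
    rw [pushedPos]
    ring
  have hv := w.1.2.2
  rw [e] at hx0 hx1 ⊢
  rcases finger_cases hy hy2 hw with ⟨-, -, -, h5⟩ | ⟨-, -, -, h5⟩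
  · exact mem_collar_low hy hy2 hx0 hx1 hv.1 hv.2 fun _ => h5 _ hc0 hc1
  · exact mem_collar_high hy hy2 hx0 hx1 hv.1 hv.2 fun _ => h5 _ hc0 hc1

theorem sqPt_mem_collarLimit {x v : ℝ} (h : sqPt (x, v) ∈ collar (bandEdge y) y) (hx : x = 0) :
    (⟨sqPt (x, v), h⟩ : collar (bandEdge y) y) ∈ collarLimit (bandEdge y) y := by
  simp [collarLimit, sqPt_fst, hx]

theorem collarHeight_sqPt {x v : ℝ} (h : sqPt (x, v) ∈ collar (bandEdge y) y)
    (hv : v ∈ Icc (0 : ℝ) 1) : collarHeight ⟨sqPt (x, v), h⟩ = ⟨v, hv⟩ :=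
  Subtype.ext (by simp [collarHeight, sqPt_snd, hv.1, hv.2])

/-- The motion of the collar with first coordinate `X` and second coordinate `V`, where `V` depends
only on the height, so that the motion is compatible with one of the segment. -/
noncomputable def collarPath (X : collar (bandEdge y) y → unitInterval → ℝ)
    (V : unitInterval → unitInterval → unitInterval)
    (h : ∀ w s, sqPt (X w s, (V (collarHeight w) s : ℝ)) ∈ collar (bandEdge y) y)
    (w : collar (bandEdge y) y) (s : unitInterval) : collar (bandEdge y) y :=
  ⟨sqPt (X w s, (V (collarHeight w) s : ℝ)), h w s⟩

section collarPath

variable {X : collar (bandEdge y) y → unitInterval → ℝ}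
  {V : unitInterval → unitInterval → unitInterval}

theorem continuous_collarPath
    (h : ∀ w s, sqPt (X w s, (V (collarHeight w) s : ℝ)) ∈ collar (bandEdge y) y)
    (hX : Continuous fun p : collar (bandEdge y) y × unitInterval => X p.1 p.2)
    (hV : Continuous fun p : unitInterval × unitInterval => V p.1 p.2) :
    Continuous fun p : collar (bandEdge y) y × unitInterval => collarPath X V h p.1 p.2 := by
  have hV' : Continuous fun p : collar (bandEdge y) y × unitInterval =>
      V (collarHeight p.1) p.2 :=
    hV.comp ((continuous_collarHeight.comp continuous_fst).prodMk continuous_snd)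
  exact Continuous.subtype_mk (continuous_sqPt.comp
    (hX.prodMk (continuous_subtype_val.comp hV'))) fun p => h p.1 p.2

theorem collarHeight_collarPath
    (h : ∀ w s, sqPt (X w s, (V (collarHeight w) s : ℝ)) ∈ collar (bandEdge y) y)
    (w : collar (bandEdge y) y) (s : unitInterval) :
    collarHeight (collarPath X V h w s) = V (collarHeight w) s :=
  collarHeight_sqPt (h w s) (V (collarHeight w) s).2

theorem homotopic_of_collarPath {F G : C(CollarLoops (bandEdge y) y, CollarLoops (bandEdge y) y)}
    (h : ∀ w s, sqPt (X w s, (V (collarHeight w) s : ℝ)) ∈ collar (bandEdge y) y)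
    (hX : Continuous fun p : collar (bandEdge y) y × unitInterval => X p.1 p.2)
    (hV : Continuous fun p : unitInterval × unitInterval => V p.1 p.2)
    (hL : ∀ w ∈ collarLimit (bandEdge y) y, ∀ s, X w s = 0)
    (hF : ∀ v, F (ArcSpace.pt _ _ _ v) = ArcSpace.pt _ _ _ (V v 0))
    (hF' : ∀ w, ∀ θ : unitInterval,
      F (ArcSpace.arc _ _ _ w θ) = ArcSpace.arc _ _ _ (collarPath X V h w 0) θ)
    (hG : ∀ v, G (ArcSpace.pt _ _ _ v) = ArcSpace.pt _ _ _ (V v 1))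
    (hG' : ∀ w, ∀ θ : unitInterval,
      G (ArcSpace.arc _ _ _ w θ) = ArcSpace.arc _ _ _ (collarPath X V h w 1) θ) :
    F.Homotopic G :=
  ArcSpace.homotopic_of_deformation V (collarPath X V h) hV (continuous_collarPath h hX hV)
    (collarHeight_collarPath h) (collarHeight_collarPath h)
    (fun w hw s => sqPt_mem_collarLimit (h w s) (hL w hw s)) hF hF' hG hG'

theorem exists_collarPath_end
    (h : ∀ w s, sqPt (X w s, (V (collarHeight w) s : ℝ)) ∈ collar (bandEdge y) y)
    (hX : Continuous fun p : collar (bandEdge y) y × unitInterval => X p.1 p.2)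
    (hV : Continuous fun p : unitInterval × unitInterval => V p.1 p.2)
    (hL : ∀ w ∈ collarLimit (bandEdge y) y, ∀ s, X w s = 0) :
    ∃ F : C(CollarLoops (bandEdge y) y, CollarLoops (bandEdge y) y),
      (∀ v, F (ArcSpace.pt _ _ _ v) = ArcSpace.pt _ _ _ (V v 1)) ∧
      ∀ w, ∀ θ : unitInterval,
        F (ArcSpace.arc _ _ _ w θ) = ArcSpace.arc _ _ _ (collarPath X V h w 1) θ :=
  ⟨ArcSpace.map collarHeight collarHeight (collarLimit (bandEdge y) y)
    ⟨fun v => V v 1, hV.comp (continuous_id.prodMk continuous_const)⟩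
    ⟨fun w => collarPath X V h w 1, (continuous_collarPath h hX hV).comp
      (continuous_id.prodMk continuous_const)⟩
    (fun w => collarHeight_collarPath h w 1) (fun w => collarHeight_collarPath h w 1)
    fun w hw => sqPt_mem_collarLimit (h w 1) (hL w hw 1),
    fun v => ArcSpace.map_pt v, fun w θ => ArcSpace.map_arc w θ⟩

end collarPath

/-- The height that moves from the reparametrized height of a point to the height itself. -/
noncomputable def raisedHeight (y : ℝ) (v s : unitInterval) : unitInterval :=
  ⟨(1 - (s : ℝ)) * levelInv (level y v) + s * v,
    combination_mem_unit (levelInv (level y v)).2.1 (levelInv (level y v)).2.2 v.2.1 v.2.2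
      s.2.1 s.2.2⟩

theorem continuous_raisedHeight (y : ℝ) :
    Continuous fun p : unitInterval × unitInterval => raisedHeight y p.1 p.2 := by
  have hl := continuous_level y
  have hi := continuous_levelInv
  exact Continuous.subtype_mk (by fun_prop) _

theorem raisedHeight_zero (v : unitInterval) : raisedHeight y v 0 = levelInv (level y v) :=
  Subtype.ext (by simp [raisedHeight])

theorem raisedHeight_one (v : unitInterval) : raisedHeight y v 1 = v :=
  Subtype.ext (by simp [raisedHeight])

theorem continuous_returnPos (hy : 0 < y) (hy2 : y ≤ 1 / 2) :
    Continuous (returnPos : collar (bandEdge y) y → ℝ) :=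
  continuous_fanPos.comp (continuous_collarToFanPoint hy hy2)

/-- The composition moves the points of the collar to the vertical lines through the tips of the
fingers or to the horizontal sides. They are moved back in three stages, so that at each stage the
fingers contain the path. -/
theorem fanToCollarLoops_comp (hy : 0 < y) (hy2 : y ≤ 1 / 2) :
    ((fanToCollarLoops hy hy2).comp (collarToFanLoops hy hy2)).Homotopic
      (ContinuousMap.id _) := by
  have hl := continuous_level y
  have hi := continuous_levelInv
  have hp := continuous_pushedPos hy hy2
  have hr := continuous_returnPos hy hy2
  have cV₁ : Continuous fun p : unitInterval × unitInterval => levelInv (level y p.1) :=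
    by fun_prop
  have cV₃ : Continuous fun p : unitInterval × unitInterval => p.1 := continuous_fst
  have cX₁ : Continuous fun p : collar (bandEdge y) y × unitInterval =>
      (1 - (p.2 : ℝ)) * returnPos p.1 + p.2 * pushedPos p.1 := by fun_prop
  have cX₂ : Continuous fun p : collar (bandEdge y) y × unitInterval => pushedPos p.1 := by
    fun_prop
  have cX₃ : Continuous fun p : collar (bandEdge y) y × unitInterval =>
      (1 - (p.2 : ℝ)) * pushedPos p.1 + p.2 * p.1.1.1.1 := by fun_prop
  have L₁ : ∀ w ∈ collarLimit (bandEdge y) y, ∀ s : unitInterval,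
      (1 - (s : ℝ)) * returnPos w + s * pushedPos w = 0 := fun w hw s => by
    rw [returnPos_of_mem hw, pushedPos_of_mem hw, mul_zero, mul_zero, add_zero]
  have L₃ : ∀ w ∈ collarLimit (bandEdge y) y, ∀ s : unitInterval,
      (1 - (s : ℝ)) * pushedPos w + s * w.1.1.1 = 0 := fun w hw s => by
    have h0 : w.1.1.1 = 0 := hw
    rw [pushedPos_of_mem hw, h0, mul_zero, mul_zero, add_zero]
  -- the stages: to the pushed position, then to the original height, then back
  obtain ⟨F₁, F₁pt, F₁arc⟩ := exists_collarPath_end (V := fun v _ => levelInv (level y v))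
    (return_to_pushed_mem hy hy2) cX₁ cV₁ L₁
  obtain ⟨F₂, F₂pt, F₂arc⟩ := exists_collarPath_end (V := raisedHeight y)
    (raise_mem hy hy2) cX₂ (continuous_raisedHeight y) fun w hw _ => pushedPos_of_mem hw
  have H1 : ((fanToCollarLoops hy hy2).comp (collarToFanLoops hy hy2)).Homotopic F₁ := by
    refine homotopic_of_collarPath (V := fun v _ => levelInv (level y v))
      (return_to_pushed_mem hy hy2) cX₁ cV₁ L₁ (fun v => ?_) (fun w θ => ?_) F₁pt F₁arc
    · rw [ContinuousMap.comp_apply, collarToFanLoops_pt, fanToCollarLoops_pt]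
      exact congrArg _ (Subtype.ext (by simp [levelMap, levelInvMap]))
    · rw [ContinuousMap.comp_apply, collarToFanLoops_arc, fanToCollarLoops_arc]
      congr 1
      refine Subtype.ext ?_
      simp only [collarPath, Icc.coe_zero, sub_zero, one_mul, zero_mul, add_zero]
      rfl
  have H2 : F₁.Homotopic F₂ := by
    refine homotopic_of_collarPath (V := raisedHeight y)
      (raise_mem hy hy2) cX₂ (continuous_raisedHeight y) (fun w hw _ => pushedPos_of_mem hw)
      (fun v => ?_) (fun w θ => ?_) F₂pt F₂arc
    · rw [F₁pt, raisedHeight_zero]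
    · rw [F₁arc]
      congr 1
      refine Subtype.ext ?_
      simp [collarPath, raisedHeight_zero]
  have H3 : F₂.Homotopic (ContinuousMap.id _) := by
    refine homotopic_of_collarPath (V := fun v _ => v) (unpush_mem hy hy2) cX₃ cV₃ L₃
      (fun v => ?_) (fun w θ => ?_) (fun v => ?_) (fun w θ => ?_)
    · rw [F₂pt, raisedHeight_one]
    · rw [F₂arc]
      congr 1
      refine Subtype.ext ?_
      simp [collarPath, raisedHeight_one]
    · rw [ContinuousMap.id_apply]
    · rw [ContinuousMap.id_apply]
      congr 1
      refine Subtype.ext ?_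
      simp only [collarPath, Icc.coe_one, sub_self, one_mul, zero_mul, zero_add]
      exact (sqPt_coe w.1).symm
  exact (H1.trans H2).trans H3

/-- The loops at the points of the fingers are parametrized up to homotopy by the fan. -/
theorem nonempty_homotopyEquiv_fanLoops (hy : 0 < y) (hy2 : y ≤ 1 / 2) :
    Nonempty (CollarLoops (bandEdge y) y ≃ₕ FanLoops) :=
  ⟨⟨collarToFanLoops hy hy2, fanToCollarLoops hy hy2, fanToCollarLoops_comp hy hy2,
    collarToFanLoops_comp hy hy2⟩⟩

end Fan

/-! ### The Griffiths space -/

theorem circle_exp_eq_of_cos_of_sin {a b : ℝ} (h1 : Real.cos a = Real.cos b)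
    (h2 : Real.sin a = Real.sin b) : Circle.exp a = Circle.exp b := by
  refine Circle.ext ?_
  rw [Circle.coe_exp, Circle.coe_exp, Complex.exp_mul_I, Complex.exp_mul_I, ← Complex.ofReal_cos,
    ← Complex.ofReal_cos, ← Complex.ofReal_sin, ← Complex.ofReal_sin, h1, h2]

theorem cos_ne_one {θ : ℝ} (h0 : 0 < θ) (h1 : θ < 1) : Real.cos (2 * Real.pi * θ) ≠ 1 := by
  intro h
  have hs := Real.sin_sq_add_cos_sq (2 * Real.pi * θ)
  rw [h] at hs
  have hs0 : Real.sin (2 * Real.pi * θ) = 0 := pow_eq_zero_iff two_ne_zero |>.1 (by linarith)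
  have := circle_param_injective h0.le h1 le_rfl zero_lt_one
    (circle_exp_eq_of_cos_of_sin (by rw [h]; simp) (by rw [hs0]; simp))
  exact h0.ne' this

/-- The circle through the origin with centre `(q, 0)`. -/
noncomputable def circlePoint (q θ : ℝ) : ℝ × ℝ :=
  (q * (1 - Real.cos (2 * Real.pi * θ)), q * Real.sin (2 * Real.pi * θ))

theorem continuous_circlePoint : Continuous fun p : ℝ × ℝ => circlePoint p.1 p.2 := by
  unfold circlePoint
  fun_prop

theorem circlePoint_zero (q : ℝ) : circlePoint q 0 = (0, 0) := by simp [circlePoint]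

theorem circlePoint_one (q : ℝ) : circlePoint q 1 = (0, 0) := by simp [circlePoint]

theorem circlePoint_zero_left (θ : ℝ) : circlePoint 0 θ = (0, 0) := by simp [circlePoint]

theorem circlePoint_fst_ne_zero {q θ : ℝ} (hq : q ≠ 0) (h0 : 0 < θ) (h1 : θ < 1) :
    (circlePoint q θ).1 ≠ 0 :=
  mul_ne_zero hq (sub_ne_zero.2 (cos_ne_one h0 h1).symm)

theorem circlePoint_sq (q θ : ℝ) : (circlePoint q θ).1 ^ 2 + (circlePoint q θ).2 ^ 2 =
    2 * q * (circlePoint q θ).1 := by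
  have hs := Real.sin_sq_add_cos_sq (2 * Real.pi * θ)
  dsimp only [circlePoint]
  linear_combination q ^ 2 * hs

theorem circlePoint_injective {q q' θ θ' : ℝ} (hq : q ≠ 0) (h0 : 0 < θ) (h1 : θ < 1)
    (h0' : 0 < θ') (h1' : θ' < 1) (h : circlePoint q θ = circlePoint q' θ') :
    q = q' ∧ θ = θ' := by
  have hU := circlePoint_fst_ne_zero hq h0 h1
  have e1 := circlePoint_sq q θ
  have e2 := circlePoint_sq q' θ'
  rw [← h, e1] at e2
  obtain rfl : q = q' := by
    have := mul_right_cancel₀ hU e2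
    linarith
  refine ⟨rfl, circle_param_injective h0.le h1 h0'.le h1' (circle_exp_eq_of_cos_of_sin ?_ ?_)⟩
  · have := mul_left_cancel₀ hq (congrArg Prod.fst h)
    linarith
  · exact mul_left_cancel₀ hq (congrArg Prod.snd h)

theorem isCompact_reciprocals : IsCompact {τ : ℝ | τ = 0 ∨ ∃ n : ℕ, 1 ≤ n ∧ τ = 1 / (n : ℝ)} := by
  convert (tendsto_one_div_add_atTop_nhds_zero_nat (𝕜 := ℝ)).isCompact_insert_range using 1
  ext τ
  simp only [mem_ofPred_eq, mem_insert_iff, mem_range]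
  refine or_congr_right ⟨?_, ?_⟩
  · rintro ⟨n, hn, rfl⟩
    exact ⟨n - 1, by rw [← Nat.cast_add_one, Nat.sub_add_cancel hn]⟩
  · rintro ⟨n, rfl⟩
    exact ⟨n + 1, by omega, by rw [Nat.cast_add_one]⟩

theorem isCompact_leafSlopes : IsCompact leafSlopes := by
  convert isCompact_reciprocals.union (isCompact_reciprocals.image continuous_neg) using 1
  ext τ
  simp only [leafSlopes, mem_ofPred_eq, mem_union, mem_image]
  constructor
  · rintro (h | ⟨n, hn, h | h⟩)
    · exact Or.inl (Or.inl h)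
    · exact Or.inr ⟨1 / n, Or.inr ⟨n, hn, rfl⟩, h.symm⟩
    · exact Or.inl (Or.inr ⟨n, hn, h⟩)
  · rintro ((h | ⟨n, hn, h⟩) | ⟨σ, h | ⟨n, hn, h⟩, rfl⟩)
    · exact Or.inl h
    · exact Or.inr ⟨n, hn, Or.inr h⟩
    · exact Or.inl (by rw [h, neg_zero])
    · exact Or.inr ⟨n, hn, Or.inl (by rw [h])⟩

instance : CompactSpace fan := by
  rw [← isCompact_iff_compactSpace]
  have hK : IsCompact ((leafSlopes ×ˢ Icc (-1 : ℝ) 1) ∩ {p : ℝ × ℝ | 0 ≤ p.1 * p.2}) :=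
    (isCompact_leafSlopes.prod isCompact_Icc).inter_right
      (isClosed_le continuous_const (by fun_prop))
  convert hK.image (f := fun p : ℝ × ℝ => ((1 - |p.2|) * p.1, p.2)) (by fun_prop) using 1
  ext p
  constructor
  · rintro ⟨τ, hτ, h1, h2, h3⟩
    exact ⟨(τ, p.2), ⟨⟨hτ, abs_le.1 h1⟩, h3⟩, Prod.ext h2.symm rfl⟩
  · rintro ⟨⟨τ, t⟩, ⟨⟨hτ, ht⟩, h3⟩, rfl⟩
    exact ⟨τ, hτ, abs_le.2 ht, rfl, h3⟩

theorem circlePoint_mem_hawaiianEarring {m : ℕ} (hm : 1 ≤ m) (θ : ℝ) :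
    circlePoint (1 / m) θ ∈ hawaiianEarring := by
  refine ⟨m, hm, ?_⟩
  have := circlePoint_sq (1 / m) θ
  linear_combination this

theorem exists_circlePoint {p : ℝ × ℝ} (hp : p ∈ hawaiianEarring) :
    ∃ m : ℕ, 1 ≤ m ∧ ∃ θ : unitInterval, p = circlePoint (1 / m) θ := by
  obtain ⟨m, hm, h⟩ := hp
  have hm0 : (m : ℝ) ≠ 0 := by positivity
  have hc : (1 - m * p.1) ^ 2 + (m * p.2) ^ 2 = 1 := by
    field_simp at h
    linear_combination h
  obtain ⟨θ, hθ⟩ := exists_circle_param ⟨⟨1 - m * p.1, m * p.2⟩, by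
    refine mem_sphere_zero_iff_norm.2 ?_
    rw [← sq_eq_sq₀ (norm_nonneg _) zero_le_one, Complex.sq_norm,
      Complex.normSq_mk]
    linear_combination hc⟩
  have hθ' := congrArg (fun s : Circle => (s : ℂ)) hθ
  rw [Circle.coe_exp, Complex.exp_mul_I, ← Complex.ofReal_cos, ← Complex.ofReal_sin] at hθ'
  have h1 : Real.cos (2 * Real.pi * θ) = 1 - m * p.1 := by
    simpa [-Complex.ofReal_cos, -Complex.ofReal_sin] using congrArg Complex.re hθ'
  have h2 : Real.sin (2 * Real.pi * θ) = m * p.2 := by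
    simpa [-Complex.ofReal_cos, -Complex.ofReal_sin] using congrArg Complex.im hθ'
  refine ⟨m, hm, θ, Prod.ext ?_ ?_⟩
  · rw [circlePoint, h1]
    field_simp
    ring
  · rw [circlePoint, h2]
    field_simp

theorem hawaiianEarring_fst_nonneg {p : ℝ × ℝ} (hp : p ∈ hawaiianEarring) : 0 ≤ p.1 := by
  obtain ⟨m, hm, θ, rfl⟩ := exists_circlePoint hp
  exact mul_nonneg (by positivity) (by linarith [Real.cos_le_one (2 * Real.pi * θ)])

theorem hawaiianEarring_eq_zero {p : ℝ × ℝ} (hp : p ∈ hawaiianEarring) (h0 : p.1 = 0) :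
    p = (0, 0) := by
  obtain ⟨m, hm, θ, rfl⟩ := exists_circlePoint hp
  have := circlePoint_sq (1 / m) θ
  rw [h0] at this
  exact Prod.ext h0 (pow_eq_zero_iff two_ne_zero |>.1 (by linarith))

instance : CompactSpace hawaiianEarring := by
  rw [← isCompact_iff_compactSpace]
  convert (isCompact_reciprocals.prod (isCompact_Icc (a := (0 : ℝ)) (b := 1))).image
    continuous_circlePoint using 1
  ext p
  constructor
  · intro hp
    obtain ⟨m, hm, θ, rfl⟩ := exists_circlePoint hp
    exact ⟨(1 / m, θ), ⟨Or.inr ⟨m, hm, rfl⟩, θ.2⟩, rfl⟩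
  · rintro ⟨⟨τ, θ⟩, ⟨h | ⟨n, hn, h⟩, -⟩, rfl⟩
    · dsimp only at h ⊢
      rw [h, circlePoint_zero_left]
      exact earringPoint.2
    · dsimp only at h ⊢
      rw [h]
      exact circlePoint_mem_hawaiianEarring hn θ

/-- The map of the fan with its loops to space that sends the loop at `(q, t)` to the circle with
centre `(q, 0)` at height `t`. -/
noncomputable def fanLoopsEmbedding : FanLoops → (ℝ × ℝ) × ℝ :=
  ArcSpace.desc fanHeight fanHeight fanLimit (fun h => ((0, 0), (h : ℝ)))
    (fun w θ => (circlePoint (w : ℝ × ℝ).1 θ, (w : ℝ × ℝ).2))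
    (fun w => by rw [Icc.coe_zero, circlePoint_zero]; rfl)
    (fun w => by rw [Icc.coe_one, circlePoint_one]; rfl)
    (fun w hw θ => by rw [(hw : (w : ℝ × ℝ).1 = 0), circlePoint_zero_left]; rfl)

theorem fanLoopsEmbedding_arc (w : fan) (θ : unitInterval) :
    fanLoopsEmbedding (ArcSpace.arc _ _ _ w θ) =
      (circlePoint (w : ℝ × ℝ).1 θ, (w : ℝ × ℝ).2) := ArcSpace.desc_arc w θ

theorem continuous_fanLoopsEmbedding : Continuous fanLoopsEmbedding := by
  refine ArcSpace.continuous_desc (by fun_prop) (Continuous.prodMk ?_ (by fun_prop))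
  exact continuous_circlePoint.comp (by fun_prop :
    Continuous fun p : fan × unitInterval => ((p.1 : ℝ × ℝ).1, (p.2 : ℝ)))

theorem fanLoopsEmbedding_injective : Function.Injective fanLoopsEmbedding := by
  refine ArcSpace.desc_injective ?_ ?_ ?_
  · intro h h' e
    exact Subtype.ext (congrArg Prod.snd e)
  · intro w hw w' _ θ θ' h0 h1 h0' h1' e
    obtain ⟨e1, e2⟩ := circlePoint_injective hw h0 h1 h0' h1' (Prod.mk.inj e).1
    exact ⟨Subtype.ext (Prod.ext e1 (Prod.mk.inj e).2), Subtype.ext e2⟩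
  · intro h w hw θ h0 h1 e
    exact circlePoint_fst_ne_zero hw h0 h1 (congrArg (fun q => q.1.1) e).symm

/-- The cone over the earring in space, with its base in the plane of height `0` and its apex on the
axis at height `σ`. -/
def coneEmbedding (σ : ℝ) : TopCone hawaiianEarring → (ℝ × ℝ) × ℝ :=
  Quot.lift (fun q => ((σ * (1 - q.2) * (q.1 : ℝ × ℝ).1, σ * (1 - q.2) * (q.1 : ℝ × ℝ).2),
    σ * q.2)) (by
    rintro p q ⟨hp, hq⟩
    simp [hp, hq])

theorem coneEmbedding_mk (σ : ℝ) (p : hawaiianEarring) (t : unitInterval) :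
    coneEmbedding σ (Quot.mk _ (p, t)) =
      ((σ * (1 - t) * (p : ℝ × ℝ).1, σ * (1 - t) * (p : ℝ × ℝ).2), σ * t) := rfl

theorem continuous_coneEmbedding (σ : ℝ) : Continuous (coneEmbedding σ) :=
  continuous_quot_lift _ (by fun_prop)

theorem coneEmbedding_injective {σ : ℝ} (hσ : σ ≠ 0) : Function.Injective (coneEmbedding σ) := by
  rintro ⟨p, t⟩ ⟨p', t'⟩ h
  change coneEmbedding σ (Quot.mk _ (p, t)) = coneEmbedding σ (Quot.mk _ (p', t')) at h
  rw [coneEmbedding_mk, coneEmbedding_mk, Prod.mk.injEq, Prod.mk.injEq] at h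
  obtain ⟨⟨h1, h2⟩, h3⟩ := h
  obtain rfl : t = t' := Subtype.ext (mul_left_cancel₀ hσ h3)
  by_cases ht : t = 1
  · exact Quot.sound ⟨ht, ht⟩
  · have h4 : σ * (1 - (t : ℝ)) ≠ 0 :=
      mul_ne_zero hσ (sub_ne_zero.2 fun h => ht (Subtype.ext h.symm))
    rw [show p = p' from
      Subtype.ext (Prod.ext (mul_left_cancel₀ h4 h1) (mul_left_cancel₀ h4 h2))]

/-- The Griffiths space in space: one cone below and one above the plane of the two earrings, which
lie on different sides of a line through their common point. -/
def griffithsEmbedding : GriffithsSpace → (ℝ × ℝ) × ℝ :=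
  Quot.lift (Sum.elim (coneEmbedding (-1)) (coneEmbedding 1)) (by
    rintro _ _ ⟨rfl, rfl⟩
    simp [TopCone.ofBase, coneEmbedding, earringPoint])

theorem griffithsEmbedding_inl (p : hawaiianEarring) (t : unitInterval) :
    griffithsEmbedding (Quot.mk _ (Sum.inl (Quot.mk _ (p, t)))) =
      ((-1 * (1 - (t : ℝ)) * (p : ℝ × ℝ).1, -1 * (1 - (t : ℝ)) * (p : ℝ × ℝ).2), -1 * (t : ℝ)) :=
  rfl

theorem griffithsEmbedding_inr (p : hawaiianEarring) (t : unitInterval) :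
    griffithsEmbedding (Quot.mk _ (Sum.inr (Quot.mk _ (p, t)))) =
      ((1 * (1 - (t : ℝ)) * (p : ℝ × ℝ).1, 1 * (1 - (t : ℝ)) * (p : ℝ × ℝ).2), 1 * (t : ℝ)) :=
  rfl

theorem continuous_griffithsEmbedding : Continuous griffithsEmbedding :=
  continuous_quot_lift _ ((continuous_coneEmbedding _).sumElim (continuous_coneEmbedding _))

theorem eq_of_coneEmbedding_eq {a b : TopCone hawaiianEarring}
    (h : coneEmbedding (-1) a = coneEmbedding 1 b) :
    a = TopCone.ofBase earringPoint ∧ b = TopCone.ofBase earringPoint := by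
  obtain ⟨⟨p, t⟩, rfl⟩ := Quot.exists_rep a
  obtain ⟨⟨p', t'⟩, rfl⟩ := Quot.exists_rep b
  rw [coneEmbedding_mk, coneEmbedding_mk, Prod.mk.injEq, Prod.mk.injEq] at h
  obtain ⟨⟨h1, -⟩, h3⟩ := h
  have ht := t.2.1
  have ht' := t'.2.1
  obtain rfl : t = 0 := Subtype.ext (by rw [Icc.coe_zero]; linarith)
  obtain rfl : t' = 0 := Subtype.ext (by rw [Icc.coe_zero] at h3 ⊢; linarith)
  rw [Icc.coe_zero] at h1
  have hp := hawaiianEarring_fst_nonneg p.2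
  have hp' := hawaiianEarring_fst_nonneg p'.2
  have e : p = earringPoint := Subtype.ext (hawaiianEarring_eq_zero p.2 (by linarith))
  have e' : p' = earringPoint := Subtype.ext (hawaiianEarring_eq_zero p'.2 (by linarith))
  rw [e, e']
  exact ⟨rfl, rfl⟩

theorem griffithsEmbedding_injective : Function.Injective griffithsEmbedding := by
  rintro ⟨a | a⟩ ⟨b | b⟩ h
  · rw [coneEmbedding_injective (by norm_num) h]
  · obtain ⟨rfl, rfl⟩ := eq_of_coneEmbedding_eq h
    exact Quot.sound ⟨rfl, rfl⟩
  · obtain ⟨rfl, rfl⟩ := eq_of_coneEmbedding_eq h.symm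
    exact (Quot.sound ⟨rfl, rfl⟩).symm
  · rw [coneEmbedding_injective one_ne_zero h]

theorem fanLoopsEmbedding_pt_mem (h : Icc (-1 : ℝ) 1) :
    (((0, 0), (h : ℝ)) : (ℝ × ℝ) × ℝ) ∈ range griffithsEmbedding := by
  rcases le_total (h : ℝ) 0 with h0 | h0
  · refine ⟨Quot.mk _ (Sum.inl (Quot.mk _ (earringPoint, ⟨-h, by linarith,
      by linarith [h.2.1]⟩))), ?_⟩
    rw [griffithsEmbedding_inl]
    simp [earringPoint]
  · refine ⟨Quot.mk _ (Sum.inr (Quot.mk _ (earringPoint, ⟨h, h0, h.2.2⟩))), ?_⟩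
    rw [griffithsEmbedding_inr]
    simp [earringPoint]

theorem range_fanLoopsEmbedding : range fanLoopsEmbedding = range griffithsEmbedding := by
  refine Subset.antisymm ?_ ?_
  · rintro _ ⟨q, rfl⟩
    rcases ArcSpace.exists_rep q with ⟨h, rfl⟩ | ⟨w, hw, θ, -, -, rfl⟩
    · exact fanLoopsEmbedding_pt_mem h
    rw [fanLoopsEmbedding_arc]
    obtain ⟨τ, hτ, h1, h2, h3⟩ := w.2
    rw [abs_le] at h1
    rcases hτ with rfl | ⟨n, hn, rfl | rfl⟩
    · exact absurd (h2.trans (mul_zero _)) hw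
    · have hn0 : (0 : ℝ) < 1 / n := by positivity
      have ht : (w : ℝ × ℝ).2 ≤ 0 := by
        by_contra! hc
        nlinarith [mul_pos hn0 hc]
      rw [abs_of_nonpos ht] at h2
      refine ⟨Quot.mk _ (Sum.inl (Quot.mk _ (⟨_, circlePoint_mem_hawaiianEarring hn θ⟩,
        ⟨-(w : ℝ × ℝ).2, by linarith, by linarith⟩))), ?_⟩
      rw [griffithsEmbedding_inl, h2]
      refine Prod.ext (Prod.ext ?_ ?_) ?_ <;> dsimp only [circlePoint] <;> ring
    · have hn0 : (0 : ℝ) < 1 / n := by positivity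
      have ht : 0 ≤ (w : ℝ × ℝ).2 := nonneg_of_mul_nonneg_right h3 hn0
      rw [abs_of_nonneg ht] at h2
      refine ⟨Quot.mk _ (Sum.inr (Quot.mk _ (⟨_, circlePoint_mem_hawaiianEarring hn θ⟩,
        ⟨(w : ℝ × ℝ).2, ht, h1.2⟩))), ?_⟩
      rw [griffithsEmbedding_inr, h2]
      refine Prod.ext (Prod.ext ?_ ?_) ?_ <;> dsimp only [circlePoint] <;> ring
  · rintro _ ⟨⟨⟨⟨p, hp⟩, t⟩ | ⟨⟨p, hp⟩, t⟩⟩, rfl⟩ <;>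
    obtain ⟨m, hm, θ, rfl⟩ := exists_circlePoint hp <;>
    have ht0 := t.2.1 <;> have ht1 := t.2.2
    · have hw : ((1 - (t : ℝ)) * -(1 / (m : ℝ)), -(t : ℝ)) ∈ fan := by
        refine ⟨-(1 / m), Or.inr ⟨m, hm, Or.inl rfl⟩, abs_le.2 ⟨by linarith, by linarith⟩, ?_, ?_⟩
        · rw [abs_neg, abs_of_nonneg ht0]
        · have : 0 ≤ 1 / (m : ℝ) * t := by positivity
          dsimp only
          linarith
      refine ⟨ArcSpace.arc _ _ _ ⟨_, hw⟩ θ, ?_⟩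
      rw [fanLoopsEmbedding_arc]
      change _ = coneEmbedding (-1) (Quot.mk _ (_, t))
      rw [coneEmbedding_mk]
      refine Prod.ext (Prod.ext ?_ ?_) ?_ <;> dsimp only [circlePoint] <;> ring
    · have hw : ((1 - (t : ℝ)) * (1 / (m : ℝ)), (t : ℝ)) ∈ fan := by
        refine ⟨1 / m, Or.inr ⟨m, hm, Or.inr rfl⟩, abs_le.2 ⟨by linarith, by linarith⟩, ?_, ?_⟩
        · rw [abs_of_nonneg ht0]
        · dsimp only
          positivity
      refine ⟨ArcSpace.arc _ _ _ ⟨_, hw⟩ θ, ?_⟩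
      rw [fanLoopsEmbedding_arc]
      change _ = coneEmbedding 1 (Quot.mk _ (_, t))
      rw [coneEmbedding_mk]
      refine Prod.ext (Prod.ext ?_ ?_) ?_ <;> dsimp only [circlePoint] <;> ring

/-- The fan with its loops is the Griffiths space: the loops at the points of one leaf form the cone
over one circle of an earring, and the two halves of the limit line are the cones over the common
points of the circles. -/
theorem nonempty_homeomorph_griffithsSpace : Nonempty (FanLoops ≃ₜ GriffithsSpace) :=
  nonempty_homeomorph_of_range_eq continuous_fanLoopsEmbedding continuous_griffithsEmbedding
    fanLoopsEmbedding_injective griffithsEmbedding_injective range_fanLoopsEmbedding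

/-! ### The three cases -/

theorem nonempty_homotopyEquiv_griffithsSpace {y ε : ℝ} (hy : 0 < y) (hy2 : y ≤ 1 / 2)
    (hε : 0 ≤ ε) (hle : y + ε ≤ 1) : Nonempty (plSpace y ε ≃ₕ GriffithsSpace) := by
  rw [plSpace_eq_doubleSquare hy.le hε (by linarith) hle]
  obtain ⟨e₁⟩ := nonempty_homotopyEquiv_band hy hε hle
  obtain ⟨e₂⟩ := nonempty_homotopyEquiv_collarLoops (isBand_wave hy (by linarith))
  obtain ⟨e₃⟩ := nonempty_homotopyEquiv_fanLoops hy hy2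
  obtain ⟨e₄⟩ := nonempty_homeomorph_griffithsSpace
  exact ⟨((e₁.trans e₂).trans e₃).trans e₄.toHomotopyEquiv⟩

theorem theorem4p3 (y ε : ℝ) (hy0 : 0 ≤ y) (hy1 : y ≤ 1) (hε : 0 ≤ ε)
    (hpos : 0 < y + ε) (hle : y + ε ≤ 1) :
    (1 / 2 < y → ContractibleSpace (plSpace 1 0) ∧ ContractibleSpace (plSpace y ε)) ∧
    (y = 0 → ∀ s₀ : Circle, Nonempty (plSpace y ε ≃ₕ SCSpace Circle s₀)) ∧
    (0 < y → y ≤ 1 / 2 → Nonempty (plSpace y ε ≃ₕ GriffithsSpace)) := by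
  refine ⟨fun hy => ⟨contractibleSpace_plSpace le_rfl (by norm_num) (by norm_num),
    contractibleSpace_plSpace hε hle hy⟩, ?_, fun hy hy2 =>
    nonempty_homotopyEquiv_griffithsSpace hy hy2 hε hle⟩
  rintro rfl s₀
  exact nonempty_homotopyEquiv_of_eq_zero (by linarith) (by linarith) s₀
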